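/- Throughout, $d\ge 1$, $\|\cdot\|$ is the Euclidean norm on $\mathbb R^d$ and $\operatorname{erfc}(x)=\frac{2}{\sqrt\pi}\int_x^\infty e^{-y^2}\,dy$. **Max-stable processes and TCFs.** A family of spectral functions on a measure space $(S,\nu)$ is a family of measurable $V_t:S\to[0,\infty]$, $t\in\mathbb R^d$, with $\int V_t\,d\nu=1$. It defines, in law, the max-stable process $X_t=\sup_n U_nV_t(s_n)$, where $(U_n,s_n)_n$ is a Poisson point process on $(0,\infty)\times S$ with intensity $u^{-2}du\times\nu(ds)$; its marginals are standard Fréchet. The tail correlation function (TCF) of $X$ is $\chi(t)=\lim_{\tau\to\infty}\mathbb P(X_t\ge\tau\mid X_o\ge\tau)$, $t\in\mathbb R^d$. For a class of such processes, $T^d_{\text{class}}$ is the set of the TCFs on $\mathbb R^d$ of its members. The classes are: * *M3r.* $S=\mathbb R^d\times\Xi$ with $\nu$ the product of Lebesgue measure and a probability measure, $V_t(z,\xi)=f_\xi(t-z)$, where $f$ is a jointly measurable random function $\mathbb R^d\to[0,\infty]$ with $\mathbb E\int f=1$ all of whose realizations are radially symmetric around the origin and non-increasing in the radius. Moreover,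 $T^\infty_{M3r}$ is the set of functions $\varphi$ on $[0,\infty)$ with $\varphi(\|\cdot\|)\in T^d_{M3r}$ for all $d\ge1$. * *MPS (mixed Poisson storms).* The same construction with $f=\mu_d(\Lambda)\,\mathbf 1_{\Lambda^{-1}C}$, where $C$ is the typical cell of the stationary isotropic Poisson hyperplane mosaic of intensity $1$ in $\mathbb R^d$, $\Lambda$ is a random variable in $(0,\infty)$ independent of $C$, and $\mu_d(\lambda)=\kappa_{d-1}^d\lambda^d/(d^d\kappa_d^{d-1})$ is the reciprocal of the expected volume of $\lambda^{-1}C$, with $\kappa_d=\pi^{d/2}/\Gamma(1+d/2)$. * *BR (Brown–Resnick).* $\nu$ is a probability measure and $V_t=\exp(W_t-\sigma^2(t)/2)$ for a centred Gaussian process $W$ on $\mathbb R^d$ with stationary increments and $\sigma^2(t)=\operatorname{Var}W_t$; its variogram is $\gamma(t)=\mathbb E(W_t-W_o)^2$. We write $T^d_{BR,\mathrm{rad}}\subset T^d_{BR}$ for the TCFs that arise from those $W$ whose variogram is radially symmetric around the origin and grows monotonically to $\infty$ with the radius. * *VBR (variance-mixed Brown–Resnick).* $V_t=\exp(SW_t-S^2\sigma^2(t)/2)$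 with $W$ as before and a random variable $S$ in $(0,\infty)$ independent of $W$. **Proposition 4.1.** For every $d\ge1$: (a) For $\alpha\in\mathbb R$, the function $t\mapsto\operatorname{erfc}(\|t\|^\alpha)$ on $\mathbb R^d$ (with $0^0=1$, and $0^\alpha=0$ if $\alpha<0$) belongs to $T^d_{BR}$ if and only if $\alpha\in(0,1]$, and it belongs to $T^d_{BR,\mathrm{rad}}$ if and only if $\alpha\in(0,1]$. Moreover $T^d_{BR,\mathrm{rad}}\setminus T^d_{MPS}\ne\emptyset$; in particular $T^d_{BR}\setminus T^d_{MPS}\neq\emptyset$. (b) $T^d_{VBR}$ contains no function with compact support, and $T^d_{M3r}\setminus T^d_{VBR}\ne\emptyset$. Furthermore: (c) There is $d_0\ge1$ such that for all $d\ge d_0$ one has $T^\infty_{M3r}\setminus T^d_{BR}\ne\emptyset$; more precisely, the function $\varphi(r)=0.25\operatorname{erfc}(r)+0.75\operatorname{erfc}(5r)$ on $[0,\infty)$ satisfies $\varphi\in T^\infty_{M3r}$ and $\varphi(\|\cdot\|)\notin T^d_{BR}$. -/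

import Mathlib

open MeasureTheory ProbabilityTheory Filter Topology Set
open scoped ENNReal NNReal

namespace TailCorr

noncomputable section

/-- The space `ℝ^d` with the Euclidean norm. -/
abbrev E (d : ℕ) : Type := EuclideanSpace ℝ (Fin d)

/-- The complementary error function. -/
def erfc (x : ℝ) : ℝ := 2 / √Real.pi * ∫ y in Ioi x, Real.exp (-y ^ 2)

/-! ### Poisson point processes and max-stable processes -/

/-- The random points `x 0, x 1, …` form an (enumerated) Poisson point process on `S` with intensity
measure `μ`: the number of points in `A` is Poisson distributed with mean `μ A` (it is infinite if
`μ A = ∞`), and the numbers of points in disjoint sets are independent. -/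
structure IsPoissonProcess {Ω S : Type*} [MeasurableSpace Ω] [MeasurableSpace S]
    (P : Measure Ω) (x : ℕ → Ω → S) (μ : Measure S) : Prop where
  measurable : ∀ n, Measurable (x n)
  law_count : ∀ A : Set S, MeasurableSet A → μ A ≠ ∞ →
    HasLaw (fun ω => {n | x n ω ∈ A}.encard)
      ((poissonMeasure (μ A).toNNReal).map (Nat.cast : ℕ → ℕ∞)) P
  infinite_count : ∀ A : Set S, MeasurableSet A → μ A = ∞ →
    ∀ᵐ ω ∂P, {n | x n ω ∈ A}.encard = ⊤
  indep : ∀ (m : ℕ) (A : Fin m → Set S), (∀ i, MeasurableSet (A i)) →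
    Pairwise (fun i j => Disjoint (A i) (A j)) →
    iIndepFun (fun i ω => {n | x n ω ∈ A i}.encard) P

/-- The measure `u⁻² du` on `(0, ∞)`. -/
def radialIntensity : Measure ℝ :=
  (volume.restrict (Ioi 0)).withDensity (fun u => ENNReal.ofReal (u ^ 2)⁻¹)

/-- `V` is a family of spectral functions on the measure space `(S, ν)`, and the process `X` has the
same law (on the product `σ`-algebra, i.e. the same finite dimensional distributions) as
`sup_n U_n V_t(s_n)`, where `(U_n, s_n)` is a Poisson point process on `(0, ∞) × S` with intensity
`u⁻² du × ν(ds)`. Such a process takes values in `(0, ∞)` almost surely at each location and has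
standard Fréchet marginals. -/
structure HasSpectralRep {T Ω S : Type} [MeasurableSpace Ω] [MeasurableSpace S]
    (P : Measure Ω) (X : T → Ω → ℝ≥0∞) (ν : Measure S) (V : T → S → ℝ≥0∞) : Prop where
  measurable_spectral : ∀ t, Measurable (V t)
  lintegral_spectral : ∀ t, ∫⁻ s, V t s ∂ν = 1
  measurable : ∀ t, Measurable (X t)
  law_eq : ∃ (Ω₀ : Type) (_ : MeasurableSpace Ω₀) (P₀ : Measure Ω₀) (_ : IsProbabilityMeasure P₀)
    (η : ℕ → Ω₀ → ℝ × S), IsPoissonProcess P₀ η (radialIntensity.prod ν) ∧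
      P.map (fun ω t => X t ω) =
        P₀.map (fun ω t => ⨆ n, ENNReal.ofReal (η n ω).1 * V t (η n ω).2)

/-- `χ` is the tail correlation function of `X`:
`χ(t) = lim_{τ ↑ ∞} P(X_t ≥ τ | X_o ≥ τ)` for every `t` (the upper endpoint of the standard Fréchet
distribution is `∞`). -/
def IsTCF {d : ℕ} {Ω : Type} [MeasurableSpace Ω] (P : Measure Ω) (X : E d → Ω → ℝ≥0∞)
    (χ : E d → ℝ) : Prop :=
  ∀ t, Tendsto (fun τ : ℝ =>
      (P[|{ω | ENNReal.ofReal τ ≤ X 0 ω}] {ω | ENNReal.ofReal τ ≤ X t ω}).toReal)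
    atTop (𝓝 (χ t))

/-- `χ` is the tail correlation function of a max-stable process with spectral functions `V` on
`(S, ν)`. -/
def IsTCFOfSpectral {d : ℕ} {S : Type} [MeasurableSpace S] (ν : Measure S) (V : E d → S → ℝ≥0∞)
    (χ : E d → ℝ) : Prop :=
  ∃ (Ω : Type) (_ : MeasurableSpace Ω) (P : Measure Ω) (_ : IsProbabilityMeasure P)
    (X : E d → Ω → ℝ≥0∞), HasSpectralRep P X ν V ∧ IsTCF P X χ

/-! ### Mixed moving maxima -/

/-- The spectral functions `V_t(z, ξ) = f(t - z; ξ)` on `ℝ^d × Ξ` of the mixed moving maxima process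
with random shape function `f`, a process on the probability space `Ξ`. -/
def movingSpectral {d : ℕ} {Ξ : Type} (f : Ξ → E d → ℝ≥0∞) (t : E d) (p : E d × Ξ) : ℝ≥0∞ :=
  f p.2 (t - p.1)

/-- The class of tail correlation functions on `ℝ^d` of M3r processes: mixed moving maxima processes
all realizations of whose random shape function are radially symmetric around the origin and
non-increasing in the radius (this is what `radial` says). -/
def TM3r (d : ℕ) : Set (E d → ℝ) :=
  {χ | ∃ (Ξ : Type) (_ : MeasurableSpace Ξ) (Q : Measure Ξ) (_ : IsProbabilityMeasure Q)
    (f : Ξ → E d → ℝ≥0∞) (_measurable : Measurable (fun p : Ξ × E d => f p.1 p.2))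
    (_norm : ∫⁻ ξ, (∫⁻ x, f ξ x ∂volume) ∂Q = 1)
    (_radial : ∀ ξ x y, ‖x‖ ≤ ‖y‖ → f ξ y ≤ f ξ x),
    IsTCFOfSpectral ((volume : Measure (E d)).prod Q) (movingSpectral f) χ}

/-- The functions on `[0, ∞)` that are (as functions of the radius) tail correlation functions of
M3r processes in every dimension `d ≥ 1`. -/
def TM3rInfty : Set (ℝ≥0 → ℝ) :=
  {φ | ∀ d : ℕ, 1 ≤ d → (fun t : E d => φ ‖t‖₊) ∈ TM3r d}

/-! ### Mixed Poisson storms -/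

/-- The hyperplane `{x : ⟨x, u⟩ = r}` with unit normal vector `u`. -/
def hyperplane {d : ℕ} (p : Metric.sphere (0 : E d) 1 × ℝ) : Set (E d) :=
  {x | inner ℝ x (p.1 : E d) = p.2}

/-- The cells of the mosaic generated by countably many hyperplanes: the closures of the connected
components of the complement of their union. -/
def cells {d : ℕ} (h : ℕ → Metric.sphere (0 : E d) 1 × ℝ) : Set (Set (E d)) :=
  {K | ∃ x ∈ (⋃ n, hyperplane (h n))ᶜ,
    K = closure (connectedComponentIn (⋃ n, hyperplane (h n))ᶜ x)}

/-- The intensity measure of the stationary isotropic Poisson hyperplane process of intensity `1`: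
the normal vector is uniformly distributed on the sphere and the signed distance follows the
Lebesgue measure. -/
def hyperplaneIntensity (d : ℕ) : Measure (Metric.sphere (0 : E d) 1 × ℝ) :=
  (((volume : Measure (E d)).toSphere univ)⁻¹ • (volume : Measure (E d)).toSphere).prod volume

/-- The centre of gravity, used as the centre function of the cells. -/
def centroid {d : ℕ} (K : Set (E d)) : E d := ⨍ x in K, x ∂volume

/-- The half-open unit cube. -/
def unitCube (d : ℕ) : Set (E d) := {x | ∀ i, x i ∈ Ico (0 : ℝ) 1}

/-- The expected number of cells `K` with centre in the unit cube for which the centred cell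
`K - centroid K` lies in `𝒜`. -/
def cellIntensity {d : ℕ} {Ω : Type} [MeasurableSpace Ω] (P : Measure Ω)
    (h : ℕ → Ω → Metric.sphere (0 : E d) 1 × ℝ) (𝒜 : Set (Set (E d))) : ℝ≥0∞ :=
  ∫⁻ ω, (({K ∈ cells (fun n => h n ω) | centroid K ∈ unitCube d ∧
    (fun x => x - centroid K) '' K ∈ 𝒜}.encard : ℕ∞) : ℝ≥0∞) ∂P

/-- The random set `C` is distributed like the typical cell of the stationary isotropic Poisson
hyperplane mosaic of intensity `1`: its law is the Palm distribution of the centred cells. Here sets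
of subsets of `ℝ^d` are measured by the `σ`-algebra generated by the events `x ∈ C`. -/
structure IsTypicalCell {d : ℕ} {Ξ : Type} [MeasurableSpace Ξ] (Q : Measure Ξ)
    (C : Ξ → Set (E d)) : Prop where
  measurable : MeasurableSet {p : Ξ × E d | p.2 ∈ C p.1}
  law : ∃ (Ω : Type) (_ : MeasurableSpace Ω) (P : Measure Ω) (_ : IsProbabilityMeasure P)
    (h : ℕ → Ω → Metric.sphere (0 : E d) 1 × ℝ),
    IsPoissonProcess P h (hyperplaneIntensity d) ∧
    ∀ 𝒜 : Set (Set (E d)), MeasurableSet 𝒜 →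
      Q (C ⁻¹' 𝒜) = cellIntensity P h 𝒜 / cellIntensity P h univ

/-- The volume `κ_d` of the `d`-dimensional unit ball. -/
def kappa (d : ℕ) : ℝ := Real.pi ^ ((d : ℝ) / 2) / Real.Gamma (1 + (d : ℝ) / 2)

/-- The reciprocal of the expected volume of the typical cell of the mosaic of intensity `r`. -/
def cellNorm (d : ℕ) (r : ℝ) : ℝ := kappa (d - 1) ^ d * r ^ d / ((d : ℝ) ^ d * kappa d ^ (d - 1))

/-- The random shape function `μ_d(Λ) 1_{Λ⁻¹ C}`, where `Λ⁻¹ C = {x : Λ x ∈ C}`. -/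
def stormShape {d : ℕ} {Ξ : Type} (Λ : Ξ → ℝ) (C : Ξ → Set (E d)) (ξ : Ξ) : E d → ℝ≥0∞ :=
  {x : E d | Λ ξ • x ∈ C ξ}.indicator (fun _ => ENNReal.ofReal (cellNorm d (Λ ξ)))

/-- The class of tail correlation functions on `ℝ^d` of mixed Poisson storm processes, with random
intensity `Λ ∈ (0, ∞)` and an independent typical cell `C`. -/
def TMPS (d : ℕ) : Set (E d → ℝ) :=
  {χ | ∃ (Ξ : Type) (_ : MeasurableSpace Ξ) (Q : Measure Ξ) (_ : IsProbabilityMeasure Q)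
    (Λ : Ξ → ℝ) (C : Ξ → Set (E d)) (_measurable : Measurable Λ) (_pos : ∀ᵐ ξ ∂Q, 0 < Λ ξ)
    (_typical : IsTypicalCell Q C) (_indep : IndepFun Λ C Q),
    IsTCFOfSpectral ((volume : Measure (E d)).prod Q) (movingSpectral (stormShape Λ C)) χ}

/-! ### Brown-Resnick processes -/

/-- `W` is a centred Gaussian process on `ℝ^d` with stationary increments. -/
structure IsStationaryIncrementGaussian {d : ℕ} {Ξ : Type} [MeasurableSpace Ξ] (Q : Measure Ξ)
    (W : E d → Ξ → ℝ) : Prop where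
  measurable : ∀ t, Measurable (W t)
  gaussian : IsGaussianProcess W Q
  centred : ∀ t, ∫ ξ, W t ξ ∂Q = 0
  stationary : ∀ h h' : E d,
    Q.map (fun ξ t => W (t + h) ξ - W h ξ) = Q.map (fun ξ t => W (t + h') ξ - W h' ξ)

/-- The variogram `γ(t) = E (W_t - W_o)²`. -/
def variogram {d : ℕ} {Ξ : Type} [MeasurableSpace Ξ] (Q : Measure Ξ) (W : E d → Ξ → ℝ)
    (t : E d) : ℝ := ∫ ξ, (W t ξ - W 0 ξ) ^ 2 ∂Q

/-- The spectral process `exp (S W_t - S² σ²(t) / 2)`, where `σ²(t) = Var W_t`. -/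
def brSpectral {d : ℕ} {Ξ : Type} [MeasurableSpace Ξ] (Q : Measure Ξ) (S : Ξ → ℝ)
    (W : E d → Ξ → ℝ) (t : E d) (ξ : Ξ) : ℝ≥0∞ :=
  ENNReal.ofReal (Real.exp (S ξ * W t ξ - S ξ ^ 2 * variance (W t) Q / 2))

/-- `γ` is radially symmetric around the origin and grows monotonously to `∞` with the radius. -/
def RadialToInfty {d : ℕ} (γ : E d → ℝ) : Prop :=
  ∃ g : ℝ → ℝ, MonotoneOn g (Ici 0) ∧ Tendsto g atTop atTop ∧ ∀ t, γ t = g ‖t‖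

/-- The class of tail correlation functions on `ℝ^d` of Brown-Resnick processes. -/
def TBR (d : ℕ) : Set (E d → ℝ) :=
  {χ | ∃ (Ξ : Type) (_ : MeasurableSpace Ξ) (Q : Measure Ξ) (_ : IsProbabilityMeasure Q)
    (W : E d → Ξ → ℝ) (_gaussian : IsStationaryIncrementGaussian Q W),
    IsTCFOfSpectral Q (brSpectral Q (fun _ => 1) W) χ}

/-- The subclass arising from variograms that are radially symmetric and grow to `∞`. -/
def TBRRadial (d : ℕ) : Set (E d → ℝ) :=
  {χ | ∃ (Ξ : Type) (_ : MeasurableSpace Ξ) (Q : Measure Ξ) (_ : IsProbabilityMeasure Q)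
    (W : E d → Ξ → ℝ) (_gaussian : IsStationaryIncrementGaussian Q W)
    (_radial : RadialToInfty (variogram Q W)),
    IsTCFOfSpectral Q (brSpectral Q (fun _ => 1) W) χ}

/-- The class of tail correlation functions on `ℝ^d` of variance-mixed Brown-Resnick processes, with
a random factor `S ∈ (0, ∞)` that is independent of the Gaussian process `W`. -/
def TVBR (d : ℕ) : Set (E d → ℝ) :=
  {χ | ∃ (Ξ : Type) (_ : MeasurableSpace Ξ) (Q : Measure Ξ) (_ : IsProbabilityMeasure Q)
    (W : E d → Ξ → ℝ) (S : Ξ → ℝ) (_gaussian : IsStationaryIncrementGaussian Q W)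
    (_measurable : Measurable S) (_pos : ∀ᵐ ξ ∂Q, 0 < S ξ)
    (_indep : IndepFun S (fun ξ t => W t ξ) Q),
    IsTCFOfSpectral Q (brSpectral Q S W) χ}

/-- The radial subclass is indeed a subclass. -/
theorem TBRRadial_subset (d : ℕ) : TBRRadial d ⊆ TBR d := by
  rintro χ ⟨Ξ, m, Q, hQ, W, hW, -, h⟩
  exact ⟨Ξ, m, Q, hQ, W, hW, h⟩

/-- Brown-Resnick processes are the variance-mixed ones with `S = 1`. -/
theorem TBR_subset_TVBR (d : ℕ) : TBR d ⊆ TVBR d := by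
  rintro χ ⟨Ξ, m, Q, hQ, W, hW, h⟩
  exact ⟨Ξ, m, Q, hQ, W, fun _ => 1, hW, measurable_const, by simp,
    indepFun_const_left _ _, h⟩

end

end TailCorr

namespace TailCorr

noncomputable section

/-! ### The tail correlation function in terms of the spectral functions -/

/-! Everything rests on the formula χ(t) = ∫ min(V_0, V_t) dν. Void probabilities of the Poisson
process give P(X_s < y, X_t < y) = exp(-∫ max(V_s, V_t) dν / y). Inclusion–exclusion and a
first-order expansion in 1/τ turn the conditional exceedance probability into 2 - ∫ max(V_0, V_t) dν
= ∫ min(V_0, V_t) dν (`HasSpectralRep.tendsto_cond`). Conversely, Poisson processes exist for all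
s-finite intensities of infinite mass, so every normalized measurable spectral family has this
function as its TCF (`isTCFOfSpectral_of_lintegral`). Class membership thus becomes a question about
integrals.

For Brown–Resnick processes, tilting by one of the two lognormal factors gives χ = erfc √(γ/8), and
the admissible γ are exactly those for which γ(s - t) is a squared distance in a Hilbert space
(`mem_TBR_iff`).

(a) The triangle inequality for √γ forces α ∈ (0, 1], and the variogram of fractional Brownian
motion (or ‖t‖² for α = 1) realizes these exponents. Typical cells are convex, whence 2 χ(t) ≤
χ(t/2) + χ(3t/2) for almost every t and every MPS function (`ae_two_mul_le_of_mem_TMPS`). This fails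
for erfc √(‖t‖^(2β) + ‖t‖²) with small β > 0: the limiting profile erfc √(1 + r²) decreases linearly
in r² near 0, and 1/4 + 9/4 > 2.

(b) VBR spectral functions are strictly positive, hence so is χ, whereas the normalized indicator of
a ball yields an M3r function of compact support.

(c) Moving maxima with the normalized shape exp(-b ‖x‖²) have TCF erfc(√b ‖t‖ / 2) in every
dimension; mixing b = 4 and b = 100 gives φ. If φ were Brown–Resnick, then γ(t)/8 = g(‖t‖²) with
erfc √g(r²) = φ(r). Cauchy–Schwarz for sums over N points on orthogonal axes at squared distance T
and N further ones at squared distance h gives `IsHilbertVariogram.sq_le_mul`. As N → ∞ and T → ∞,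
where g(u) - u → log 4, it would become (g(h) - h)² ≤ log 4 · (2 g(h) - g(2h)). But g(h) = 16 h - 80
h² + o(h²), so the two sides behave like 225 h² and 160 log 4 · h² ≈ 221.8 h². Hence some finite N,
T, h already give a contradiction, in every dimension d ≥ 2N. -/

theorem radialIntensity_Ioi {a : ℝ} (ha : 0 < a) :
    radialIntensity (Ioi a) = ENNReal.ofReal a⁻¹ := by
  have hint : IntegrableOn (fun u : ℝ => (u ^ 2)⁻¹) (Ioi a) := by
    refine (integrableOn_Ioi_rpow_of_lt (a := -2) (by norm_num) ha).congr_fun ?_ measurableSet_Ioi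
    intro u hu
    have hu0 : (0 : ℝ) < u := ha.trans hu
    simp [Real.rpow_neg hu0.le]
  have hval : ∫ u in Ioi a, (u ^ 2)⁻¹ = a⁻¹ := by
    have h := integral_Ioi_rpow_of_lt (a := -2) (by norm_num) ha
    rw [← setIntegral_congr_fun measurableSet_Ioi (f := fun u : ℝ => u ^ (-2 : ℝ))] 
    · rw [h]; norm_num [Real.rpow_neg_one]
    · intro u hu
      have hu0 : (0 : ℝ) < u := ha.trans hu
      simp [Real.rpow_neg hu0.le]
  rw [radialIntensity, withDensity_apply _ measurableSet_Ioi,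
    Measure.restrict_restrict measurableSet_Ioi,
    inter_eq_self_of_subset_left (Ioi_subset_Ioi ha.le),
    ← ofReal_integral_eq_lintegral_ofReal hint (ae_of_all _ fun u => by positivity), hval]

theorem radialIntensity_Ioi_zero : radialIntensity (Ioi 0) = ∞ := by
  refine top_unique (ENNReal.le_of_forall_nnreal_lt fun r _ => ?_)
  have h : (0 : ℝ) < (r + 1 : ℝ)⁻¹ := by positivity
  calc (r : ℝ≥0∞) ≤ ENNReal.ofReal ((r + 1 : ℝ)⁻¹)⁻¹ := by
        rw [inv_inv, ← ENNReal.ofReal_coe_nnreal]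
        exact ENNReal.ofReal_le_ofReal (by linarith)
    _ = radialIntensity (Ioi (r + 1 : ℝ)⁻¹) := (radialIntensity_Ioi h).symm
    _ ≤ radialIntensity (Ioi 0) := measure_mono (Ioi_subset_Ioi h.le)

theorem radialIntensity_superlevel (m : ℝ≥0∞) {y : ℝ} (hy : 0 < y) :
    radialIntensity {u | ENNReal.ofReal y < ENNReal.ofReal u * m} = m / ENNReal.ofReal y := by
  have hy' : ENNReal.ofReal y ≠ 0 := by simpa using hy
  rcases eq_or_ne m ∞ with rfl | hm
  · rw [ENNReal.top_div_of_ne_top ENNReal.ofReal_ne_top]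
    refine Eq.trans ?_ radialIntensity_Ioi_zero
    congr 1
    ext u
    rcases le_or_gt u 0 with hu | hu
    · simp [ENNReal.ofReal_of_nonpos hu, hu]
    · simp [ENNReal.mul_top, hu]
  rcases eq_or_ne m 0 with rfl | hm0
  · simp
  have hpos := ENNReal.toReal_pos hm0 hm
  have : {u : ℝ | ENNReal.ofReal y < ENNReal.ofReal u * m} = Ioi (y / m.toReal) := by
    ext u
    rw [mem_ofPred_eq, mem_Ioi, div_lt_iff₀ hpos]
    nth_rw 1 [← ENNReal.ofReal_toReal hm]
    rw [← ENNReal.ofReal_mul' hpos.le, ENNReal.ofReal_lt_ofReal_iff']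
    constructor
    · exact fun h => h.1
    · exact fun h => ⟨h, hy.trans h⟩
  rw [this, radialIntensity_Ioi (by positivity), inv_div, ENNReal.ofReal_div_of_pos hy,
    ENNReal.ofReal_toReal hm]

/-- The void probabilities of a Poisson process. -/
theorem IsPoissonProcess.measure_void {Ω S : Type*} [MeasurableSpace Ω] [MeasurableSpace S]
    {P : Measure Ω} {x : ℕ → Ω → S} {μ : Measure S} (h : IsPoissonProcess P x μ) {A : Set S}
    (hA : MeasurableSet A) (hμ : μ A ≠ ∞) :
    P {ω | ∀ n, x n ω ∉ A} = ENNReal.ofReal (Real.exp (-(μ A).toReal)) := by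
  have hset : {ω | ∀ n, x n ω ∉ A} = {ω | {n | x n ω ∈ A}.encard = 0} := by
    ext ω
    simp [encard_eq_zero, eq_empty_iff_forall_notMem]
  have hl := h.law_count A hA hμ
  have : {ω | {n | x n ω ∈ A}.encard = 0} = (fun ω => {n | x n ω ∈ A}.encard) ⁻¹' {0} := rfl
  rw [hset, this, ← Measure.map_apply_of_aemeasurable hl.aemeasurable (measurableSet_singleton _),
    hl.map_eq, Measure.map_apply (by fun_prop) (measurableSet_singleton _)]
  have : (Nat.cast : ℕ → ℕ∞) ⁻¹' {0} = {0} := by ext; simp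
  rw [this, poissonMeasure_singleton]
  simp [ENNReal.coe_toNNReal_eq_toReal]

section Spectral

variable {T Ω S : Type} [MeasurableSpace Ω] [MeasurableSpace S] {P : Measure Ω}
  {X : T → Ω → ℝ≥0∞} {ν : Measure S} {V : T → S → ℝ≥0∞}

theorem prod_radialIntensity_superlevel [SFinite ν] {M : S → ℝ≥0∞} (hM : Measurable M) {y : ℝ}
    (hy : 0 < y) :
    radialIntensity.prod ν {p | ENNReal.ofReal y < ENNReal.ofReal p.1 * M p.2} =
      (∫⁻ s, M s ∂ν) / ENNReal.ofReal y := by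
  have hmeas : MeasurableSet {p : ℝ × S | ENNReal.ofReal y < ENNReal.ofReal p.1 * M p.2} :=
    measurableSet_lt measurable_const (by fun_prop)
  have : SFinite radialIntensity := by unfold radialIntensity; infer_instance
  rw [Measure.prod_apply_symm hmeas]
  simp_rw [preimage_ofPred_eq, radialIntensity_superlevel _ hy, ENNReal.div_eq_inv_mul]
  rw [lintegral_const_mul _ hM]

/-- The joint distribution function of a max-stable process at two locations. -/
theorem HasSpectralRep.measure_lt [SFinite ν] (h : HasSpectralRep P X ν V) (s t : T) {y : ℝ}
    (hy : 0 < y) :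
    P {ω | X s ω < ENNReal.ofReal y ∧ X t ω < ENNReal.ofReal y} =
      ENNReal.ofReal (Real.exp (-((∫⁻ z, max (V s z) (V t z) ∂ν).toReal / y))) := by
  obtain ⟨Ω₀, _, P₀, _, η, hη, hlaw⟩ := h.law_eq
  set M : S → ℝ≥0∞ := fun z => max (V s z) (V t z) with hMdef
  have hM : Measurable M := (h.measurable_spectral s).max (h.measurable_spectral t)
  have hMfin : ∫⁻ z, M z ∂ν ≠ ∞ := by
    refine ne_top_of_le_ne_top (b := ∫⁻ z, (V s z + V t z) ∂ν) ?_
      (lintegral_mono fun z => max_le le_self_add le_add_self)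
    rw [lintegral_add_left (h.measurable_spectral s), h.lintegral_spectral, h.lintegral_spectral]
    simp
  set Y : T → Ω₀ → ℝ≥0∞ := fun r ω => ⨆ n, ENNReal.ofReal (η n ω).1 * V r (η n ω).2 with hY
  have hYm : ∀ r, Measurable (Y r) := fun r => by
    have := hη.measurable
    have := h.measurable_spectral r
    fun_prop
  have htransfer : ∀ y : ℝ, P {ω | X s ω < ENNReal.ofReal y ∧ X t ω < ENNReal.ofReal y} =
      P₀ {ω | Y s ω < ENNReal.ofReal y ∧ Y t ω < ENNReal.ofReal y} := fun y => by
    have hB : MeasurableSet {x : T → ℝ≥0∞ | x s < ENNReal.ofReal y ∧ x t < ENNReal.ofReal y} :=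
      (measurableSet_lt (measurable_pi_apply s) measurable_const).inter
        (measurableSet_lt (measurable_pi_apply t) measurable_const)
    have := congrArg (fun m => m {x : T → ℝ≥0∞ | x s < ENNReal.ofReal y ∧ x t < ENNReal.ofReal y})
      hlaw
    rwa [Measure.map_apply (measurable_pi_lambda _ h.measurable) hB,
      Measure.map_apply (measurable_pi_lambda _ hYm) hB] at this
  have hle : ∀ y : ℝ, 0 < y → P₀ {ω | Y s ω ≤ ENNReal.ofReal y ∧ Y t ω ≤ ENNReal.ofReal y} =
      ENNReal.ofReal (Real.exp (-((∫⁻ z, M z ∂ν).toReal / y))) := fun y hy => by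
    have hset : {ω | Y s ω ≤ ENNReal.ofReal y ∧ Y t ω ≤ ENNReal.ofReal y} =
        {ω | ∀ n, η n ω ∉ {p : ℝ × S | ENNReal.ofReal y < ENNReal.ofReal p.1 * M p.2}} := by
      ext ω
      simp only [hY, hMdef, mem_ofPred_eq, iSup_le_iff, not_lt, mul_max, max_le_iff, forall_and]
    rw [hset, hη.measure_void (measurableSet_lt measurable_const (by fun_prop)),
      prod_radialIntensity_superlevel hM hy, ENNReal.toReal_div, ENNReal.toReal_ofReal hy.le]
    rw [prod_radialIntensity_superlevel hM hy]
    exact (ENNReal.div_lt_top hMfin (by simpa using hy)).ne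
  rw [htransfer]
  apply le_antisymm
  · rw [← hle y hy]
    exact measure_mono fun ω hω => ⟨hω.1.le, hω.2.le⟩
  · set θ := (∫⁻ z, M z ∂ν).toReal
    -- Void probabilities describe the events with `≤`. For z < y the event at level z with `≤` lies
    -- in the strict event at level y, and the right-hand side is continuous in the level.
    have hcont : Tendsto (fun z : ℝ => ENNReal.ofReal (Real.exp (-(θ / z)))) (𝓝[<] y)
        (𝓝 (ENNReal.ofReal (Real.exp (-(θ / y))))) := by
      refine Tendsto.mono_left ?_ nhdsWithin_le_nhds
      have : ContinuousAt (fun z : ℝ => Real.exp (-(θ / z))) y := by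
        have := hy.ne'
        fun_prop (disch := assumption)
      exact (ENNReal.continuous_ofReal.continuousAt.comp this).tendsto
    refine le_of_tendsto hcont ?_
    filter_upwards [Ioo_mem_nhdsLT hy] with z hz
    rw [← hle z hz.1]
    have := (ENNReal.ofReal_lt_ofReal_iff hy).2 hz.2
    exact measure_mono fun ω hω => ⟨hω.1.trans_lt this, hω.2.trans_lt this⟩

/-- By inclusion–exclusion the quotient is the conditional exceedance probability when θ is the
integral of the maximum. In x = 1/τ, numerator and denominator vanish at 0 with slopes 2 - θ and 1.
-/
theorem tendsto_tail_ratio (θ : ℝ) :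
    Tendsto (fun τ : ℝ => (1 - 2 * Real.exp (-(1 / τ)) + Real.exp (-(θ / τ))) /
      (1 - Real.exp (-(1 / τ)))) atTop (𝓝 (2 - θ)) := by
  have hz : Tendsto (fun τ : ℝ => τ⁻¹) atTop (𝓝[≠] 0) :=
    tendsto_inv_atTop_nhdsGT_zero.mono_right (nhdsWithin_mono _ fun x hx => ne_of_gt hx)
  have hd : ∀ c : ℝ, Tendsto (fun x : ℝ => x⁻¹ * (Real.exp (-(c * x)) - 1)) (𝓝[≠] 0) (𝓝 (-c)) := by
    intro c
    have h : HasDerivAt (fun x : ℝ => Real.exp (-(c * x))) (-c) 0 := by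
      have := (((hasDerivAt_id (0 : ℝ)).const_mul c).neg).exp
      simpa using this
    simpa using h.tendsto_slope_zero
  have h1 := hd 1
  have h2 := hd θ
  have h3 : Tendsto (fun x : ℝ => (-(2 * (x⁻¹ * (Real.exp (-(1 * x)) - 1))) +
      x⁻¹ * (Real.exp (-(θ * x)) - 1)) / (-(x⁻¹ * (Real.exp (-(1 * x)) - 1)))) (𝓝[≠] 0)
      (𝓝 ((-(2 * (-1)) + -θ) / (-(-1)))) :=
    (((h1.const_mul 2).neg).add h2).div h1.neg (by norm_num)
  have h4 := h3.comp hz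
  have : (-(2 * (-1)) + -θ) / (-(-1)) = 2 - θ := by ring
  rw [this] at h4
  refine h4.congr' ?_
  filter_upwards [eventually_gt_atTop 0] with τ hτ
  have e : Real.exp (-(1 / τ)) < 1 := by
    rw [Real.exp_lt_one_iff]; have : 0 < 1 / τ := by positivity
    linarith
  have e' : (1 - Real.exp (-(1 / τ))) ≠ 0 := by linarith
  simp only [Function.comp_apply, inv_inv]
  rw [one_mul, ← div_eq_mul_inv, ← one_div, div_eq_div_iff _ e']
  · ring
  · have : τ * (Real.exp (-(1 / τ)) - 1) ≠ 0 := mul_ne_zero hτ.ne' (by linarith)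
    simpa using this

end Spectral

section TCF

variable {d : ℕ} {S : Type} [MeasurableSpace S] {ν : Measure S} {V : E d → S → ℝ≥0∞}

theorem lintegral_min_add_max {f g : S → ℝ≥0∞} (hf : Measurable f) (hg : Measurable g) :
    ∫⁻ s, min (f s) (g s) ∂ν + ∫⁻ s, max (f s) (g s) ∂ν = ∫⁻ s, f s ∂ν + ∫⁻ s, g s ∂ν := by
  rw [← lintegral_add_left (hf.min hg), ← lintegral_add_left hf]
  exact lintegral_congr fun s => min_add_max _ _

/-- The tail correlation function is the integral of the minimum of two spectral functions. -/
theorem HasSpectralRep.tendsto_cond [SFinite ν] {Ω : Type} [MeasurableSpace Ω] {P : Measure Ω}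
    [IsProbabilityMeasure P] {X : E d → Ω → ℝ≥0∞} (h : HasSpectralRep P X ν V) (t : E d) :
    Tendsto (fun τ : ℝ =>
      (P[|{ω | ENNReal.ofReal τ ≤ X 0 ω}] {ω | ENNReal.ofReal τ ≤ X t ω}).toReal)
    atTop (𝓝 (∫⁻ s, min (V 0 s) (V t s) ∂ν).toReal) := by
  have hsum := lintegral_min_add_max (ν := ν) (h.measurable_spectral 0) (h.measurable_spectral t)
  rw [h.lintegral_spectral, h.lintegral_spectral] at hsum
  have hfin : ∫⁻ s, min (V 0 s) (V t s) ∂ν ≠ ∞ ∧ ∫⁻ s, max (V 0 s) (V t s) ∂ν ≠ ∞ := by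
    rw [← ENNReal.add_ne_top, hsum]; norm_num
  set θ := (∫⁻ s, max (V 0 s) (V t s) ∂ν).toReal with hθ
  have hval : (∫⁻ s, min (V 0 s) (V t s) ∂ν).toReal = 2 - θ := by
    have := congrArg ENNReal.toReal hsum
    rw [ENNReal.toReal_add hfin.1 hfin.2] at this
    norm_num at this
    linarith
  rw [hval]
  refine (tendsto_tail_ratio θ).congr' ?_
  filter_upwards [eventually_gt_atTop 0] with τ hτ
  set A := {ω | X 0 ω < ENNReal.ofReal τ} with hA
  set B := {ω | X t ω < ENNReal.ofReal τ} with hB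
  have hAm : MeasurableSet A := measurableSet_lt (h.measurable 0) measurable_const
  have hBm : MeasurableSet B := measurableSet_lt (h.measurable t) measurable_const
  have hAc : {ω | ENNReal.ofReal τ ≤ X 0 ω} = Aᶜ := by ext; simp [hA]
  have hBc : {ω | ENNReal.ofReal τ ≤ X t ω} = Bᶜ := by ext; simp [hB]
  have hPA : P.real A = Real.exp (-(1 / τ)) := by
    have := h.measure_lt 0 0 hτ
    simp only [and_self, max_self, h.lintegral_spectral, ENNReal.toReal_one] at this
    rw [measureReal_def, hA, this, ENNReal.toReal_ofReal (Real.exp_nonneg _)]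
  have hPB : P.real B = Real.exp (-(1 / τ)) := by
    have := h.measure_lt t t hτ
    simp only [and_self, max_self, h.lintegral_spectral, ENNReal.toReal_one] at this
    rw [measureReal_def, hB, this, ENNReal.toReal_ofReal (Real.exp_nonneg _)]
  have hPAB : P.real (A ∩ B) = Real.exp (-(θ / τ)) := by
    have := h.measure_lt 0 t hτ
    rw [measureReal_def]
    change (P {ω | X 0 ω < ENNReal.ofReal τ ∧ X t ω < ENNReal.ofReal τ}).toReal = _
    rw [this, ENNReal.toReal_ofReal (Real.exp_nonneg _)]
  have hunion : P.real (A ∪ B) = 2 * Real.exp (-(1 / τ)) - Real.exp (-(θ / τ)) := by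
    have := measureReal_union_add_inter (μ := P) (s := A) hBm
    linarith
  rw [hAc, hBc, cond_apply hAm.compl, ENNReal.toReal_mul, ENNReal.toReal_inv, ← compl_union]
  change _ = (P.real Aᶜ)⁻¹ * P.real (A ∪ B)ᶜ
  rw [probReal_compl_eq_one_sub hAm, probReal_compl_eq_one_sub (hAm.union hBm), hunion, hPA,
    div_eq_inv_mul]
  congr 1
  ring

theorem IsTCFOfSpectral.eq [SFinite ν] {χ : E d → ℝ} (h : IsTCFOfSpectral ν V χ) (t : E d) :
    χ t = (∫⁻ s, min (V 0 s) (V t s) ∂ν).toReal := by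
  obtain ⟨Ω, _, P, _, X, hX, hχ⟩ := h
  exact tendsto_nhds_unique (hχ t) (hX.tendsto_cond t)

theorem IsTCFOfSpectral.measurable {χ : E d → ℝ} (h : IsTCFOfSpectral ν V χ) (t : E d) :
    Measurable (V t) := by
  obtain ⟨Ω, _, P, _, X, hX, hχ⟩ := h
  exact hX.measurable_spectral t

theorem IsTCFOfSpectral.lintegral {χ : E d → ℝ} (h : IsTCFOfSpectral ν V χ) (t : E d) :
    ∫⁻ s, V t s ∂ν = 1 := by
  obtain ⟨Ω, _, P, _, X, hX, hχ⟩ := h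
  exact hX.lintegral_spectral t

end TCF

/-! ### Existence of Poisson processes -/

/-! ### Monotone limits of integer-valued counts -/

section Limits

variable {Ω : Type*} [MeasurableSpace Ω] {P : Measure Ω} [IsProbabilityMeasure P]

theorem setOf_iSup_cast_le {Ω : Type*} (M : ℕ → Ω → ℕ) (a : ℕ∞) :
    {ω | ⨆ K, (M K ω : ℕ∞) ≤ a} = ⋂ K, {ω | (M K ω : ℕ∞) ≤ a} := by
  ext ω; simp

/-- The event that all suprema are bounded is the decreasing intersection of the events at stage K,
so continuity from above applies. -/
theorem tendsto_measure_cast_le {ι : Type*} [Countable ι] {M : ι → ℕ → Ω → ℕ} (hM : ∀ i K, Measurable (M i K))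
    (hmono : ∀ i ω, Monotone fun K => M i K ω) (a : ι → ℕ∞) :
    Tendsto (fun K => P (⋂ i, {ω | (M i K ω : ℕ∞) ≤ a i})) atTop
      (𝓝 (P (⋂ i, {ω | ⨆ K, (M i K ω : ℕ∞) ≤ a i}))) := by
  have h : (⋂ i, {ω | ⨆ K, (M i K ω : ℕ∞) ≤ a i}) = ⋂ K, ⋂ i, {ω | (M i K ω : ℕ∞) ≤ a i} := by
    rw [iInter_comm]
    exact iInter_congr fun i => setOf_iSup_cast_le (M i) (a i)
  rw [h]
  refine tendsto_measure_iInter_atTop (fun K => ?_) ?_ ⟨0, measure_ne_top _ _⟩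
  · refine (MeasurableSet.iInter fun i => ?_).nullMeasurableSet
    have : Measurable fun ω => (M i K ω : ℕ∞) := (measurable_of_countable _).comp (hM i K)
    exact this (DiscreteMeasurableSpace.forall_measurableSet (Iic (a i)))
  · intro K L hKL ω hω
    simp only [mem_iInter, mem_ofPred_eq] at hω ⊢
    exact fun i => le_trans (by exact_mod_cast hmono i ω hKL) (hω i)

/-- Identifying the discrete σ-algebra with the Borel one lets the lower sets `Iic` serve as a
generating π-system, so that laws on `ℕ∞` are determined by their distribution functions. -/
theorem borel_enat : borel ℕ∞ = ⊤ := by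
  refine top_unique fun s _ => ?_
  have : @OpensMeasurableSpace ℕ∞ _ (borel ℕ∞) := @OpensMeasurableSpace.mk _ _ (borel ℕ∞) le_rfl
  exact @Set.Countable.measurableSet ℕ∞ (borel ℕ∞) (@OpensMeasurableSpace.toMeasurableSingletonClass _ _ (borel ℕ∞) _ _)
    s (to_countable s)

theorem measurable_iSup_cast {M : ℕ → Ω → ℕ} (hM : ∀ K, Measurable (M K)) :
    Measurable fun ω => ⨆ K, (M K ω : ℕ∞) := by
  have : BorelSpace ℕ∞ := ⟨borel_enat.symm⟩
  exact Measurable.iSup fun K => (measurable_of_countable _).comp (hM K)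

theorem generateFrom_range_Iic_enat :
    MeasurableSpace.generateFrom (range (Iic : ℕ∞ → Set ℕ∞)) = (⊤ : MeasurableSpace ℕ∞) := by
  rw [← borel_enat, borel_eq_generateFrom_Iic]

theorem tendsto_measure_cast_le_one {M : ℕ → Ω → ℕ} (hM : ∀ K, Measurable (M K)) (hmono : ∀ ω, Monotone fun K => M K ω)
    (a : ℕ∞) : Tendsto (fun K => P {ω | (M K ω : ℕ∞) ≤ a}) atTop
      (𝓝 (P {ω | ⨆ K, (M K ω : ℕ∞) ≤ a})) := by
  simpa only [iInter_const] using tendsto_measure_cast_le (P := P) (ι := Unit) (M := fun _ => M) (fun _ => hM)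
      (fun _ => hmono) fun _ => a

/-- On products of lower sets both the joint law and the product law are limits of their values at
stage K, where they agree. -/
theorem iIndepFun_iSup_cast {ι : Type*} [Fintype ι] {M : ι → ℕ → Ω → ℕ}
    (hM : ∀ i K, Measurable (M i K)) (hmono : ∀ i ω, Monotone fun K => M i K ω)
    (hind : ∀ K, iIndepFun (fun i => M i K) P) :
    iIndepFun (fun i ω => ⨆ K, (M i K ω : ℕ∞)) P := by
  have hZ : ∀ i, Measurable fun ω => ⨆ K, (M i K ω : ℕ∞) := fun i => measurable_iSup_cast (hM i)
  rw [iIndepFun_iff_map_fun_eq_pi_map fun i => (hZ i).aemeasurable]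
  have : ∀ i, IsProbabilityMeasure (P.map fun ω => ⨆ K, (M i K ω : ℕ∞)) := fun i =>
    Measure.isProbabilityMeasure_map (hZ i).aemeasurable
  refine (Measure.pi_eq_generateFrom (C := fun _ => range Iic)
    (fun _ => generateFrom_range_Iic_enat) (fun _ => isPiSystem_Iic)
    (fun i => ⟨fun _ => univ, fun _ => ⟨⊤, Iic_top⟩, fun _ => measure_lt_top _ _, iUnion_const _⟩)
    fun s hs => ?_).symm
  choose a ha using hs
  obtain rfl : (fun i => Iic (a i)) = s := funext ha
  rw [Measure.map_apply (measurable_pi_lambda _ hZ)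
    (MeasurableSet.univ_pi fun i => DiscreteMeasurableSpace.forall_measurableSet _)]
  have h1 := tendsto_measure_cast_le (P := P) hM hmono a
  have h2 : Tendsto (fun K => ∏ i, P {ω | (M i K ω : ℕ∞) ≤ a i}) atTop
      (𝓝 (∏ i, P {ω | ⨆ K, (M i K ω : ℕ∞) ≤ a i})) := by
    refine ENNReal.tendsto_finsetProd_of_ne_top _ (fun i _ => ?_) fun i _ => measure_ne_top _ _
    exact tendsto_measure_cast_le_one (hM i) (hmono i) (a i)
  have h3 : ∀ K, P (⋂ i, {ω | (M i K ω : ℕ∞) ≤ a i}) = ∏ i, P {ω | (M i K ω : ℕ∞) ≤ a i} := by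
    intro K
    have := (hind K).measure_inter_preimage_eq_mul Finset.univ (sets := fun i => {n | (n : ℕ∞) ≤ a i})
      (fun i _ => DiscreteMeasurableSpace.forall_measurableSet _)
    simpa using this
  simp_rw [h3] at h1
  have h4 := tendsto_nhds_unique h1 h2
  convert h4 using 2
  · ext ω; simp [Pi.le_def]
  · rw [Measure.map_apply (hZ _) (DiscreteMeasurableSpace.forall_measurableSet _)]
    rfl

theorem poissonMeasure_Iic (r : ℝ≥0) (n : ℕ) :
    poissonMeasure r (Iic n) =
      ENNReal.ofReal (∑ j ∈ Finset.range (n + 1), Real.exp (-r) * r ^ j / j.factorial) := by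
  rw [ENNReal.ofReal_sum_of_nonneg fun j _ => by positivity]
  have : (Iic n : Set ℕ) = ↑(Finset.range (n + 1)) := by ext; simp
  rw [this, ← sum_measure_singleton]
  exact Finset.sum_congr rfl fun j _ => poissonMeasure_singleton r j

theorem measure_cast_le_of_hasLaw {P : Measure Ω} {N : Ω → ℕ} {r : ℝ≥0} (h : HasLaw N (poissonMeasure r) P) (n : ℕ) :
    P {ω | (N ω : ℕ∞) ≤ n} = ENNReal.ofReal (∑ j ∈ Finset.range (n + 1), Real.exp (-r) * r ^ j / j.factorial) := by
  rw [← poissonMeasure_Iic, ← h.map_eq, Measure.map_apply_of_aemeasurable h.aemeasurable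
    (DiscreteMeasurableSpace.forall_measurableSet _)]
  congr 1; ext; simp

variable {M : ℕ → Ω → ℕ} {r : ℕ → ℝ≥0}

/-- Distribution functions pass to the limit, and that of the Poisson law is continuous in its
parameter. -/
theorem hasLaw_iSup_cast (hM : ∀ K, Measurable (M K)) (hmono : ∀ ω, Monotone fun K => M K ω)
    (hlaw : ∀ K, HasLaw (M K) (poissonMeasure (r K)) P) {ρ : ℝ≥0}
    (hr : Tendsto r atTop (𝓝 ρ)) :
    HasLaw (fun ω => ⨆ K, (M K ω : ℕ∞)) ((poissonMeasure ρ).map (Nat.cast : ℕ → ℕ∞)) P where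
  aemeasurable := (measurable_iSup_cast hM).aemeasurable
  map_eq := by
    have : IsProbabilityMeasure ((poissonMeasure ρ).map (Nat.cast : ℕ → ℕ∞)) :=
      Measure.isProbabilityMeasure_map (measurable_of_countable _).aemeasurable
    have hZ := measurable_iSup_cast hM
    have := Measure.isProbabilityMeasure_map (μ := P) hZ.aemeasurable
    refine ext_of_generate_finite (range (Iic : ℕ∞ → Set ℕ∞)) generateFrom_range_Iic_enat.symm
      isPiSystem_Iic ?_ (by simp)
    rintro _ ⟨a, rfl⟩
    cases a with
    | top => simp
    | coe n =>
      have hm : MeasurableSet (Iic (n : ℕ∞)) := DiscreteMeasurableSpace.forall_measurableSet _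
      rw [Measure.map_apply hZ hm, Measure.map_apply (measurable_of_countable _) hm]
      have h1 := tendsto_measure_cast_le_one (P := P) hM hmono n
      have h2 : Tendsto (fun K => P {ω | (M K ω : ℕ∞) ≤ n}) atTop (𝓝 (poissonMeasure ρ (Iic n))) := by
        simp_rw [measure_cast_le_of_hasLaw (hlaw _), poissonMeasure_Iic]
        refine (ENNReal.continuous_ofReal.tendsto _).comp ?_
        have hr' : Tendsto (fun K => (r K : ℝ)) atTop (𝓝 (ρ : ℝ)) := by exact_mod_cast hr
        have hc : Continuous fun x : ℝ => ∑ j ∈ Finset.range (n + 1), Real.exp (-x) * x ^ j / j.factorial := by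
          fun_prop
        exact (hc.tendsto _).comp hr'
      have h3 := tendsto_nhds_unique h1 h2
      rw [show Nat.cast ⁻¹' Iic (n : ℕ∞) = Iic n by ext; simp, ← h3]
      rfl

/-- For fixed n the probability that a Poisson variable is at most n tends to 0 as the parameter
grows. -/
theorem ae_iSup_cast_eq_top (hM : ∀ K, Measurable (M K)) (hmono : ∀ ω, Monotone fun K => M K ω)
    (hlaw : ∀ K, HasLaw (M K) (poissonMeasure (r K)) P) 
    (hr : Tendsto r atTop atTop) :
    ∀ᵐ ω ∂P, ⨆ K, (M K ω : ℕ∞) = ⊤ := by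
  have h0 : ∀ n : ℕ, P {ω | ⨆ K, (M K ω : ℕ∞) ≤ n} = 0 := by
    intro n
    refine tendsto_nhds_unique (tendsto_measure_cast_le_one (P := P) hM hmono n) ?_
    simp_rw [measure_cast_le_of_hasLaw (hlaw _)]
    rw [← ENNReal.ofReal_zero]
    refine (ENNReal.continuous_ofReal.tendsto _).comp ?_
    have hr' : Tendsto (fun K => (r K : ℝ)) atTop atTop := by exact_mod_cast hr
    have hc : Tendsto (fun x : ℝ => ∑ j ∈ Finset.range (n + 1), Real.exp (-x) * x ^ j / j.factorial)
        atTop (𝓝 (∑ j ∈ Finset.range (n + 1), 0)) := by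
      refine tendsto_finsetSum _ fun j _ => ?_
      have := (Real.tendsto_pow_mul_exp_neg_atTop_nhds_zero j).div_const (j.factorial : ℝ)
      simpa [mul_comm] using this
    simp only [Finset.sum_const_zero] at hc
    exact hc.comp hr'
  have : ∀ᵐ ω ∂P, ∀ n : ℕ, ¬ ⨆ K, (M K ω : ℕ∞) ≤ n := ae_all_iff.2 fun n => by
    rw [ae_iff]; simpa using h0 n
  filter_upwards [this] with ω hω
  by_contra hne
  obtain ⟨n, hn⟩ := ENat.ne_top_iff_exists.1 hne
  exact hω n hn.symm.le

end Limits

/-! ### Independent pieces of finite intensity and their characteristic functionals -/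

section Pieces

variable {S : Type} [MeasurableSpace S]

/-- The zero measure cannot be normalized; there a Dirac mass with weight 0 is used, which is why
`S` has to be nonempty. -/
theorem exists_probability_smul [Nonempty S] (m : Measure S) [IsFiniteMeasure m] :
    ∃ p : Measure S, IsProbabilityMeasure p ∧ m = (m univ).toNNReal • p := by
  rcases eq_or_ne m 0 with rfl | h
  · exact ⟨Measure.dirac (Classical.arbitrary S), inferInstance, by simp⟩
  · have h0 : m univ ≠ 0 := by simpa using h
    have := NeZero.mk h
    refine ⟨(m univ)⁻¹ • m, inferInstance, ?_⟩
    have e : (m univ).toNNReal • ((m univ)⁻¹ • m) = ((m univ).toNNReal : ℝ≥0∞) • ((m univ)⁻¹ • m) := rfl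
    rw [e, ENNReal.coe_toNNReal (measure_ne_top _ _), smul_smul,
      ENNReal.mul_inv_cancel h0 (measure_ne_top _ _), one_smul]

/-- The number of indices `j < n` such that `y j ∈ A`. -/
def countIn {S : Type*} (A : Set S) (ω : ℕ × (ℕ → S)) : ℕ :=
  open Classical in ∑ j ∈ Finset.range ω.1, if ω.2 j ∈ A then 1 else 0

/-- Given the number n of points, independence makes the integral the n-th power of c = ∫ exp(i f)
dp; the Poisson weights then sum to exp(r (c - 1)). -/
theorem integral_cexp_sum_piece {r : ℝ≥0} {p : Measure S} [IsProbabilityMeasure p] {f : S → ℝ}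
    (hf : Measurable f) :
    ∫ ω : ℕ × (ℕ → S), Complex.exp (∑ j ∈ Finset.range ω.1, f (ω.2 j) * Complex.I)
      ∂((poissonMeasure r).prod (Measure.infinitePi fun _ : ℕ => p)) =
    Complex.exp (∫ s, (Complex.exp (f s * Complex.I) - 1) ∂(r • p)) := by
  have hfin : ∀ n : ℕ, ∫ y : ℕ → S, Complex.exp (∑ j ∈ Finset.range n, f (y j) * Complex.I)
      ∂(Measure.infinitePi fun _ : ℕ => p) = (∫ s, Complex.exp (f s * Complex.I) ∂p) ^ n := by
    intro n
    have hind : iIndepFun (fun (j : Fin n) (y : ℕ → S) => Complex.exp (f (y j) * Complex.I))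
        (Measure.infinitePi fun _ : ℕ => p) := by
      have h := iIndepFun_infinitePi (P := fun _ : ℕ => p)
        (X := fun (_ : ℕ) s => Complex.exp (f s * Complex.I)) (fun _ => by fun_prop)
      exact h.precomp Fin.val_injective
    have h := hind.integral_fun_prod_eq_prod_integral fun j => by
      have : Measurable fun y : ℕ → S => Complex.exp (f (y j) * Complex.I) := by fun_prop
      exact this.aestronglyMeasurable
    have e : ∀ j : ℕ, ∫ y : ℕ → S, Complex.exp (f (y j) * Complex.I)
        ∂(Measure.infinitePi fun _ : ℕ => p) = ∫ s, Complex.exp (f s * Complex.I) ∂p := by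
      intro j
      have h1 := (measurePreserving_eval_infinitePi (fun _ : ℕ => p) j).map_eq
      conv_rhs => rw [← h1]
      rw [integral_map (measurable_pi_apply j).aemeasurable (by
        have : Measurable fun s => Complex.exp (f s * Complex.I) := by fun_prop
        exact this.aestronglyMeasurable)]
    simp_rw [e] at h
    rw [Finset.prod_const, Finset.card_univ, Fintype.card_fin] at h
    rw [← h]
    refine integral_congr_ae (ae_of_all _ fun y => ?_)
    simp only
    rw [Complex.exp_sum, Finset.prod_range]
  set c := ∫ s, Complex.exp (f s * Complex.I) ∂p with hc
  have hint : Integrable (fun s => Complex.exp (f s * Complex.I)) p := by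
    refine Integrable.of_bound (by
        have : Measurable fun s => Complex.exp (f s * Complex.I) := by fun_prop
        exact this.aestronglyMeasurable) 1 (ae_of_all _ fun s => ?_)
    rw [Complex.norm_exp_ofReal_mul_I]
  have hmeas : Measurable fun ω : ℕ × (ℕ → S) => Complex.exp (∑ j ∈ Finset.range ω.1, f (ω.2 j) * Complex.I) := by
    refine measurable_from_prod_countable_right fun n => ?_
    simp only
    fun_prop
  rw [integral_prod]
  · simp_rw [hfin]
    rw [integral_poissonMeasure, integral_smul_nnreal_measure, integral_sub hint (integrable_const _), ← hc]
    simp only [integral_const, probReal_univ, one_smul, NNReal.smul_def]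
    rw [Complex.real_smul, mul_sub, mul_one, Complex.exp_sub, div_eq_inv_mul, ← Complex.exp_neg]
    have h := (NormedSpace.expSeries_div_hasSum_exp ((r : ℂ) * c)).tsum_eq
    rw [← Complex.exp_eq_exp_ℂ] at h
    rw [← h, ← tsum_mul_left]
    refine tsum_congr fun n => ?_
    simp only [Complex.real_smul]
    push_cast
    ring
  · refine Integrable.of_bound hmeas.aestronglyMeasurable 1 (ae_of_all _ fun ω => ?_)
    rw [← Finset.sum_mul, ← Complex.ofReal_sum, Complex.norm_exp_ofReal_mul_I]

/-- The probability space of countably many independent pieces of a Poisson process. -/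
def pieces (r : ℕ → ℝ≥0) (p : ℕ → Measure S) : Measure (ℕ → ℕ × (ℕ → S)) :=
  Measure.infinitePi fun k => (poissonMeasure (r k)).prod (Measure.infinitePi fun _ : ℕ => p k)

variable {r : ℕ → ℝ≥0} {p : ℕ → Measure S} [∀ k, IsProbabilityMeasure (p k)]

instance : IsProbabilityMeasure (pieces r p) := by unfold pieces; infer_instance

theorem integral_cexp_sum_pieces (K : ℕ) {f : S → ℝ} (hf : Measurable f) :
    ∫ ω, Complex.exp (∑ k ∈ Finset.range K, ∑ j ∈ Finset.range (ω k).1, f ((ω k).2 j) * Complex.I)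
      ∂(pieces r p) =
    Complex.exp (∑ k ∈ Finset.range K, ∫ s, (Complex.exp (f s * Complex.I) - 1) ∂(r k • p k)) := by
  have hmeas : Measurable fun ω : ℕ × (ℕ → S) => Complex.exp (∑ j ∈ Finset.range ω.1, f (ω.2 j) * Complex.I) := by
    refine measurable_from_prod_countable_right fun n => ?_
    simp only
    fun_prop
  have hind := (iIndepFun_infinitePi
    (P := fun k => (poissonMeasure (r k)).prod (Measure.infinitePi fun _ : ℕ => p k))
    (X := fun (_ : ℕ) ω => Complex.exp (∑ j ∈ Finset.range ω.1, f (ω.2 j) * Complex.I))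
    (fun _ => hmeas)).precomp (Fin.val_injective (n := K))
  have h := hind.integral_fun_prod_eq_prod_integral fun k => by
      have := hmeas.comp (measurable_pi_apply (X := fun _ : ℕ => ℕ × (ℕ → S)) (k : ℕ))
      exact this.aestronglyMeasurable
  have e : ∀ k : ℕ, ∫ ω : ℕ → ℕ × (ℕ → S), Complex.exp (∑ j ∈ Finset.range (ω k).1, f ((ω k).2 j) * Complex.I)
        ∂(pieces r p) = Complex.exp (∫ s, (Complex.exp (f s * Complex.I) - 1) ∂(r k • p k)) := by
      intro k
      have h1 := (measurePreserving_eval_infinitePi (fun k => (poissonMeasure (r k)).prod (Measure.infinitePi fun _ : ℕ => p k)) k).map_eq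
      rw [← integral_cexp_sum_piece hf, ← h1, integral_map (measurable_pi_apply k).aemeasurable hmeas.aestronglyMeasurable]
      rfl
  have h' : ∫ ω, ∏ k : Fin K, Complex.exp (∑ j ∈ Finset.range (ω k).1, f ((ω k).2 j) * Complex.I) ∂(pieces r p) =
    ∏ k : Fin K, ∫ ω, Complex.exp (∑ j ∈ Finset.range (ω k).1, f ((ω k).2 j) * Complex.I) ∂(pieces r p) := h
  simp_rw [e] at h'
  rw [Complex.exp_sum, Finset.prod_range, ← h']
  refine integral_congr_ae (ae_of_all _ fun ω => ?_)
  simp only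
  rw [Complex.exp_sum, Finset.prod_range]

end Pieces

/-! ### Counts of points in finitely many pieces -/

section Counts

variable {S : Type} [MeasurableSpace S] {r : ℕ → ℝ≥0} {p : ℕ → Measure S}
  [∀ k, IsProbabilityMeasure (p k)]

theorem measurable_countIn {A : Set S} (hA : MeasurableSet A) : Measurable (countIn A) := by
  classical
  refine measurable_from_prod_countable_right fun n => ?_
  have h : ∀ j ∈ Finset.range n, Measurable fun y : ℕ → S => if y j ∈ A then 1 else 0 := fun j _ =>
    Measurable.ite ((measurable_pi_apply j) hA) measurable_const measurable_const
  exact Finset.measurable_fun_sum (M := ℕ) _ h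

/-- The number of points in `A` of the first `K` pieces. -/
def countUpTo {S : Type*} (A : Set S) (K : ℕ) (ω : ℕ → ℕ × (ℕ → S)) : ℕ :=
  ∑ k ∈ Finset.range K, countIn A (ω k)

theorem measurable_countUpTo {A : Set S} (hA : MeasurableSet A) (K : ℕ) :
    Measurable (countUpTo A K) :=
  Finset.measurable_fun_sum _ fun k _ => (measurable_countIn hA).comp (measurable_pi_apply k)

theorem monotone_countUpTo {S : Type*} (A : Set S) (ω : ℕ → ℕ × (ℕ → S)) :
    Monotone fun K => countUpTo A K ω := fun _ _ h =>
  Finset.sum_le_sum_of_subset (Finset.range_mono h)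

/-- The characteristic functional is applied to f = ∑ t_i 1_{A_i}. Disjointness makes exp(i f) - 1
additive over the A_i, so the joint characteristic function is a product of Poisson ones. Both the
laws and the independence of the counts are read off from this. -/
theorem integral_cexp_countUpTo {ι : Type*} [Fintype ι] {A : ι → Set S}
    (hA : ∀ i, MeasurableSet (A i)) (hd : Pairwise fun i j => Disjoint (A i) (A j)) (K : ℕ)
    (t : ι → ℝ) :
    ∫ ω, Complex.exp ((∑ i, countUpTo (A i) K ω * t i : ℝ) * Complex.I) ∂(pieces r p) =
      ∏ i, Complex.exp ((∑ k ∈ Finset.range K, r k * (p k (A i)).toNNReal : ℝ≥0) *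
        (Complex.exp (t i * Complex.I) - 1)) := by
  classical
  set f : S → ℝ := fun s => ∑ i, (A i).indicator (fun _ => t i) s with hf
  have hfm : Measurable f := Finset.measurable_fun_sum _ fun i _ =>
    measurable_const.indicator (hA i)
  have hpt : ∀ s, Complex.exp (f s * Complex.I) - 1 =
      ∑ i, (A i).indicator (fun _ => Complex.exp (t i * Complex.I) - 1) s := by
    intro s
    by_cases hs : ∃ i, s ∈ A i
    · obtain ⟨i, hi⟩ := hs
      have hne : ∀ j ≠ i, s ∉ A j := fun j hj hsj =>
        (hd hj).le_bot ⟨hsj, hi⟩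
      rw [hf]
      simp only
      rw [Finset.sum_eq_single i (fun j _ hj => indicator_of_notMem (hne j hj) _) (by simp),
        Finset.sum_eq_single i (fun j _ hj => indicator_of_notMem (hne j hj) _) (by simp),
        indicator_of_mem hi, indicator_of_mem hi]
    · push Not at hs
      simp [hf, hs]
  have h := integral_cexp_sum_pieces (r := r) (p := p) K hfm
  have hsum : ∀ ω : ℕ → ℕ × (ℕ → S), (∑ k ∈ Finset.range K, ∑ j ∈ Finset.range (ω k).1,
      f ((ω k).2 j) * Complex.I : ℂ) = (∑ i, countUpTo (A i) K ω * t i : ℝ) * Complex.I := by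
    intro ω
    simp_rw [← Finset.sum_mul, ← Complex.ofReal_sum]
    congr 2
    simp only [hf, countUpTo, countIn, Nat.cast_sum, Finset.sum_mul]
    simp_rw [Finset.sum_comm (t := Finset.univ) (s := Finset.range _)]
    refine Finset.sum_congr rfl fun i _ => Finset.sum_congr rfl fun k _ => Finset.sum_congr rfl fun j _ => ?_
    by_cases hi : (ω k).2 j ∈ A i <;> simp [hi]
  simp_rw [hsum, hpt] at h
  rw [h, ← Complex.exp_sum]
  congr 1
  have hk : ∀ k, ∫ s, ∑ i, (A i).indicator (fun _ => Complex.exp (t i * Complex.I) - 1) s ∂(r k • p k)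
      = ∑ i, (r k * (p k (A i)).toNNReal : ℝ≥0) * (Complex.exp (t i * Complex.I) - 1) := by
    intro k
    rw [integral_finsetSum _ fun i _ => (integrable_const _).indicator (hA i)]
    refine Finset.sum_congr rfl fun i _ => ?_
    rw [integral_indicator_const _ (hA i), Complex.real_smul]
    congr 1
    rw [measureReal_nnreal_smul_apply]
    simp [measureReal_def, ENNReal.coe_toNNReal_eq_toReal]
  simp_rw [hk]
  rw [Finset.sum_comm]
  refine Finset.sum_congr rfl fun i _ => ?_
  rw [← Finset.sum_mul]
  push_cast
  rfl

theorem hasLaw_countUpTo {A : Set S} (hA : MeasurableSet A) (K : ℕ) :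
    HasLaw (countUpTo A K)
      (poissonMeasure (∑ k ∈ Finset.range K, r k * (p k A).toNNReal)) (pieces r p) where
  aemeasurable := (measurable_countUpTo hA K).aemeasurable
  map_eq := by
    have hm := measurable_countUpTo hA K
    have hcast : Measurable (Nat.cast : ℕ → ℝ) := measurable_of_countable _
    -- Characteristic functions determine laws on ℝ; the floor map brings the identity back to ℕ.
    have hfloor : Measurable (Nat.floor : ℝ → ℕ) := Nat.measurable_floor
    have key : ((pieces r p).map (countUpTo A K)).map (Nat.cast : ℕ → ℝ) =
        (poissonMeasure (∑ k ∈ Finset.range K, r k * (p k A).toNNReal)).map (Nat.cast : ℕ → ℝ) := by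
      have := Measure.isProbabilityMeasure_map (μ := pieces r p) hm.aemeasurable
      refine Measure.ext_of_charFun (funext fun t => ?_)
      rw [charFun_map_cast_poissonMeasure, Measure.map_map hcast hm, charFun_apply,
        integral_map (hcast.comp hm).aemeasurable (by fun_prop)]
      have h := integral_cexp_countUpTo (r := r) (p := p) (ι := Unit) (fun _ => hA)
        (fun i j hij => (hij rfl).elim) K fun _ => t
      simp only [Finset.univ_unique, Finset.sum_singleton, Finset.prod_singleton] at h
      rw [← h]
      simp [mul_comm]
    have h2 := congrArg (Measure.map (Nat.floor : ℝ → ℕ)) key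
    rw [Measure.map_map hfloor hcast, Measure.map_map hfloor hcast] at h2
    have e : (Nat.floor : ℝ → ℕ) ∘ (Nat.cast : ℕ → ℝ) = id := by ext; simp
    simpa [e] using h2

theorem iIndepFun_countUpTo {ι : Type*} [Fintype ι] {A : ι → Set S}
    (hA : ∀ i, MeasurableSet (A i)) (hd : Pairwise fun i j => Disjoint (A i) (A j)) (K : ℕ) :
    iIndepFun (fun i => countUpTo (A i) K) (pieces r p) := by
  have hcast : Measurable (Nat.cast : ℕ → ℝ) := measurable_of_countable _
  have hm : ∀ i, Measurable fun ω => (countUpTo (A i) K ω : ℝ) := fun i =>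
    hcast.comp (measurable_countUpTo (hA i) K)
  have key : iIndepFun (fun i ω => (countUpTo (A i) K ω : ℝ)) (pieces r p) := by
    rw [iIndepFun_iff_charFun_pi fun i => (hm i).aemeasurable]
    intro t
    have h := integral_cexp_countUpTo (r := r) (p := p) hA hd K fun i => t i
    have hm2 : Measurable fun ω => WithLp.toLp 2 fun i => (countUpTo (A i) K ω : ℝ) :=
      (WithLp.measurable_toLp 2 _).comp (measurable_pi_lambda _ hm)
    rw [charFun_apply, integral_map hm2.aemeasurable (by fun_prop)]
    have e : ∀ i, charFun ((pieces r p).map fun ω => (countUpTo (A i) K ω : ℝ)) (t i) =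
        Complex.exp ((∑ k ∈ Finset.range K, r k * (p k (A i)).toNNReal : ℝ≥0) *
        (Complex.exp (t i * Complex.I) - 1)) := by
      intro i
      rw [← charFun_map_cast_poissonMeasure, ← (hasLaw_countUpTo (hA i) K).map_eq,
        Measure.map_map hcast (measurable_countUpTo (hA i) K)]
      rfl
    simp_rw [e]
    rw [← h]
    refine integral_congr_ae (ae_of_all _ fun ω => ?_)
    simp [PiLp.inner_apply, mul_comm]
  have h2 := key.comp (fun _ => (Nat.floor : ℝ → ℕ)) fun _ => Nat.measurable_floor
  convert h2 using 2
  ext ω; simp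

/-- The index set of the points that belong to `A`. -/
theorem encard_points {S : Type*} (A : Set S) (ω : ℕ → ℕ × (ℕ → S)) :
    {q : ℕ × ℕ | q.2 < (ω q.1).1 ∧ (ω q.1).2 q.2 ∈ A}.encard =
      ⨆ K, (countUpTo A K ω : ℕ∞) := by
  classical
  set D : ℕ → Finset (ℕ × ℕ) := fun K => ((Finset.range K).sigma fun k =>
    (Finset.range (ω k).1).filter fun j => (ω k).2 j ∈ A).map
      ⟨fun x => (x.1, x.2), fun x y h => by
        rcases x with ⟨a, b⟩; rcases y with ⟨a', b'⟩; simpa using h⟩ with hD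
  have hmem : ∀ K q, q ∈ D K ↔ q.1 < K ∧ q.2 < (ω q.1).1 ∧ (ω q.1).2 q.2 ∈ A := by
    rintro K ⟨k, j⟩
    simp only [hD, Finset.mem_map, Finset.mem_sigma, Finset.mem_range, Finset.mem_filter,
      Sigma.exists]
    constructor
    · rintro ⟨a, b, h, e⟩
      obtain ⟨rfl, rfl⟩ := Prod.mk.injEq .. ▸ e
      exact h
    · exact fun h => ⟨k, j, h, rfl⟩
  have hcard : ∀ K, (D K).card = countUpTo A K ω := by
    intro K
    simp only [hD, Finset.card_map, Finset.card_sigma, countUpTo, countIn, Finset.card_filter]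
  apply le_antisymm
  -- If the supremum is a finite n that falls short, n + 1 of the indices already lie in the first K
  -- pieces for some K, contradicting the count at stage K.
  · by_contra hlt
    push Not at hlt
    obtain ⟨n, hn⟩ := ENat.ne_top_iff_exists.1 hlt.ne_top
    rw [← hn] at hlt
    have h1 : ((n + 1 : ℕ) : ℕ∞) ≤ {q : ℕ × ℕ | q.2 < (ω q.1).1 ∧ (ω q.1).2 q.2 ∈ A}.encard := by
      push_cast
      exact Order.add_one_le_of_lt hlt
    obtain ⟨T, hT, hTc⟩ := Set.exists_subset_encard_eq h1
    have hTf : T.Finite := Set.finite_of_encard_eq_coe hTc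
    obtain ⟨K, hK⟩ : ∃ K, ∀ q ∈ T, q.1 < K := by
      obtain ⟨K, hK⟩ := (hTf.image Prod.fst).bddAbove
      exact ⟨K + 1, fun q hq => Nat.lt_succ_of_le (hK (mem_image_of_mem _ hq))⟩
    have hsub : T ⊆ D K := fun q hq => Finset.mem_coe.2 ((hmem K q).2 ⟨hK q hq, hT hq⟩)
    have h2 := Set.encard_le_encard hsub
    rw [hTc, Set.encard_coe_eq_coe_finsetCard, hcard] at h2
    have h3 : (countUpTo A K ω : ℕ∞) ≤ n := by
      rw [hn]; exact le_iSup (fun K => (countUpTo A K ω : ℕ∞)) K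
    have := h2.trans h3
    norm_cast at this
    omega
  · refine iSup_le fun K => ?_
    rw [← hcard, ← Set.encard_coe_eq_coe_finsetCard]
    exact Set.encard_le_encard fun q hq => ((hmem K q).1 (Finset.mem_coe.1 hq)).2

end Counts

/-! ### Enumerating the points of all pieces by a single index -/

section Enumeration

/-- The position of the `n`-th index (in the pairing order) with `q.2 < N q.1`. -/
def enumIndex (N : ℕ → ℕ) (n : ℕ) : ℕ × ℕ :=
  Nat.unpair (open Classical in
    if {m | (Nat.unpair m).2 < N (Nat.unpair m).1}.Infinite then
      Nat.nth (fun m => (Nat.unpair m).2 < N (Nat.unpair m).1) n else 0)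

theorem infinite_unpair_iff (N : ℕ → ℕ) :
    {m | (Nat.unpair m).2 < N (Nat.unpair m).1}.Infinite ↔
      {q : ℕ × ℕ | q.2 < N q.1}.Infinite := by
  have h : {q : ℕ × ℕ | q.2 < N q.1} =
      Nat.unpair '' {m | (Nat.unpair m).2 < N (Nat.unpair m).1} := by
    ext q
    constructor
    · intro hq
      exact ⟨Nat.pair q.1 q.2, by simpa using hq, by simp⟩
    · rintro ⟨m, hm, rfl⟩
      exact hm
  rw [h, Set.infinite_image_iff]
  exact Nat.pairEquiv.symm.injective.injOn

/-- For an infinite index set the enumeration is a bijection onto it, so counts are preserved. The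
default index 0 used for finite sets never enters. -/
theorem encard_enumIndex {N : ℕ → ℕ} (hN : {q : ℕ × ℕ | q.2 < N q.1}.Infinite)
    (B : Set (ℕ × ℕ)) :
    {n | enumIndex N n ∈ B}.encard = {q : ℕ × ℕ | q.2 < N q.1 ∧ q ∈ B}.encard := by
  rw [← infinite_unpair_iff] at hN
  have hinj : Function.Injective (enumIndex N) := by
    unfold enumIndex
    simp only [hN, if_true]
    exact Nat.pairEquiv.symm.injective.comp (Nat.nth_injective hN)
  have hrange : range (enumIndex N) = {q : ℕ × ℕ | q.2 < N q.1} := by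
    ext q
    simp only [mem_range, enumIndex, hN, if_true]
    constructor
    · rintro ⟨n, rfl⟩
      exact Nat.nth_mem_of_infinite hN n
    · intro hq
      have : Nat.pair q.1 q.2 ∈ range (Nat.nth fun m => (Nat.unpair m).2 < N (Nat.unpair m).1) := by
        rw [Nat.range_nth_of_infinite hN]
        simpa using hq
      obtain ⟨n, hn⟩ := this
      exact ⟨n, by rw [hn]; simp⟩
  rw [← hinj.encard_image]
  congr 1
  ext q
  constructor
  · rintro ⟨n, hn, rfl⟩
    exact ⟨hrange.subset (mem_range_self n), hn⟩
  · rintro ⟨hq, hB⟩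
    have : q ∈ range (enumIndex N) := hrange ▸ hq
    obtain ⟨n, rfl⟩ := this
    exact ⟨n, hB, rfl⟩

/-- The n-th admissible position equals m exactly when m is admissible and n admissible positions
precede it. This, together with the event of infinitely many positions, depends on countably many
coordinate conditions. -/
theorem measurable_enumIndex (n : ℕ) : Measurable fun N : ℕ → ℕ => enumIndex N n := by
  classical
  refine (measurable_of_countable _).comp ?_
  have hset : ∀ m : ℕ, MeasurableSet {N : ℕ → ℕ | (Nat.unpair m).2 < N (Nat.unpair m).1} := fun m =>
    measurableSet_lt measurable_const (measurable_pi_apply _)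
  have hinf : MeasurableSet
      {N : ℕ → ℕ | {m | (Nat.unpair m).2 < N (Nat.unpair m).1}.Infinite} := by
    simp_rw [Set.infinite_iff_exists_gt]
    have : {N : ℕ → ℕ | ∀ a : ℕ, ∃ b ∈ {m | (Nat.unpair m).2 < N (Nat.unpair m).1}, a < b} =
      ⋂ a : ℕ, ⋃ b : ℕ, ⋃ _ : a < b, {N | (Nat.unpair b).2 < N (Nat.unpair b).1} := by
      ext N; simp [and_comm]
    rw [this]
    exact .iInter fun a => .iUnion fun b => .iUnion fun _ => hset b
  have hcount : ∀ m, Measurable fun N : ℕ → ℕ =>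
      Nat.count (fun m => (Nat.unpair m).2 < N (Nat.unpair m).1) m := by
    intro m
    induction m with
    | zero => simp
    | succ m ih =>
      simp_rw [Nat.count_succ]
      exact ih.add (Measurable.ite (hset m) measurable_const measurable_const)
  refine measurable_to_countable' fun m => ?_
  have hs : MeasurableSet ({N : ℕ → ℕ | {m | (Nat.unpair m).2 < N (Nat.unpair m).1}.Infinite} ∩
      ({N | (Nat.unpair m).2 < N (Nat.unpair m).1} ∩
        {N | Nat.count (fun m => (Nat.unpair m).2 < N (Nat.unpair m).1) m = n})) :=
    hinf.inter ((hset m).inter (hcount m (measurableSet_singleton n)))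
  have hs' : MeasurableSet ({N : ℕ → ℕ | {m | (Nat.unpair m).2 < N (Nat.unpair m).1}.Infinite}ᶜ ∩
      {_N | (0 : ℕ) = m}) := hinf.compl.inter (MeasurableSet.const _)
  convert hs.union hs' using 1
  ext N
  by_cases hN : {m | (Nat.unpair m).2 < N (Nat.unpair m).1}.Infinite
  · simp only [mem_preimage, hN, if_true, mem_singleton_iff, mem_union, mem_inter_iff, mem_ofPred_eq,
      true_and, mem_compl_iff, not_true_eq_false, false_and, or_false]
    constructor
    · rintro rfl
      exact ⟨Nat.nth_mem_of_infinite hN n, Nat.count_nth_of_infinite hN n⟩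
    · rintro ⟨hm, rfl⟩
      exact Nat.nth_count hm
  · simp [hN]

end Enumeration

/-! ### Existence for s-finite intensities, and TCFs from spectral functions -/

section Existence

variable {S : Type} [MeasurableSpace S]

theorem tendsto_sum_pieces {r : ℕ → ℝ≥0} {p : ℕ → Measure S} [∀ k, IsProbabilityMeasure (p k)]
    {μ : Measure S} (hμ : Measure.sum (fun k => r k • p k) = μ) {A : Set S} (hA : MeasurableSet A) :
    Tendsto (fun K => ((∑ k ∈ Finset.range K, r k * (p k A).toNNReal : ℝ≥0) : ℝ≥0∞)) atTop
      (𝓝 (μ A)) := by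
  rw [← hμ, Measure.sum_apply _ hA]
  have := ENNReal.tendsto_nat_tsum fun k => (r k • p k) A
  refine this.congr fun K => ?_
  push_cast
  refine Finset.sum_congr rfl fun k _ => ?_
  rw [ENNReal.coe_toNNReal (measure_ne_top _ _)]
  rfl

/-- Every `s`-finite measure of infinite total mass is the intensity of a Poisson process. -/
theorem exists_isPoissonProcess (μ : Measure S) [SFinite μ] (hμ : μ univ = ∞) :
    ∃ (Ω : Type) (_ : MeasurableSpace Ω) (P : Measure Ω) (_ : IsProbabilityMeasure P)
      (x : ℕ → Ω → S), IsPoissonProcess P x μ := by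
  have hne : Nonempty S := by
    by_contra h
    rw [not_nonempty_iff] at h
    simp [univ_eq_empty_iff.2 h] at hμ
  choose p hp hpr using fun k => exists_probability_smul (sfiniteSeq μ k)
  set r : ℕ → ℝ≥0 := fun k => (sfiniteSeq μ k univ).toNNReal with hr
  have hsum : Measure.sum (fun k => r k • p k) = μ := by
    conv_rhs => rw [← sum_sfiniteSeq μ]
    congr 1
    exact funext fun k => (hpr k).symm
  set x : ℕ → (ℕ → ℕ × (ℕ → S)) → S := fun n ω =>
    (fun q : ℕ × ℕ => (ω q.1).2 q.2) (enumIndex (fun k => (ω k).1) n) with hx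
  have htop : ∀ A : Set S, MeasurableSet A → μ A = ∞ →
      ∀ᵐ ω ∂(pieces r p), ⨆ K, (countUpTo A K ω : ℕ∞) = ⊤ := by
    intro A hA hA'
    refine ae_iSup_cast_eq_top (fun K => measurable_countUpTo hA K) (monotone_countUpTo A)
      (fun K => hasLaw_countUpTo hA K) ?_
    have := tendsto_sum_pieces hsum hA
    rw [hA'] at this
    exact ENNReal.tendsto_coe_nhds_top.1 this
  have hcount : ∀ᵐ ω ∂(pieces r p), ∀ A : Set S,
      {n | x n ω ∈ A}.encard = ⨆ K, (countUpTo A K ω : ℕ∞) := by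
    -- Infinite total mass makes the number of points almost surely infinite, so the enumeration
    -- lists each point exactly once.
    filter_upwards [htop univ .univ hμ] with ω hω A
    rw [← encard_points] at hω ⊢
    have hinf : {q : ℕ × ℕ | q.2 < (ω q.1).1}.Infinite := by
      rw [← Set.encard_eq_top_iff]; simpa using hω
    exact encard_enumIndex hinf {q | (ω q.1).2 q.2 ∈ A}
  refine ⟨_, inferInstance, pieces r p, inferInstance, x, ?_, ?_, ?_, ?_⟩
  · intro n
    have h1 : Measurable fun ω : ℕ → ℕ × (ℕ → S) => enumIndex (fun k => (ω k).1) n :=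
      (measurable_enumIndex n).comp (measurable_pi_lambda _ fun k =>
        measurable_fst.comp (measurable_pi_apply k))
    have h2 : Measurable fun z : (ℕ × ℕ) × (ℕ → ℕ × (ℕ → S)) => (z.2 z.1.1).2 z.1.2 :=
      measurable_from_prod_countable_right fun q => by
        simp only
        fun_prop
    exact h2.comp (h1.prodMk measurable_id)
  · intro A hA hA'
    have h := hasLaw_iSup_cast (P := pieces r p) (ρ := (μ A).toNNReal)
      (fun K => measurable_countUpTo hA K) (monotone_countUpTo A)
      (fun K => hasLaw_countUpTo hA K) (by
        have := tendsto_sum_pieces hsum hA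
        rw [← ENNReal.coe_toNNReal hA'] at this
        exact ENNReal.tendsto_coe.1 this)
    exact h.congr (by filter_upwards [hcount] with ω hω using hω A)
  · intro A hA hA'
    filter_upwards [hcount, htop A hA hA'] with ω h1 h2
    rw [h1, h2]
  · intro m A hA hd
    refine (iIndepFun_iSup_cast (P := pieces r p) (fun i K => measurable_countUpTo (hA i) K)
      (fun i => monotone_countUpTo (A i)) fun K => iIndepFun_countUpTo hA hd K).congr fun i => ?_
    filter_upwards [hcount] with ω hω using (hω (A i)).symm

/-- A family of normalized spectral functions has a tail correlation function. -/
theorem isTCFOfSpectral_of_lintegral {d : ℕ} {ν : Measure S} [SFinite ν] {V : E d → S → ℝ≥0∞}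
    (hV : ∀ t, Measurable (V t)) (hV1 : ∀ t, ∫⁻ s, V t s ∂ν = 1) {χ : E d → ℝ}
    (hχ : ∀ t, χ t = (∫⁻ s, min (V 0 s) (V t s) ∂ν).toReal) : IsTCFOfSpectral ν V χ := by
  have hr : SFinite radialIntensity := by unfold radialIntensity; infer_instance
  have hν : ν univ ≠ 0 := by
    intro h0
    have := hV1 0
    rw [Measure.measure_univ_eq_zero.1 h0] at this
    simp at this
  have hinf : (radialIntensity.prod ν) univ = ∞ := by
    rw [← univ_prod_univ, Measure.prod_prod]
    have : radialIntensity univ = ∞ := by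
      rw [← top_le_iff, ← radialIntensity_Ioi_zero]; exact measure_mono (subset_univ _)
    rw [this, ENNReal.top_mul hν]
  obtain ⟨Ω, _, P, _, η, hη⟩ := exists_isPoissonProcess _ hinf
  have hX : HasSpectralRep P (fun t ω => ⨆ n, ENNReal.ofReal (η n ω).1 * V t (η n ω).2) ν V :=
    ⟨hV, hV1, fun t => by
      have := hη.measurable
      have := hV t
      fun_prop, Ω, _, P, inferInstance, η, hη, rfl⟩
  exact ⟨Ω, _, P, inferInstance, _, hX, fun t => hχ t ▸ hX.tendsto_cond t⟩

end Existence

/-! ### The complementary error function -/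

theorem integrable_exp_neg_sq : Integrable fun y : ℝ => Real.exp (-y ^ 2) := by
  simpa using integrable_exp_neg_mul_sq (b := 1) one_pos

theorem continuous_exp_neg_sq : Continuous fun y : ℝ => Real.exp (-y ^ 2) := by fun_prop

theorem erfc_zero : erfc 0 = 1 := by
  have h := integral_gaussian_Ioi 1
  simp only [neg_mul, one_mul, div_one] at h
  rw [erfc, h]
  have : √Real.pi ≠ 0 := by positivity
  field_simp

theorem erfc_sub_erfc (x y : ℝ) :
    erfc x - erfc y = 2 / √Real.pi * ∫ t in x..y, Real.exp (-t ^ 2) := by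
  rw [erfc, erfc, ← mul_sub, intervalIntegral.integral_Ioi_sub_Ioi']
  · exact integrable_exp_neg_sq.integrableOn
  · exact integrable_exp_neg_sq.integrableOn

theorem erfc_eq (x : ℝ) : erfc x = 1 - 2 / √Real.pi * ∫ t in (0 : ℝ)..x, Real.exp (-t ^ 2) := by
  rw [← erfc_sub_erfc, erfc_zero]; ring

theorem hasDerivAt_erfc (x : ℝ) : HasDerivAt erfc (-(2 / √Real.pi * Real.exp (-x ^ 2))) x := by
  have h := (intervalIntegral.integral_hasDerivAt_right
    (continuous_exp_neg_sq.intervalIntegrable 0 x)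
    (continuous_exp_neg_sq.stronglyMeasurableAtFilter _ _) continuous_exp_neg_sq.continuousAt)
  have h2 := (h.const_mul (2 / √Real.pi)).const_sub 1
  exact h2.congr_of_eventuallyEq (Eventually.of_forall erfc_eq)

theorem continuous_erfc : Continuous erfc :=
  continuous_iff_continuousAt.2 fun x => (hasDerivAt_erfc x).continuousAt

theorem strictAnti_erfc : StrictAnti erfc := by
  refine strictAnti_of_deriv_neg fun x => ?_
  rw [(hasDerivAt_erfc x).deriv, neg_lt_zero]
  positivity

theorem tendsto_erfc_atTop : Tendsto erfc atTop (𝓝 0) := by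
  have h := intervalIntegral_tendsto_integral_Ioi 0 integrable_exp_neg_sq.integrableOn tendsto_id
  have h2 := (h.const_mul (2 / √Real.pi)).const_sub 1
  have h3 : 2 / √Real.pi * ∫ y in Ioi (0 : ℝ), Real.exp (-y ^ 2) = 1 := erfc_zero
  rw [h3, sub_self] at h2
  exact h2.congr fun x => (erfc_eq x).symm

theorem erfc_pos (x : ℝ) : 0 < erfc x := by
  have h1 : 0 ≤ erfc (x + 1) := by
    unfold erfc; positivity
  exact h1.trans_lt (strictAnti_erfc (by linarith))

/-- Variance 1/2 is the normalization with density exp(-x²)/√π. -/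
theorem gaussianReal_half_Ioi (a : ℝ) :
    gaussianReal 0 (1 / 2) (Ioi a) = ENNReal.ofReal (erfc a / 2) := by
  rw [gaussianReal_apply_eq_integral _ (by norm_num)]
  congr 1
  rw [erfc, mul_div_right_comm, ← integral_const_mul]
  refine setIntegral_congr_fun measurableSet_Ioi fun x _ => ?_
  simp only [gaussianPDFReal]
  norm_num
  have : √2 ≠ 0 := by positivity
  field_simp

/-- `E min(1, e^X)` for a normal random variable `X` with `E e^X = 1`. -/
theorem lintegral_min_one_exp_gaussianReal (v : ℝ≥0) :
    ∫⁻ x, ENNReal.ofReal (min 1 (Real.exp x)) ∂(gaussianReal (-(v / 2)) v) =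
      ENNReal.ofReal (erfc √(v / 8)) := by
  rcases eq_or_ne v 0 with rfl | hv
  · simp [erfc_zero]
  have hv' : (0 : ℝ) < v := by positivity
  have := nullSingletonClass_gaussianReal (μ := -(v / 2 : ℝ)) hv
  -- Exponential tilting: multiplication by e^x moves the mean from -v/2 to v/2 and keeps the
  -- variance.
  have hshift : ∀ x, Real.exp x * gaussianPDFReal (-(v / 2)) v x = gaussianPDFReal (v / 2) v x := by
    intro x
    simp only [gaussianPDFReal]
    rw [mul_left_comm, ← Real.exp_add]
    congr 2
    field_simp
    ring
  -- Scaling the law of variance 1/2 by √(2v) produces variance v, and the threshold v/2 corresponds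
  -- to √(v/8).
  have hIoi : gaussianReal (-(v / 2)) v (Ioi 0) = ENNReal.ofReal (erfc √(v / 8) / 2) := by
    rw [← gaussianReal_half_Ioi]
    have h1 := gaussianReal_map_const_mul (μ := 0) (v := 1 / 2) √(2 * v)
    have h2 := gaussianReal_map_add_const (μ := 0) (v := v) (-(v / 2 : ℝ))
    have e : (NNReal.mk (√(2 * v) ^ 2) (sq_nonneg _) * (1 / 2) : ℝ≥0) = v := by
      ext
      simp only [NNReal.coe_mul, NNReal.coe_mk, Real.sq_sqrt (show (0 : ℝ) ≤ 2 * v by positivity)]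
      push_cast
      ring
    rw [mul_zero, e] at h1
    rw [zero_add, ← h1, Measure.map_map (by fun_prop) (by fun_prop)] at h2
    rw [← h2, Measure.map_apply (by fun_prop) measurableSet_Ioi]
    congr 1
    ext x
    have hs : √(2 * v : ℝ) * √(v / 8) = v / 2 := by
      rw [← Real.sqrt_mul (by positivity), show (2 * v * (v / 8) : ℝ) = (v / 2) ^ 2 by ring,
        Real.sqrt_sq (by positivity)]
    have hp : 0 < √(2 * v : ℝ) := by positivity
    simp only [mem_preimage, Function.comp_apply, mem_Ioi]
    rw [← mul_lt_mul_iff_right₀ hp (b := √(v / 8 : ℝ)), hs]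
    constructor <;> intro h <;> linarith
  have hIic : gaussianReal (v / 2) v (Iic 0) = gaussianReal (-(v / 2)) v (Ioi 0) := by
    rw [← gaussianReal_map_neg, Measure.map_apply (by fun_prop) measurableSet_Ioi]
    have := nullSingletonClass_gaussianReal (μ := (v / 2 : ℝ)) hv
    rw [← measure_congr Iio_ae_eq_Iic]
    congr 1
    ext; simp
  -- The minimum is 1 on the positive half-line and e^x on the other; by tilting and reflection each
  -- half contributes erfc(√(v/8))/2.
  rw [gaussianReal_of_var_ne_zero _ hv, lintegral_withDensity_eq_lintegral_mul _ (by fun_prop)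
    (by fun_prop), ← lintegral_add_compl _ (measurableSet_Ioi (a := (0 : ℝ))), compl_Ioi]
  have e1 : ∫⁻ x in Ioi 0, (gaussianPDF (-(v / 2)) v * fun x => ENNReal.ofReal (min 1 (Real.exp x))) x =
      gaussianReal (-(v / 2)) v (Ioi 0) := by
    rw [gaussianReal_apply _ hv]
    refine setLIntegral_congr_fun measurableSet_Ioi fun x hx => ?_
    simp only [Pi.mul_apply, min_eq_left (Real.one_le_exp (le_of_lt hx)), ENNReal.ofReal_one, mul_one]
  have e2 : ∫⁻ x in Iic 0, (gaussianPDF (-(v / 2)) v * fun x => ENNReal.ofReal (min 1 (Real.exp x))) x =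
      gaussianReal (v / 2) v (Iic 0) := by
    rw [gaussianReal_apply _ hv]
    refine setLIntegral_congr_fun measurableSet_Iic fun x hx => ?_
    simp only [Pi.mul_apply, gaussianPDF, min_eq_right (Real.exp_le_one_iff.2 hx)]
    rw [← hshift, mul_comm, ENNReal.ofReal_mul (Real.exp_nonneg _)]
  rw [e1, e2, hIic, hIoi, ← ENNReal.ofReal_add (by have := erfc_pos √(v / 8); positivity)
    (by have := erfc_pos √(v / 8); positivity), add_halves]

/-! ### Brown-Resnick processes -/

section BrownResnick

variable {Ξ : Type} [MeasurableSpace Ξ] {Q : Measure Ξ}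

theorem integral_exp_of_hasGaussianLaw {X : Ξ → ℝ} (hX : HasGaussianLaw X Q) (h0 : ∫ ξ, X ξ ∂Q = 0) :
    ∫ ξ, Real.exp (X ξ) ∂Q = Real.exp ((∫ ξ, X ξ ^ 2 ∂Q) / 2) := by
  have h := mgf_gaussianReal hX.map_eq_gaussianReal 1
  simp only [mgf, one_mul] at h
  rw [h, h0, variance_of_integral_eq_zero hX.aemeasurable h0, Real.coe_toNNReal _ (integral_nonneg fun _ => sq_nonneg _)]
  simp

theorem integrable_exp_of_hasGaussianLaw {X : Ξ → ℝ} (hX : HasGaussianLaw X Q) :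
    Integrable (fun ξ => Real.exp (X ξ)) Q := by
  have h := integrable_exp_mul_gaussianReal (μ := ∫ ξ, X ξ ∂Q) (v := (Var[X; Q]).toNNReal) 1
  rw [← hX.map_eq_gaussianReal, integrable_map_measure (by fun_prop) hX.aemeasurable] at h
  simpa [Function.comp_def] using h

theorem lintegral_exp_sub_of_hasGaussianLaw {X : Ξ → ℝ} (hX : HasGaussianLaw X Q)
    (h0 : ∫ ξ, X ξ ∂Q = 0) :
    ∫⁻ ξ, ENNReal.ofReal (Real.exp (X ξ - (∫ ξ, X ξ ^ 2 ∂Q) / 2)) ∂Q = 1 := by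
  simp_rw [Real.exp_sub]
  rw [← ofReal_integral_eq_lintegral_ofReal ((integrable_exp_of_hasGaussianLaw hX).div_const _)
    (ae_of_all _ fun _ => by positivity), integral_div, integral_exp_of_hasGaussianLaw hX h0,
    div_self (Real.exp_pos _).ne', ENNReal.ofReal_one]

variable {d : ℕ} {W : E d → Ξ → ℝ}

theorem brSpectral_one (hW : IsStationaryIncrementGaussian Q W) (t : E d) (ξ : Ξ) :
    brSpectral Q (fun _ => 1) W t ξ =
      ENNReal.ofReal (Real.exp (W t ξ - (∫ ξ, W t ξ ^ 2 ∂Q) / 2)) := by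
  rw [brSpectral, variance_of_integral_eq_zero (hW.measurable t).aemeasurable (hW.centred t)]
  simp

/-- The increment laws based at t and at 0 agree; their second moments at lag s - t are compared. -/
theorem integral_sub_sq (hW : IsStationaryIncrementGaussian Q W) (s t : E d) :
    ∫ ξ, (W s ξ - W t ξ) ^ 2 ∂Q = variogram Q W (s - t) := by
  have hst := hW.stationary t 0
  have hm : ∀ h, Measurable fun (ξ : Ξ) (r : E d) => W (r + h) ξ - W h ξ := fun h =>
    measurable_pi_lambda _ fun r => (hW.measurable _).sub (hW.measurable _)
  have key : ∀ h, ∫ x, (x (s - t)) ^ 2 ∂(Q.map fun (ξ : Ξ) (r : E d) => W (r + h) ξ - W h ξ) =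
      ∫ ξ, (W (s - t + h) ξ - W h ξ) ^ 2 ∂Q := fun h => by
    rw [integral_map (hm h).aemeasurable]
    exact ((measurable_pi_apply (s - t)).pow_const 2).aestronglyMeasurable
  have h1 := key t
  rw [hst, key 0] at h1
  simp only [sub_add_cancel, add_zero] at h1
  rw [← h1, variogram]

/-- The expected minimum of two normalized lognormal random variables. -/
theorem lintegral_min_exp_of_hasGaussianLaw {A B : Ξ → ℝ} (hAm : Measurable A) (hBm : Measurable B)
    (hAB : HasGaussianLaw (fun ξ => (A ξ, B ξ)) Q) (hA : ∫ ξ, A ξ ∂Q = 0) (hB : ∫ ξ, B ξ ∂Q = 0) :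
    ∫⁻ ξ, min (ENNReal.ofReal (Real.exp (A ξ - (∫ ξ, A ξ ^ 2 ∂Q) / 2)))
      (ENNReal.ofReal (Real.exp (B ξ - (∫ ξ, B ξ ^ 2 ∂Q) / 2))) ∂Q =
      ENNReal.ofReal (erfc √((∫ ξ, (B ξ - A ξ) ^ 2 ∂Q) / 8)) := by
  set a := ∫ ξ, A ξ ^ 2 ∂Q with ha
  set b := ∫ ξ, B ξ ^ 2 ∂Q with hb
  set c := ∫ ξ, A ξ * B ξ ∂Q with hc
  have iA : MemLp A 2 Q := hAB.fst.memLp_two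
  have iB : MemLp B 2 Q := hAB.snd.memLp_two
  have hcomb : ∀ u v : ℝ, ∫ ξ, (u * A ξ + v * B ξ) ^ 2 ∂Q = u ^ 2 * a + v ^ 2 * b + 2 * u * v * c := by
    intro u v
    have e : ∀ ξ, (u * A ξ + v * B ξ) ^ 2 = (u ^ 2 * A ξ ^ 2 + v ^ 2 * B ξ ^ 2) + 2 * u * v * (A ξ * B ξ) := by
      intro ξ; ring
    have i1 := iA.integrable_sq.const_mul (u ^ 2)
    have i2 := iB.integrable_sq.const_mul (v ^ 2)
    have i3 : Integrable (fun ξ => 2 * u * v * (A ξ * B ξ)) Q := (iA.integrable_mul iB).const_mul (2 * u * v)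
    simp_rw [e]
    rw [integral_add (by exact i1.add i2) i3, integral_add i1 i2, integral_const_mul, integral_const_mul, integral_const_mul]
  have hγ : ∫ ξ, (B ξ - A ξ) ^ 2 ∂Q = a + b - 2 * c := by
    have := hcomb (-1) 1
    simp only [neg_mul, one_mul] at this
    rw [← integral_congr_ae (ae_of_all _ fun ξ => by ring : (fun ξ => (-A ξ + B ξ) ^ 2) =ᵐ[Q] fun ξ => (B ξ - A ξ) ^ 2), this]
    ring
  have hγ0 : 0 ≤ a + b - 2 * c := hγ ▸ integral_nonneg fun _ => sq_nonneg _
  set v : ℝ≥0 := ⟨a + b - 2 * c, hγ0⟩ with hv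
  have hlaw : ∀ s t : ℝ, HasGaussianLaw (fun ξ => s * A ξ + t * B ξ) Q := fun s t =>
    hAB.map_fun (s • ContinuousLinearMap.fst ℝ ℝ ℝ + t • ContinuousLinearMap.snd ℝ ℝ ℝ)
  have hmean : ∀ s t : ℝ, ∫ ξ, (s * A ξ + t * B ξ) ∂Q = 0 := fun s t => by
    rw [integral_add (hAB.fst.integrable.const_mul _) (hAB.snd.integrable.const_mul _),
      integral_const_mul, integral_const_mul, hA, hB]
    simp
  -- Under the probability measure tilted by the first lognormal factor, the log-ratio X of the two
  -- factors is normal with mean -v/2 and variance v = E(B - A)². The claim then reduces to the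
  -- one-dimensional integral of min(1, e^X).
  set Q' := Q.withDensity fun ξ => ENNReal.ofReal (Real.exp (A ξ - a / 2)) with hQ'
  have hQ'p : IsProbabilityMeasure Q' := ⟨by
    rw [hQ', withDensity_apply _ .univ, Measure.restrict_univ]
    exact lintegral_exp_sub_of_hasGaussianLaw hAB.fst hA⟩
  set X : Ξ → ℝ := fun ξ => B ξ - b / 2 - (A ξ - a / 2) with hX
  have hXm : Measurable X := by fun_prop
  have hmgf : mgf X Q' = mgf id (gaussianReal (-(v / 2)) v) := by
    ext s
    rw [mgf_id_gaussianReal, mgf, hQ', integral_withDensity_eq_integral_toReal_smul (by fun_prop)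
      (ae_of_all _ fun _ => ENNReal.ofReal_lt_top)]
    have e : ∀ ξ, (ENNReal.ofReal (Real.exp (A ξ - a / 2))).toReal • Real.exp (s * X ξ) =
        Real.exp ((1 - s) * A ξ + s * B ξ) * Real.exp (-(a / 2) - s * (b / 2 - a / 2)) := by
      intro ξ
      rw [ENNReal.toReal_ofReal (Real.exp_nonneg _), smul_eq_mul, ← Real.exp_add, ← Real.exp_add, hX]
      congr 1
      ring
    simp_rw [e]
    rw [integral_mul_const, integral_exp_of_hasGaussianLaw (hlaw _ _) (hmean _ _), hcomb, ← Real.exp_add]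
    congr 1
    rw [show (v : ℝ) = a + b - 2 * c from rfl]
    ring
  have hXlaw : Q'.map X = gaussianReal (-(v / 2)) v := by
    have h1 := eqOn_complexMGF_of_mgf hmgf
    -- The Gaussian moment generating function is finite on the whole line, so agreement extends to
    -- all complex arguments and determines the law.
    have h2 : complexMGF X Q' = complexMGF id (gaussianReal (-(v / 2)) v) := by
      ext z
      refine h1 ?_
      rw [integrableExpSet_eq_of_mgf hmgf, integrableExpSet_id_gaussianReal]
      simp
    simpa using Measure.ext_of_complexMGF_eq hXm.aemeasurable aemeasurable_id h2
  have hmain := lintegral_min_one_exp_gaussianReal v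
  rw [← hXlaw, lintegral_map (by fun_prop) hXm, hQ', lintegral_withDensity_eq_lintegral_mul _ (by fun_prop) (by fun_prop)] at hmain
  rw [hγ]
  refine Eq.trans (lintegral_congr fun ξ => ?_) hmain
  rw [Pi.mul_apply, ← ENNReal.ofReal_mul (Real.exp_nonneg _), ← ENNReal.ofReal_mono.map_min,
    mul_min_of_nonneg _ _ (Real.exp_nonneg _), mul_one, ← Real.exp_add, hX]
  congr 3
  ring

theorem lintegral_min_brSpectral (hW : IsStationaryIncrementGaussian Q W) (t : E d) :
    ∫⁻ ξ, min (brSpectral Q (fun _ => 1) W 0 ξ) (brSpectral Q (fun _ => 1) W t ξ) ∂Q =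
      ENNReal.ofReal (erfc √(variogram Q W t / 8)) := by
  simp_rw [brSpectral_one hW]
  exact lintegral_min_exp_of_hasGaussianLaw (hW.measurable 0) (hW.measurable t)
    hW.gaussian.hasGaussianLaw_prodMk (hW.centred 0) (hW.centred t)

variable [IsProbabilityMeasure Q]

/-- The tail correlation function of a Brown-Resnick process in terms of the variogram. -/
theorem isTCFOfSpectral_brSpectral_iff (hW : IsStationaryIncrementGaussian Q W) {χ : E d → ℝ} :
    IsTCFOfSpectral Q (brSpectral Q (fun _ => 1) W) χ ↔ ∀ t, χ t = erfc √(variogram Q W t / 8) := by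
  constructor
  · intro h t
    rw [h.eq, lintegral_min_brSpectral hW, ENNReal.toReal_ofReal (erfc_pos _).le]
  · intro h
    refine isTCFOfSpectral_of_lintegral (fun t => ?_) (fun t => ?_) fun t => ?_
    · have := hW.measurable t
      unfold brSpectral
      fun_prop
    · simp_rw [brSpectral_one hW]
      exact lintegral_exp_sub_of_hasGaussianLaw (hW.gaussian.hasGaussianLaw_eval t) (hW.centred t)
    · rw [h, lintegral_min_brSpectral hW, ENNReal.toReal_ofReal (erfc_pos _).le]

end BrownResnick

/-! ### Gaussian processes with a given variogram -/

section Isonormal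

theorem integral_norm_le_norm_Lp {Ξ : Type} [MeasurableSpace Ξ] {Q : Measure Ξ}
    [IsProbabilityMeasure Q] (f : Lp ℝ 2 Q) : ∫ ξ, ‖f ξ‖ ∂Q ≤ ‖f‖ := by
  rw [integral_norm_eq_lintegral_enorm (Lp.aestronglyMeasurable f), Lp.norm_def,
    ← eLpNorm_one_eq_lintegral_enorm]
  exact ENNReal.toReal_mono (Lp.eLpNorm_ne_top f)
    (eLpNorm_le_eLpNorm_of_exponent_le (by norm_num) (Lp.aestronglyMeasurable f))

/-- The map is 1-Lipschitz, because |e^{ia} - e^{ib}| ≤ |a - b| and the L¹ norm is at most the L²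
norm on a probability space. -/
theorem continuous_integral_cexp_Lp {Ξ : Type} [MeasurableSpace Ξ] (Q : Measure Ξ)
    [IsProbabilityMeasure Q] :
    Continuous fun f : Lp ℝ 2 Q => ∫ ξ, Complex.exp (f ξ * Complex.I) ∂Q := by
  have hint : ∀ f : Lp ℝ 2 Q, Integrable (fun ξ => Complex.exp (f ξ * Complex.I)) Q := fun f => by
    have := Lp.stronglyMeasurable f
    refine Integrable.of_bound (by fun_prop) 1 (ae_of_all _ fun ξ => ?_)
    rw [Complex.norm_exp_ofReal_mul_I]
  refine (LipschitzWith.of_dist_le_mul (K := 1) fun f g => ?_).continuous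
  rw [dist_eq_norm, ← integral_sub (hint f) (hint g), NNReal.coe_one, one_mul, dist_eq_norm]
  refine (norm_integral_le_integral_norm _).trans (le_trans ?_ (integral_norm_le_norm_Lp (f - g)))
  refine integral_mono_ae ((hint f).sub (hint g)).norm ?_ ?_
  · exact ((Lp.memLp (f - g)).integrable (by norm_num)).norm
  · filter_upwards [Lp.coeFn_sub f g] with ξ hξ
    rw [hξ, Pi.sub_apply]
    have h := Real.norm_exp_I_mul_ofReal_sub_one_le (x := f ξ - g ξ)
    have e : Complex.exp (f ξ * Complex.I) - Complex.exp (g ξ * Complex.I) =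
        Complex.exp (g ξ * Complex.I) * (Complex.exp (Complex.I * ((f ξ - g ξ : ℝ) : ℂ)) - 1) := by
      rw [mul_sub, ← Complex.exp_add, mul_one]
      congr 2
      push_cast
      ring
    rw [e, norm_mul, Complex.norm_exp_ofReal_mul_I, one_mul]
    exact h

theorem integral_cexp_sum_infinitePi {ι : Type} (F : Finset ι) (a : ι → ℝ) :
    ∫ ω : ι → ℝ, Complex.exp ((∑ i ∈ F, a i * ω i : ℝ) * Complex.I)
      ∂(Measure.infinitePi fun _ => gaussianReal 0 1) = Complex.exp (-(∑ i ∈ F, a i ^ 2 : ℝ) / 2) := by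
  have hind : iIndepFun (fun (i : F) (ω : ι → ℝ) => Complex.exp ((a i * ω i : ℝ) * Complex.I))
        (Measure.infinitePi fun _ => gaussianReal 0 1) := by
      have h := iIndepFun_infinitePi (P := fun _ : ι => gaussianReal 0 1)
        (X := fun (i : ι) s => Complex.exp ((a i * s : ℝ) * Complex.I)) (fun _ => by fun_prop)
      exact h.precomp Subtype.val_injective
  have h := hind.integral_fun_prod_eq_prod_integral fun j => by
      have : Measurable fun ω : ι → ℝ => Complex.exp ((a j * ω j : ℝ) * Complex.I) := by fun_prop
      exact this.aestronglyMeasurable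
  have e : ∀ i : ι, ∫ ω : ι → ℝ, Complex.exp ((a i * ω i : ℝ) * Complex.I)
        ∂(Measure.infinitePi fun _ => gaussianReal 0 1) = Complex.exp (-(a i ^ 2 : ℝ) / 2) := by
      intro i
      have h1 := (measurePreserving_eval_infinitePi (fun _ : ι => gaussianReal 0 1) i).map_eq
      have h2 := charFun_gaussianReal (μ := 0) (v := 1) (a i)
      rw [← h1, charFun_apply, integral_map (measurable_pi_apply i).aemeasurable (by fun_prop)] at h2
      refine Eq.trans (integral_congr_ae (ae_of_all _ fun ω => ?_)) (h2.trans ?_)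
      · simp
      · congr 1
        push_cast
        ring
  simp_rw [e] at h
  rw [← Complex.exp_sum] at h
  have e2 : ∑ i : F, (-(a i ^ 2 : ℝ) / 2 : ℂ) = -(∑ i ∈ F, a i ^ 2 : ℝ) / 2 := by
    rw [← Finset.sum_coe_sort F]
    push_cast
    rw [← Finset.sum_div, Finset.sum_neg_distrib]
  rw [← e2, ← h]
  refine integral_congr_ae (ae_of_all _ fun ω => ?_)
  simp only
  rw [← Complex.exp_sum, ← Finset.sum_mul, ← Complex.ofReal_sum, Finset.sum_coe_sort F fun i => a i * ω i]

/-- The isonormal Gaussian process over a Hilbert space. -/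
theorem exists_isonormal (H : Type) [NormedAddCommGroup H] [InnerProductSpace ℝ H]
    [CompleteSpace H] :
    ∃ (Ξ : Type) (_ : MeasurableSpace Ξ) (Q : Measure Ξ) (_ : IsProbabilityMeasure Q)
      (I : H →ₗᵢ[ℝ] Lp ℝ 2 Q), ∀ h, Q.map (I h) = gaussianReal 0 (‖h‖₊ ^ 2) := by
  classical
  obtain ⟨w, b, -⟩ := exists_hilbertBasis ℝ H
  set Q : Measure (w → ℝ) := Measure.infinitePi fun _ => gaussianReal 0 1 with hQ
  have heval : ∀ i : w, Q.map (fun ω : w → ℝ => ω i) = gaussianReal 0 1 := fun i =>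
    (measurePreserving_eval_infinitePi (fun _ : w => gaussianReal 0 1) i).map_eq
  have hmem : ∀ i : w, MemLp (fun ω : w → ℝ => ω i) 2 Q := fun i => by
    have h := memLp_id_gaussianReal (μ := 0) (v := 1) 2
    rw [← heval i] at h
    exact h.comp_of_map (measurable_pi_apply i).aemeasurable
  set Z : w → Lp ℝ 2 Q := fun i => (hmem i).toLp with hZ
  have hinner : ∀ i j, inner ℝ (Z i) (Z j) = ∫ ω : w → ℝ, ω i * ω j ∂Q := fun i j => by
    rw [L2.inner_def]
    refine integral_congr_ae ?_
    filter_upwards [(hmem i).coeFn_toLp, (hmem j).coeFn_toLp] with ω h1 h2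
    simp only [hZ, h1, h2]
    simp [mul_comm]
  have hmean : ∀ i, ∫ ω : w → ℝ, ω i ∂Q = 0 := fun i => by
    have h := integral_id_gaussianReal (μ := 0) (v := 1)
    rw [← heval i, integral_map (measurable_pi_apply i).aemeasurable (by fun_prop)] at h
    exact h
  have hZon : Orthonormal ℝ Z := by
    rw [orthonormal_iff_ite]
    intro i j
    rw [hinner]
    split_ifs with hij
    · subst hij
      have h := variance_of_integral_eq_zero (μ := gaussianReal 0 1) (X := id) (by fun_prop)
        integral_id_gaussianReal
      rw [variance_id_gaussianReal, ← heval i,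
        integral_map (measurable_pi_apply i).aemeasurable (by fun_prop)] at h
      simpa [sq] using h.symm
    · have hind := (iIndepFun_infinitePi (P := fun _ : w => gaussianReal 0 1)
        (X := fun (_ : w) (x : ℝ) => x) (fun _ => measurable_id)).indepFun hij
      have := hind.integral_fun_mul_eq_mul_integral
        (measurable_pi_apply i).aestronglyMeasurable (measurable_pi_apply j).aestronglyMeasurable
      rw [this, hmean, zero_mul]
  -- The Hilbert basis is sent to independent standard normal coordinates, which are orthonormal in
  -- L².
  set I : H →ₗᵢ[ℝ] Lp ℝ 2 Q :=
    hZon.orthogonalFamily.linearIsometry.comp b.repr.toLinearIsometry with hI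
  have hIb : ∀ i, I (b i) = Z i := fun i => by
    have h1 : I (b i) = hZon.orthogonalFamily.linearIsometry (b.repr (b i)) := rfl
    rw [h1, b.repr_self, OrthogonalFamily.linearIsometry_apply_single]
    simp
  -- The characteristic function is explicit for finite partial sums of the basis expansion and
  -- passes to the limit by L²-continuity.
  have hchar : ∀ h : H, ∫ ω, Complex.exp (I h ω * Complex.I) ∂Q =
      Complex.exp (-(‖h‖ ^ 2 : ℝ) / 2) := by
    intro h
    have hs := b.hasSum_repr h
    have hs' : Tendsto (fun F : Finset w => I (∑ i ∈ F, b.repr h i • b i)) atTop (𝓝 (I h)) :=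
      (I.continuous.tendsto _).comp hs
    have h1 := ((continuous_integral_cexp_Lp Q).tendsto _).comp hs'
    have h2 : Tendsto (fun F : Finset w => Complex.exp (-(‖∑ i ∈ F, b.repr h i • b i‖ ^ 2 : ℝ) / 2))
        atTop (𝓝 (Complex.exp (-(‖h‖ ^ 2 : ℝ) / 2))) := by
      have hc : Continuous fun x : H => Complex.exp (-(‖x‖ ^ 2 : ℝ) / 2) := by fun_prop
      exact (hc.tendsto _).comp hs
    refine tendsto_nhds_unique h1 (h2.congr fun F => ?_)
    have hn : ‖∑ i ∈ F, b.repr h i • b i‖ ^ 2 = ∑ i ∈ F, (b.repr h i) ^ 2 := by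
      rw [← real_inner_self_eq_norm_sq, b.orthonormal.inner_sum]
      simp [sq]
    rw [hn, ← integral_cexp_sum_infinitePi F fun i => b.repr h i]
    refine integral_congr_ae ?_
    have hsum : (I (∑ i ∈ F, b.repr h i • b i) : (w → ℝ) → ℝ) =ᵐ[Q] fun ω => ∑ i ∈ F, b.repr h i * ω i := by
      simp_rw [map_sum, map_smul, hIb]
      have h3 : ∀ᵐ ω ∂Q, ∀ i ∈ F, (b.repr h i • Z i : Lp ℝ 2 Q) ω = b.repr h i * ω i := by
        rw [Finset.eventually_all]
        intro i _
        filter_upwards [Lp.coeFn_smul (b.repr h i) (Z i), (hmem i).coeFn_toLp] with ω h4 h5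
        rw [h4, Pi.smul_apply, hZ, smul_eq_mul]
        simp only [h5]
      filter_upwards [Lp.coeFn_finsetSum F fun i => b.repr h i • Z i, h3] with ω h4 h5
      rw [h4, Finset.sum_apply]
      exact Finset.sum_congr rfl fun i hi => h5 i hi
    filter_upwards [hsum] with ω hω
    rw [hω]
  refine ⟨_, inferInstance, Q, inferInstance, I, fun h => ?_⟩
  have hm : Measurable (I h) := (Lp.stronglyMeasurable (I h)).measurable
  have := Measure.isProbabilityMeasure_map (μ := Q) hm.aemeasurable
  refine Measure.ext_of_charFun (funext fun t => ?_)
  rw [charFun_gaussianReal, charFun_apply, integral_map hm.aemeasurable (by fun_prop)]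
  have h1 := hchar (t • h)
  rw [map_smul] at h1
  refine Eq.trans (integral_congr_ae ?_) (h1.trans ?_)
  · filter_upwards [Lp.coeFn_smul t (I h)] with ω hω
    rw [hω]
    simp
  · congr 1
    rw [norm_smul, mul_pow, Real.norm_eq_abs, sq_abs]
    push_cast
    ring

/-- Linearity of `I`: a linear functional of the family is almost surely the image of one vector of
H. Every projection is therefore Gaussian with variance determined by the Gram matrix of the v i. -/
theorem map_dual_eq_gaussianReal {H Ξ ι : Type} [NormedAddCommGroup H] [InnerProductSpace ℝ H]
    [MeasurableSpace Ξ] {Q : Measure Ξ} {I : H →ₗᵢ[ℝ] Lp ℝ 2 Q}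
    (hI : ∀ h, Q.map (I h) = gaussianReal 0 (‖h‖₊ ^ 2)) [Fintype ι] [DecidableEq ι] {v : ι → H}
    {X : ι → Ξ → ℝ} (hXm : ∀ i, Measurable (X i)) (hX : ∀ i, X i =ᵐ[Q] I (v i))
    (L : StrongDual ℝ (ι → ℝ)) :
    (Q.map fun ξ i => X i ξ).map L =
      gaussianReal 0 (‖∑ i, L (Pi.single i 1) • v i‖₊ ^ 2) := by
  rw [← hI, Measure.map_map (by fun_prop) (measurable_pi_lambda _ hXm)]
  refine Measure.map_congr ?_
  have h3 : ∀ᵐ ξ ∂Q, ∀ i, (L (Pi.single i 1) • I (v i) : Lp ℝ 2 Q) ξ = L (Pi.single i 1) * X i ξ := by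
    rw [ae_all_iff]
    intro i
    filter_upwards [Lp.coeFn_smul (L (Pi.single i 1)) (I (v i)), hX i] with ω h4 h5
    rw [h4, Pi.smul_apply, smul_eq_mul, h5]
  simp_rw [map_sum, map_smul]
  filter_upwards [Lp.coeFn_finsetSum Finset.univ fun i => L (Pi.single i 1) • I (v i), h3] with ξ h4 h5
  rw [h4, Finset.sum_apply, Finset.sum_congr rfl fun i _ => h5 i]
  conv_lhs => rw [Function.comp_apply, ← Finset.univ_sum_single fun i => X i ξ, map_sum]
  refine Finset.sum_congr rfl fun i _ => ?_
  have : (Pi.single i (X i ξ) : ι → ℝ) = X i ξ • Pi.single i 1 := by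
    ext j
    by_cases h : j = i <;> simp [h]
  rw [this, map_smul, smul_eq_mul, mul_comm]

/-- An embedding of `ℝ^d` into a Hilbert space whose squared distances depend only on differences
yields a Gaussian process with stationary increments. -/
theorem exists_gaussian_of_embedding {d : ℕ} {H : Type} [NormedAddCommGroup H]
    [InnerProductSpace ℝ H] [CompleteSpace H] {c : E d → H} {γ : E d → ℝ}
    (hc : ∀ s t, ‖c s - c t‖ ^ 2 = γ (s - t)) :
    ∃ (Ξ : Type) (_ : MeasurableSpace Ξ) (Q : Measure Ξ) (_ : IsProbabilityMeasure Q)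
      (W : E d → Ξ → ℝ), IsStationaryIncrementGaussian Q W ∧ ∀ t, variogram Q W t = γ t := by
  classical
  obtain ⟨Ξ, _, Q, _, I, hI⟩ := exists_isonormal H
  have hm : ∀ h, Measurable (I h) := fun h => (Lp.stronglyMeasurable (I h)).measurable
  have hsub : ∀ s t, (fun ξ => I (c s) ξ - I (c t) ξ) =ᵐ[Q] I (c s - c t) := fun s t => by
    rw [map_sub]
    exact (Lp.coeFn_sub _ _).symm
  -- By polarization the Gram matrix of the increments does not involve the base point h. This is
  -- what makes the increments of the Gaussian process stationary.
  have hinner : ∀ (h s t : E d), inner ℝ (c (s + h) - c h) (c (t + h) - c h) =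
      (γ s + γ t - γ (s - t)) / 2 := fun h s t => by
    have e : (c (s + h) - c h) - (c (t + h) - c h) = c (s + h) - c (t + h) := by abel
    rw [real_inner_eq_norm_mul_self_add_norm_mul_self_sub_norm_sub_mul_self_div_two, e,
      ← sq, ← sq, ← sq, hc, hc, hc]
    simp
  refine ⟨Ξ, _, Q, inferInstance, fun t => I (c t), ⟨fun t => hm _, ⟨fun F => ⟨?_⟩⟩, fun t => ?_, ?_⟩, fun t => ?_⟩
  · exact isGaussian_of_map_eq_gaussianReal fun L => ⟨_, _, map_dual_eq_gaussianReal hI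
      (v := fun i : F => c i) (X := fun i : F => I (c i)) (fun i => hm _) (fun i => ae_eq_rfl) L⟩
  · have h := integral_id_gaussianReal (μ := 0) (v := ‖c t‖₊ ^ 2)
    rwa [← hI, integral_map (hm _).aemeasurable (by fun_prop)] at h
  · intro h h'
    have hinc : ∀ h, Measurable fun (ξ : Ξ) (t : E d) => I (c (t + h)) ξ - I (c h) ξ := fun h =>
      measurable_pi_lambda _ fun t => (hm _).sub (hm _)
    refine (map_eq_iff_forall_finset_map_restrict_eq (hinc h).aemeasurable (hinc h').aemeasurable).2 fun F => ?_
    have hXm : ∀ (h : E d) (i : F), Measurable fun ξ => I (c (i + h)) ξ - I (c h) ξ := fun h i => (hm _).sub (hm _)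
    have hp : ∀ h, IsProbabilityMeasure (Q.map fun ξ (i : F) => I (c (i + h)) ξ - I (c h) ξ) := fun h =>
      Measure.isProbabilityMeasure_map (measurable_pi_lambda _ (hXm h)).aemeasurable
    have := hp h
    have := hp h'
    change (Q.map fun ξ (i : F) => I (c (i + h)) ξ - I (c h) ξ) = Q.map fun ξ (i : F) => I (c (i + h')) ξ - I (c h') ξ
    refine Measure.ext_of_charFunDual (funext fun L => ?_)
    rw [charFunDual_eq_charFun_map_one, charFunDual_eq_charFun_map_one,
      map_dual_eq_gaussianReal hI (v := fun i : F => c (i + h) - c h) (hXm h) (fun i => hsub _ _) L,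
      map_dual_eq_gaussianReal hI (v := fun i : F => c (i + h') - c h') (hXm h') (fun i => hsub _ _) L]
    congr 2
    ext
    push_cast
    simp only [← real_inner_self_eq_norm_sq, sum_inner, inner_sum, inner_smul_left, inner_smul_right, hinner]
  · have h1 : variogram Q (fun t => I (c t)) t = ∫ ξ, (I (c t - c 0) ξ) ^ 2 ∂Q := by
      refine integral_congr_ae ?_
      filter_upwards [hsub t 0] with ξ hξ
      rw [← hξ]
    have h2 := variance_of_integral_eq_zero (μ := gaussianReal 0 (‖c t - c 0‖₊ ^ 2)) (X := id) (by fun_prop)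
        integral_id_gaussianReal
    rw [variance_id_gaussianReal, ← hI, integral_map (hm _).aemeasurable (by fun_prop)] at h2
    simp only [id] at h2
    rw [h1, ← h2]
    push_cast
    rw [hc, sub_zero]

end Isonormal

/-! ### Hilbert space embeddings: sums, multiples and fractional powers of the norm -/

section Embeddings

/-- `γ(s - t)` is the squared distance of the images of `s` and `t` in a Hilbert space. -/
def IsHilbertVariogram {d : ℕ} (γ : E d → ℝ) : Prop :=
  ∃ (H : Type) (_ : NormedAddCommGroup H) (_ : InnerProductSpace ℝ H) (_ : CompleteSpace H)
    (c : E d → H), ∀ s t, ‖c s - c t‖ ^ 2 = γ (s - t)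

variable {d : ℕ}

theorem IsHilbertVariogram.add {γ γ' : E d → ℝ} (h : IsHilbertVariogram γ)
    (h' : IsHilbertVariogram γ') : IsHilbertVariogram fun t => γ t + γ' t := by
  obtain ⟨H, _, _, _, c, hc⟩ := h
  obtain ⟨H', _, _, _, c', hc'⟩ := h'
  refine ⟨WithLp 2 (H × H'), inferInstance, inferInstance, inferInstance,
    fun t => WithLp.toLp 2 (c t, c' t), fun s t => ?_⟩
  rw [WithLp.prod_norm_sq_eq_of_L2]
  exact congrArg₂ (· + ·) (hc s t) (hc' s t)

theorem IsHilbertVariogram.const_mul {γ : E d → ℝ} (h : IsHilbertVariogram γ) {a : ℝ} (ha : 0 ≤ a) :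
    IsHilbertVariogram fun t => a * γ t := by
  obtain ⟨H, _, _, _, c, hc⟩ := h
  refine ⟨H, inferInstance, inferInstance, inferInstance, fun t => √a • c t, fun s t => ?_⟩
  rw [← smul_sub, norm_smul, mul_pow, hc, Real.norm_eq_abs, sq_abs, Real.sq_sqrt ha]

theorem isHilbertVariogram_norm_sq : IsHilbertVariogram fun t : E d => ‖t‖ ^ 2 :=
  ⟨E d, inferInstance, inferInstance, inferInstance, id, fun _ _ => rfl⟩

theorem norm_cexp_sub_one_sq_le (θ : ℝ) : ‖Complex.exp (θ * Complex.I) - 1‖ ^ 2 ≤ min 4 (θ ^ 2) := by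
  have h1 : ‖Complex.exp (θ * Complex.I) - 1‖ ≤ 2 := by
    refine (norm_sub_le _ _).trans ?_
    rw [Complex.norm_exp_ofReal_mul_I]
    norm_num
  have h2 : ‖Complex.exp (θ * Complex.I) - 1‖ ≤ |θ| := by
    have := Real.norm_exp_I_mul_ofReal_sub_one_le (x := θ)
    rwa [mul_comm, Real.norm_eq_abs] at this
  have h0 := norm_nonneg (Complex.exp (θ * Complex.I) - 1)
  refine le_min (by nlinarith) ?_
  rw [← sq_abs θ]
  gcongr

/-- Near 0 the quadratic bound leaves y^(1 - 2α), integrable since α < 1; on y > 1 the constant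
bound leaves y^(-2α - 1), integrable since α > 0. -/
theorem integrableOn_min_mul_rpow {α : ℝ} (h0 : 0 < α) (h1 : α < 1) {T : ℝ} (hT : 0 ≤ T) :
    IntegrableOn (fun y : ℝ => min 4 (T * y ^ 2) * y ^ (-2 * α - 1)) (Ioi 0) := by
  have hm : Measurable fun y : ℝ => min 4 (T * y ^ 2) * y ^ (-2 * α - 1) := by fun_prop
  rw [← Ioc_union_Ioi_eq_Ioi zero_le_one]
  refine IntegrableOn.union ?_ ?_
  · have h := (intervalIntegrable_iff_integrableOn_Ioc_of_le zero_le_one).1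
      (intervalIntegral.intervalIntegrable_rpow' (a := 0) (b := 1) (r := 1 - 2 * α) (by linarith))
    refine (h.const_mul T).mono' hm.aestronglyMeasurable ?_
    filter_upwards [ae_restrict_mem measurableSet_Ioc] with y hy
    have hy0 : 0 < y := hy.1
    rw [Real.norm_of_nonneg (by positivity)]
    calc min 4 (T * y ^ 2) * y ^ (-2 * α - 1) ≤ T * y ^ 2 * y ^ (-2 * α - 1) := by
          gcongr; exact min_le_right _ _
      _ = T * y ^ (1 - 2 * α) := by
          rw [mul_assoc, ← Real.rpow_natCast, ← Real.rpow_add hy0]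
          congr 2
          push_cast
          ring
  · have h := integrableOn_Ioi_rpow_of_lt (a := -2 * α - 1) (by linarith) one_pos
    refine (h.const_mul 4).mono' hm.aestronglyMeasurable ?_
    filter_upwards [ae_restrict_mem measurableSet_Ioi] with y hy
    have hy0 : 0 < y := one_pos.trans hy
    rw [Real.norm_of_nonneg (by positivity)]
    gcongr
    exact min_le_left _ _

theorem integrable_harmonizable_aux (hd : 1 ≤ d) {α : ℝ} (h0 : 0 < α) (h1 : α < 1) (t : E d) :
    Integrable fun x : E d => ‖Complex.exp (inner ℝ t x * Complex.I) - 1‖ ^ 2 * ‖x‖ ^ (-(2 * α + d)) := by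
  have : Nontrivial (E d) := by
    have : Nonempty (Fin d) := ⟨⟨0, hd⟩⟩
    infer_instance
  have hint : Integrable fun x : E d => min 4 (‖t‖ ^ 2 * ‖x‖ ^ 2) * ‖x‖ ^ (-(2 * α + d)) := by
    refine (integrable_fun_norm_addHaar volume (f := fun y => min 4 (‖t‖ ^ 2 * y ^ 2) * y ^ (-(2 * α + d)))).2 ?_
    refine (integrableOn_min_mul_rpow h0 h1 (sq_nonneg ‖t‖)).congr_fun (fun y hy => ?_) measurableSet_Ioi
    have hy : 0 < y := hy
    simp only [finrank_euclideanSpace, Fintype.card_fin, smul_eq_mul]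
    rw [mul_left_comm, ← Real.rpow_natCast y (d - 1), ← Real.rpow_add hy, Nat.cast_sub hd]
    congr 2
    push_cast
    ring
  refine hint.mono' (by fun_prop) (ae_of_all _ fun x => ?_)
  rw [Real.norm_of_nonneg (by positivity)]
  gcongr
  refine (norm_cexp_sub_one_sq_le _).trans ?_
  refine min_le_min le_rfl ?_
  rw [← mul_pow, ← sq_abs (inner ℝ t x)]
  gcongr
  exact abs_real_inner_le_norm t x

/-- Rotation invariance reduces t to ‖t‖ u, and the substitution x ↦ ‖t‖ x produces the factor
‖t‖^(2α). -/
theorem integral_harmonizable {α : ℝ} (t u : E d) (hu : ‖u‖ = 1) (h0 : 0 < α) :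
    ∫ x : E d, ‖Complex.exp (inner ℝ t x * Complex.I) - 1‖ ^ 2 * ‖x‖ ^ (-(2 * α + d)) =
      ‖t‖ ^ (2 * α) *
        ∫ x : E d, ‖Complex.exp (inner ℝ u x * Complex.I) - 1‖ ^ 2 * ‖x‖ ^ (-(2 * α + d)) := by
  rcases eq_or_ne t 0 with rfl | ht
  · simp [Real.zero_rpow (mul_pos two_pos h0).ne']
  have hr : 0 < ‖t‖ := norm_pos_iff.2 ht
  set r := ‖t‖ with hrdef
  set G : E d → E d → ℝ := fun t x =>
    ‖Complex.exp (inner ℝ t x * Complex.I) - 1‖ ^ 2 * ‖x‖ ^ (-(2 * α + d)) with hG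
  have hrot : ∫ x, G t x = ∫ x, G (r • u) x := by
    -- Reflection in the hyperplane orthogonal to r u - t exchanges the vectors r u and t of equal
    -- norm.
    set R := ((Submodule.span ℝ {r • u - t})ᗮ).reflection with hR
    have hRu : R (r • u) = t := Submodule.reflection_sub (by rw [norm_smul, hu, mul_one, Real.norm_of_nonneg hr.le])
    rw [← R.measurePreserving.integral_comp R.toHomeomorph.measurableEmbedding]
    refine integral_congr_ae (ae_of_all _ fun x => ?_)
    simp only [hG]
    rw [← hRu, R.inner_map_map, R.norm_map]
  have hscale : ∀ x, G (r • u) x = r ^ (2 * α + d) * G u (r • x) := fun x => by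
    simp only [hG]
    rw [inner_smul_left, inner_smul_right, norm_smul, Real.norm_of_nonneg hr.le,
      Real.mul_rpow hr.le (norm_nonneg _), mul_left_comm, ← mul_assoc (r ^ _) (r ^ _), ← Real.rpow_add hr]
    simp
  rw [hrot]
  simp_rw [hscale]
  rw [integral_const_mul, Measure.integral_comp_smul, smul_eq_mul, ← mul_assoc]
  congr 1
  rw [finrank_euclideanSpace, Fintype.card_fin, abs_of_nonneg (by positivity), Real.rpow_add hr,
    Real.rpow_natCast]
  field_simp

theorem integral_harmonizable_pos (hd : 1 ≤ d) {α : ℝ} (h0 : 0 < α) (h1 : α < 1) (u : E d) (hu : ‖u‖ = 1) :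
    0 < ∫ x : E d, ‖Complex.exp (inner ℝ u x * Complex.I) - 1‖ ^ 2 * ‖x‖ ^ (-(2 * α + d)) := by
  rw [integral_pos_iff_support_of_nonneg (fun x => by positivity) (integrable_harmonizable_aux hd h0 h1 u)]
  -- On the strip 0 < ⟨u, x⟩ < 1 the sine of ⟨u, x⟩ is positive, so the integrand does not vanish
  -- there.
  have hopen : IsOpen {x : E d | inner ℝ u x ∈ Ioo (0 : ℝ) 1} :=
    isOpen_Ioo.preimage (by fun_prop)
  refine (hopen.measure_pos volume ⟨(1 / 2 : ℝ) • u, ?_⟩).trans_le (measure_mono fun x hx => ?_)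
  · simp only [mem_ofPred_eq, inner_smul_right, real_inner_self_eq_norm_sq, hu]
    norm_num
  · obtain ⟨hx0, hx1⟩ := hx
    have hxne : x ≠ 0 := by rintro rfl; simp at hx0
    have hxn : 0 < ‖x‖ := norm_pos_iff.2 hxne
    have hexp : Complex.exp (inner ℝ u x * Complex.I) - 1 ≠ 0 := by
      intro h
      have := congrArg Complex.im h
      rw [Complex.sub_im, Complex.exp_ofReal_mul_I_im] at this
      have hs := Real.sin_pos_of_pos_of_lt_pi hx0 (hx1.trans (by linarith [Real.pi_gt_three]))
      simp at this
      linarith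
    have : 0 < ‖Complex.exp (inner ℝ u x * Complex.I) - 1‖ := norm_pos_iff.2 hexp
    exact (mul_pos (by positivity) (Real.rpow_pos_of_pos hxn _)).ne'

/-- The variogram of fractional Brownian motion. -/
theorem isHilbertVariogram_norm_rpow (hd : 1 ≤ d) {α : ℝ} (h0 : 0 < α) (h1 : α < 1) :
    IsHilbertVariogram fun t : E d => ‖t‖ ^ (2 * α) := by
  obtain ⟨u, hu⟩ : ∃ u : E d, ‖u‖ = 1 := ⟨EuclideanSpace.single ⟨0, hd⟩ 1, by simp⟩
  have hpos := integral_harmonizable_pos hd h0 h1 u hu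
  set κ := ∫ x : E d, ‖Complex.exp (inner ℝ u x * Complex.I) - 1‖ ^ 2 * ‖x‖ ^ (-(2 * α + d)) with hκ
  -- Harmonizable representation: t is sent to (e^{i⟨t,x⟩} - 1) ‖x‖^(-α - d/2) in L²(ℝ^d; ℂ),
  -- regarded as a real Hilbert space.
  set f : E d → E d → ℂ := fun t x =>
    (Complex.exp (inner ℝ t x * Complex.I) - 1) * (‖x‖ ^ (-(2 * α + d) / 2) : ℝ) with hf
  have hsq : ∀ x : E d, (‖x‖ ^ (-(2 * α + d) / 2)) ^ 2 = ‖x‖ ^ (-(2 * α + d)) := fun x => by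
    rw [← Real.rpow_natCast, ← Real.rpow_mul (norm_nonneg _)]
    congr 1
    push_cast
    ring
  have hnorm : ∀ t x : E d, ‖f t x‖ ^ 2 =
      ‖Complex.exp (inner ℝ t x * Complex.I) - 1‖ ^ 2 * ‖x‖ ^ (-(2 * α + d)) := fun t x => by
    rw [hf]
    simp only
    rw [norm_mul, mul_pow, Complex.norm_real, Real.norm_eq_abs, sq_abs, hsq]
  have hfm : ∀ t, Measurable (f t) := fun t => by
    have : Measurable fun x : E d => (inner ℝ t x : ℝ) := by fun_prop
    fun_prop
  have hmem : ∀ t, MemLp (f t) 2 volume := fun t => by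
    rw [memLp_two_iff_integrable_sq_norm (hfm t).aestronglyMeasurable]
    simp_rw [hnorm]
    exact integrable_harmonizable_aux hd h0 h1 t
  have key : IsHilbertVariogram fun t : E d => κ * ‖t‖ ^ (2 * α) := by
    refine ⟨Lp ℂ 2 (volume : Measure (E d)), inferInstance, inferInstance, inferInstance,
      fun t => (hmem t).toLp, fun s t => ?_⟩
    change _ = κ * ‖s - t‖ ^ (2 * α)
    rw [mul_comm, ← integral_harmonizable (s - t) u hu h0, ← MemLp.toLp_sub, ← real_inner_self_eq_norm_sq, L2.inner_def]
    refine integral_congr_ae ?_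
    filter_upwards [((hmem s).sub (hmem t)).coeFn_toLp] with x hx
    rw [hx, real_inner_self_eq_norm_sq, ← hnorm, Pi.sub_apply]
    -- A unimodular factor turns f s - f t into f (s - t), so the distance depends only on s - t.
    have e : f s x - f t x = Complex.exp (inner ℝ t x * Complex.I) * f (s - t) x := by
      simp only [hf, inner_sub_left]
      rw [← mul_assoc, mul_sub, ← Complex.exp_add, mul_one]
      push_cast
      rw [show (inner ℝ t x * Complex.I + (inner ℝ s x - inner ℝ t x) * Complex.I : ℂ) = inner ℝ s x * Complex.I by ring]
      ring
    rw [e, norm_mul, Complex.norm_exp_ofReal_mul_I, one_mul]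
  have := key.const_mul (inv_nonneg.2 hpos.le)
  simpa [inv_mul_cancel_left₀ hpos.ne'] using this

end Embeddings

/-! ### The class of Brown–Resnick TCFs and the admissible exponents -/

section BrownResnickClass

variable {d : ℕ}

theorem isHilbertVariogram_variogram {Ξ : Type} [MeasurableSpace Ξ] {Q : Measure Ξ}
    {W : E d → Ξ → ℝ} (hW : IsStationaryIncrementGaussian Q W) :
    IsHilbertVariogram (variogram Q W) := by
  have hmem : ∀ t, MemLp (W t) 2 Q := fun t => (hW.gaussian.hasGaussianLaw_eval t).memLp_two
  refine ⟨Lp ℝ 2 Q, inferInstance, inferInstance, inferInstance, fun t => (hmem t).toLp, fun s t => ?_⟩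
  rw [← MemLp.toLp_sub, ← real_inner_self_eq_norm_sq, L2.inner_def, ← integral_sub_sq hW]
  refine integral_congr_ae ?_
  filter_upwards [((hmem s).sub (hmem t)).coeFn_toLp] with ξ hξ
  rw [hξ, real_inner_self_eq_norm_sq, Pi.sub_apply, Real.norm_eq_abs, sq_abs]

/-- The embedding by W_t ∈ L² gives one direction, the isonormal process the other. Membership in
the class becomes Hilbert space geometry. -/
theorem mem_TBR_iff {χ : E d → ℝ} :
    χ ∈ TBR d ↔ ∃ γ : E d → ℝ, IsHilbertVariogram γ ∧ ∀ t, χ t = erfc √(γ t / 8) := by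
  constructor
  · rintro ⟨Ξ, _, Q, _, W, hW, h⟩
    exact ⟨_, isHilbertVariogram_variogram hW, (isTCFOfSpectral_brSpectral_iff hW).1 h⟩
  · rintro ⟨γ, ⟨H, _, _, _, c, hc⟩, h⟩
    obtain ⟨Ξ, _, Q, _, W, hW, hγ⟩ := exists_gaussian_of_embedding hc
    exact ⟨Ξ, _, Q, inferInstance, W, hW, (isTCFOfSpectral_brSpectral_iff hW).2 fun t => by rw [h, hγ]⟩

theorem mem_TBRRadial {χ γ : E d → ℝ} (hγ : IsHilbertVariogram γ) (hrad : RadialToInfty γ)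
    (h : ∀ t, χ t = erfc √(γ t / 8)) : χ ∈ TBRRadial d := by
  obtain ⟨H, _, _, _, c, hc⟩ := hγ
  obtain ⟨Ξ, _, Q, _, W, hW, hγ⟩ := exists_gaussian_of_embedding hc
  exact ⟨Ξ, _, Q, inferInstance, W, hW, (funext hγ : variogram Q W = γ) ▸ hrad,
    (isTCFOfSpectral_brSpectral_iff hW).2 fun t => by rw [h, hγ]⟩

theorem IsHilbertVariogram.zero {γ : E d → ℝ} (h : IsHilbertVariogram γ) : γ 0 = 0 := by
  obtain ⟨H, _, _, _, c, hc⟩ := h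
  have := hc 0 0
  simpa using this.symm

theorem IsHilbertVariogram.nonneg {γ : E d → ℝ} (h : IsHilbertVariogram γ) (t : E d) : 0 ≤ γ t := by
  obtain ⟨H, _, _, _, c, hc⟩ := h
  have := hc t 0
  rw [sub_zero] at this
  rw [← this]
  positivity

/-- √γ(s - t) is the distance of the images of s and t; this is the triangle inequality through the
image of the origin. -/
theorem IsHilbertVariogram.sqrt_le {γ : E d → ℝ} (h : IsHilbertVariogram γ) (s t : E d) :
    √(γ (s - t)) ≤ √(γ s) + √(γ t) := by
  obtain ⟨H, _, _, _, c, hc⟩ := h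
  have e : ∀ s t, √(γ (s - t)) = ‖c s - c t‖ := fun s t => by
    rw [← hc, Real.sqrt_sq (norm_nonneg _)]
  have e' : ∀ s, √(γ s) = ‖c s - c 0‖ := fun s => by rw [← e, sub_zero]
  rw [e, e', e']
  exact norm_sub_le_norm_sub_add_norm_sub (c s) (c 0) (c t) |>.trans_eq (by rw [norm_sub_rev (c 0)])

theorem exists_norm_eq (hd : 1 ≤ d) {r : ℝ} (hr : 0 ≤ r) : ∃ t : E d, ‖t‖ = r :=
  ⟨EuclideanSpace.single ⟨0, hd⟩ r, by simp [abs_of_nonneg hr]⟩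

theorem exponent_mem_of_isHilbertVariogram (hd : 1 ≤ d) {α : ℝ} {γ : E d → ℝ} (hγ : IsHilbertVariogram γ)
    (h : ∀ t, ‖t‖ ^ α = √(γ t / 8)) : α ∈ Ioc (0 : ℝ) 1 := by
  have h8 : IsHilbertVariogram fun t => 8⁻¹ * γ t := hγ.const_mul (by norm_num)
  have h' : ∀ t, √(8⁻¹ * γ t) = ‖t‖ ^ α := fun t => by rw [h, div_eq_inv_mul]
  have htri : ∀ s t : E d, ‖s - t‖ ^ α ≤ ‖s‖ ^ α + ‖t‖ ^ α := fun s t => by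
    simpa only [h'] using h8.sqrt_le s t
  -- For α = 0 the convention 0^0 = 1 contradicts γ(0) = 0.
  have h0 : α ≠ 0 := by
    rintro rfl
    have := h 0
    simp [hγ.zero] at this
  have hpos : 0 < α := by
    by_contra hneg
    have hneg : α < 0 := lt_of_le_of_ne (not_lt.1 hneg) h0
    obtain ⟨u, hu⟩ := exists_norm_eq hd zero_le_one
    -- Two points at distance 1 from each other, far out on a ray: for α < 0 the triangle inequality
    -- bounds 1 by a quantity vanishing as R → ∞.
    have hbound : ∀ R : ℝ, 0 < R → 1 ≤ 2 * R ^ α := fun R hR => by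
      have h1 := htri ((R + 1) • u) (R • u)
      rw [← sub_smul, norm_smul, norm_smul, norm_smul, hu, mul_one, mul_one, mul_one,
        add_sub_cancel_left, norm_one, Real.one_rpow, Real.norm_of_nonneg hR.le,
        Real.norm_of_nonneg (by linarith : 0 ≤ R + 1)] at h1
      have h2 : (R + 1) ^ α ≤ R ^ α := Real.rpow_le_rpow_of_nonpos hR (by linarith) hneg.le
      linarith
    have hlim : Tendsto (fun R : ℝ => 2 * R ^ α) atTop (𝓝 (2 * 0)) := by
      have := tendsto_rpow_neg_atTop (neg_pos.2 hneg)
      rw [neg_neg] at this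
      exact this.const_mul 2
    have := ge_of_tendsto hlim (by filter_upwards [eventually_gt_atTop 0] with R hR using hbound R hR)
    norm_num at this
  refine ⟨hpos, ?_⟩
  obtain ⟨u, hu⟩ := exists_norm_eq hd zero_le_one
  -- Opposite unit vectors give 2^α ≤ 2.
  have h1 := htri u (-u)
  rw [sub_neg_eq_add, ← two_smul ℝ u, norm_smul, norm_neg, hu] at h1
  norm_num at h1
  by_contra hgt
  have : (2 : ℝ) ^ (1 : ℝ) < 2 ^ α := Real.rpow_lt_rpow_of_exponent_lt one_lt_two (not_le.1 hgt)
  norm_num at this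
  linarith

theorem isHilbertVariogram_norm_rpow' (hd : 1 ≤ d) {α : ℝ} (hα : α ∈ Ioc (0 : ℝ) 1) :
    IsHilbertVariogram fun t : E d => ‖t‖ ^ (2 * α) := by
  rcases hα.2.lt_or_eq with h1 | rfl
  · exact isHilbertVariogram_norm_rpow hd hα.1 h1
  · have := isHilbertVariogram_norm_sq (d := d)
    simp_rw [← Real.rpow_natCast] at this
    simpa using this

theorem erfc_norm_rpow_mem_TBRRadial (hd : 1 ≤ d) {α : ℝ} (hα : α ∈ Ioc (0 : ℝ) 1) :
    (fun t : E d => erfc (‖t‖ ^ α)) ∈ TBRRadial d := by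
  -- The factor 8 cancels the one in erfc √(γ/8).
  refine mem_TBRRadial ((isHilbertVariogram_norm_rpow' hd hα).const_mul (a := 8) (by norm_num))
    ⟨fun r => 8 * r ^ (2 * α), ?_, ?_, fun t => rfl⟩ fun t => ?_
  · intro x hx y _ hxy
    have := hα.1
    have hx : 0 ≤ x := hx
    simp only
    gcongr
  · exact (tendsto_rpow_atTop (by linarith [hα.1])).const_mul_atTop (by norm_num)
  · congr 1
    rw [mul_div_cancel_left₀ _ (by norm_num), mul_comm 2 α, Real.rpow_mul (norm_nonneg _)]
    norm_num
    rw [Real.sqrt_sq (Real.rpow_nonneg (norm_nonneg _) _)]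

theorem exponent_mem_of_mem_TBR (hd : 1 ≤ d) {α : ℝ} (h : (fun t : E d => erfc (‖t‖ ^ α)) ∈ TBR d) :
    α ∈ Ioc (0 : ℝ) 1 := by
  obtain ⟨γ, hγ, hχ⟩ := mem_TBR_iff.1 h
  exact exponent_mem_of_isHilbertVariogram hd hγ fun t => strictAnti_erfc.injective (hχ t)

end BrownResnickClass

/-! ### Positivity of variance-mixed Brown–Resnick TCFs -/

section VarianceMixed

variable {d : ℕ}

/-- The spectral functions are exponentials, so the minimum of two of them is positive everywhere
and has a positive integral. -/
theorem pos_of_mem_TVBR {χ : E d → ℝ} (h : χ ∈ TVBR d) (t : E d) : 0 < χ t := by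
  obtain ⟨Ξ, _, Q, _, W, S, hW, hS, hpos, hind, hχ⟩ := h
  rw [hχ.eq]
  refine ENNReal.toReal_pos ?_ ?_
  · rw [lintegral_eq_zero_iff ((hχ.measurable 0).min (hχ.measurable t)) |>.ne]
    intro h0
    have : ∀ᵐ ξ ∂Q, False := by
      filter_upwards [h0] with ξ hξ
      have : 0 < min (brSpectral Q S W 0 ξ) (brSpectral Q S W t ξ) :=
        lt_min (ENNReal.ofReal_pos.2 (Real.exp_pos _)) (ENNReal.ofReal_pos.2 (Real.exp_pos _))
      exact this.ne' hξ
    simp only [ae_iff, not_false_eq_true, measure_univ, ofPred_true, one_ne_zero] at this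
  · refine ne_top_of_le_ne_top ENNReal.one_ne_top ((lintegral_mono fun ξ => min_le_left _ _).trans_eq (hχ.lintegral 0))

theorem not_hasCompactSupport_of_mem_TVBR (hd : 1 ≤ d) {χ : E d → ℝ} (h : χ ∈ TVBR d) :
    ¬ HasCompactSupport χ := by
  intro hc
  have hu : tsupport χ = univ := by
    refine eq_univ_of_univ_subset fun t _ => subset_tsupport _ (pos_of_mem_TVBR h t).ne'
  have : Nonempty (Fin d) := ⟨⟨0, hd⟩⟩
  have := NormedSpace.noncompactSpace ℝ (E d)
  rw [HasCompactSupport, hu] at hc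
  exact noncompact_univ (E d) hc

end VarianceMixed

/-! ### Moving maxima and an M3r function of compact support -/

section MovingMaxima

variable {d : ℕ} {Ξ : Type} [MeasurableSpace Ξ] {Q : Measure Ξ} [IsProbabilityMeasure Q]
  {f : Ξ → E d → ℝ≥0∞}

theorem measurable_movingSpectral (hf : Measurable fun p : Ξ × E d => f p.1 p.2) (t : E d) :
    Measurable (movingSpectral f t) :=
  hf.comp (measurable_snd.prodMk (measurable_const.sub measurable_fst))

theorem lintegral_min_movingSpectral (hf : Measurable fun p : Ξ × E d => f p.1 p.2) (s t : E d) :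
    ∫⁻ p, min (movingSpectral f s p) (movingSpectral f t p) ∂((volume : Measure (E d)).prod Q) =
      ∫⁻ ξ, (∫⁻ x, min (f ξ (x + s)) (f ξ (x + t)) ∂volume) ∂Q := by
  rw [lintegral_prod_symm' _ ((measurable_movingSpectral hf s).min (measurable_movingSpectral hf t))]
  refine lintegral_congr fun ξ => ?_
  rw [← lintegral_neg_eq_self]
  simp only [movingSpectral, sub_neg_eq_add, add_comm]

theorem mem_TM3r_of (hf : Measurable fun p : Ξ × E d => f p.1 p.2)
    (hnorm : ∫⁻ ξ, (∫⁻ x, f ξ x ∂volume) ∂Q = 1) (hrad : ∀ ξ x y, ‖x‖ ≤ ‖y‖ → f ξ y ≤ f ξ x) :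
    (fun t => (∫⁻ ξ, (∫⁻ x, min (f ξ x) (f ξ (x + t)) ∂volume) ∂Q).toReal) ∈ TM3r d := by
  refine ⟨Ξ, _, Q, inferInstance, f, hf, hnorm, hrad, isTCFOfSpectral_of_lintegral
    (measurable_movingSpectral hf) (fun t => ?_) fun t => ?_⟩
  · have h := lintegral_min_movingSpectral (Q := Q) hf t t
    simp only [min_self] at h
    rw [h, ← hnorm]
    exact lintegral_congr fun ξ => lintegral_add_right_eq_self _ _
  · simp [lintegral_min_movingSpectral hf]

/-- The shape is the normalized indicator of the unit ball; its translates by t with ‖t‖ > 2 are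
disjoint from it. -/
theorem TM3r_diff_TVBR_nonempty (hd : 1 ≤ d) : (TM3r d \ TVBR d).Nonempty := by
  set B : Set (E d) := Metric.ball 0 1 with hB
  have hB0 : volume B ≠ 0 := (Metric.measure_ball_pos volume _ one_pos).ne'
  have hBt : volume B ≠ ∞ := measure_ball_lt_top.ne
  have hBm : MeasurableSet B := measurableSet_ball
  set f : Unit → E d → ℝ≥0∞ := fun _ => B.indicator fun _ => (volume B)⁻¹ with hf
  have hfm : Measurable fun p : Unit × E d => f p.1 p.2 :=
    (measurable_const.indicator hBm).comp measurable_snd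
  have hnorm : ∫⁻ ξ, (∫⁻ x, f ξ x ∂volume) ∂(Measure.dirac ()) = 1 := by
    simp only [hf, lintegral_dirac, lintegral_indicator_const hBm]
    exact ENNReal.inv_mul_cancel hB0 hBt
  refine ⟨_, mem_TM3r_of (Q := Measure.dirac ()) hfm hnorm fun _ x y hxy => ?_, fun h => ?_⟩
  · simp only [hf]
    by_cases hy : y ∈ B
    · have hx : x ∈ B := by
        rw [hB, mem_ball_zero_iff] at hy ⊢
        exact hxy.trans_lt hy
      rw [indicator_of_mem hx, indicator_of_mem hy]
    · rw [indicator_of_notMem hy]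
      exact zero_le
  · refine not_hasCompactSupport_of_mem_TVBR hd h
      (HasCompactSupport.intro (isCompact_closedBall (0 : E d) 2) fun t ht => ?_)
    simp only [lintegral_dirac]
    have : ∀ x, min (f () x) (f () (x + t)) = 0 := fun x => by
      by_cases hx : x ∈ B
      · have hxt : x + t ∉ B := fun hxt => ht (by
          rw [hB, mem_ball_zero_iff] at hx hxt
          rw [mem_closedBall_zero_iff]
          have := norm_sub_le (x + t) x
          rw [add_sub_cancel_left] at this
          linarith)
        simp [hf, indicator_of_notMem hxt]
      · simp [hf, indicator_of_notMem hx]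
    simp [this]

end MovingMaxima

/-! ### Moving maxima with Gaussian shapes in all dimensions -/

section GaussianShapes

variable {d : ℕ} {b : ℝ}

/-- The density of the centred Gaussian measure on `ℝ^d` with exponent `-b ‖x‖²`. -/
def gaussianShape (d : ℕ) (b : ℝ) (x : E d) : ℝ :=
  (∫ y : E d, Real.exp (-b * ‖y‖ ^ 2))⁻¹ * Real.exp (-b * ‖x‖ ^ 2)

theorem integral_exp_neg_mul_norm_sq_pos (hb : 0 < b) :
    0 < ∫ y : E d, Real.exp (-b * ‖y‖ ^ 2) := by
  rw [GaussianFourier.integral_rexp_neg_mul_sq_norm hb]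
  positivity

theorem gaussianShape_pos (hb : 0 < b) (x : E d) : 0 < gaussianShape d b x :=
  mul_pos (inv_pos.2 (integral_exp_neg_mul_norm_sq_pos hb)) (Real.exp_pos _)

theorem continuous_gaussianShape : Continuous (gaussianShape d b) := by
  unfold gaussianShape
  fun_prop

theorem gaussianShape_le (hb : 0 < b) {x y : E d} (h : ‖x‖ ≤ ‖y‖) :
    gaussianShape d b y ≤ gaussianShape d b x := by
  unfold gaussianShape
  have := (integral_exp_neg_mul_norm_sq_pos (d := d) hb).le
  have h2 := mul_le_mul_of_nonneg_left (pow_le_pow_left₀ (norm_nonneg x) h 2) hb.le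
  refine mul_le_mul_of_nonneg_left (Real.exp_le_exp.2 ?_) (inv_nonneg.2 this)
  linarith

theorem lintegral_gaussianShape (hb : 0 < b) :
    ∫⁻ x : E d, ENNReal.ofReal (gaussianShape d b x) = 1 := by
  have hpos := integral_exp_neg_mul_norm_sq_pos (d := d) hb
  have hint : Integrable fun y : E d => Real.exp (-b * ‖y‖ ^ 2) := by
    by_contra h
    exact hpos.ne' (integral_undef h)
  have hint' : Integrable (gaussianShape d b) := hint.const_mul _
  rw [← ofReal_integral_eq_lintegral_ofReal hint'
    (.of_forall fun x => (gaussianShape_pos hb x).le)]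
  unfold gaussianShape
  rw [integral_const_mul, inv_mul_cancel₀ hpos.ne', ENNReal.ofReal_one]

/-- This is the characteristic function of the log-ratio of the density at x + t and at x, under the
Gaussian density itself; it identifies that log-ratio as normal. -/
theorem integral_gaussianShape_mul_cexp (hb : 0 < b) (t : E d) (s : ℝ) :
    ∫ x : E d, (gaussianShape d b x : ℂ) *
        Complex.exp (s * (-(2 * b * inner ℝ t x + b * ‖t‖ ^ 2) : ℝ) * Complex.I) =
      Complex.exp (-(s * b * ‖t‖ ^ 2) * Complex.I - b * s ^ 2 * ‖t‖ ^ 2) := by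
  have hb' : 0 < (b : ℂ).re := by simpa using hb
  have hbc : (b : ℂ) ≠ 0 := by exact_mod_cast hb.ne'
  have hC : ((∫ y : E d, Real.exp (-b * ‖y‖ ^ 2) : ℝ) : ℂ) ≠ 0 := by
    exact_mod_cast (integral_exp_neg_mul_norm_sq_pos (d := d) hb).ne'
  have hCeq : ((∫ y : E d, Real.exp (-b * ‖y‖ ^ 2) : ℝ) : ℂ) =
      (Real.pi / b : ℂ) ^ (Module.finrank ℝ (E d) / 2 : ℂ) := by
    rw [← GaussianFourier.integral_cexp_neg_mul_sq_norm hb', ← integral_complex_ofReal]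
    simp
  have key := GaussianFourier.integral_cexp_neg_mul_sq_norm_add hb' (-(2 * b * s) * Complex.I) t
  rw [← hCeq] at key
  calc _ = ∫ x : E d, (((∫ y : E d, Real.exp (-b * ‖y‖ ^ 2))⁻¹ : ℝ) : ℂ) *
        Complex.exp (-(s * b * ‖t‖ ^ 2) * Complex.I) *
        Complex.exp (-b * ‖x‖ ^ 2 + -(2 * b * s) * Complex.I * inner ℝ t x) := by
        refine integral_congr_ae (.of_forall fun x => ?_)
        simp only [gaussianShape]
        push_cast
        rw [mul_assoc, mul_assoc (_⁻¹), ← Complex.exp_add, ← Complex.exp_add]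
        congr 2
        ring
    _ = _ := by
        rw [integral_const_mul, key, Complex.ofReal_inv]
        rw [show ∀ a e f : ℂ, a⁻¹ * e * (a * f) = (a⁻¹ * a) * (e * f) from fun a e f => by ring,
          inv_mul_cancel₀ hC, one_mul, ← Complex.exp_add]
        congr 1
        field_simp
        linear_combination 4 * (s : ℂ) ^ 2 * (‖t‖ : ℂ) ^ 2 * Complex.I_sq

/-- With L the log-ratio of the two densities, the minimum is p(x) min(1, e^L). Under p, L is normal
with mean -v/2 and variance v = 2b‖t‖², so the Brown–Resnick integral applies. No dependence on the
dimension remains. -/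
theorem lintegral_min_gaussianShape (hb : 0 < b) (t : E d) :
    ∫⁻ x, min (ENNReal.ofReal (gaussianShape d b x)) (ENNReal.ofReal (gaussianShape d b (x + t))) =
      ENNReal.ofReal (erfc (√b * ‖t‖ / 2)) := by
  set p : E d → ℝ≥0∞ := fun x => ENNReal.ofReal (gaussianShape d b x) with hp
  have hpm : Measurable p := continuous_gaussianShape.measurable.ennreal_ofReal
  set G : Measure (E d) := volume.withDensity p with hG
  have : IsProbabilityMeasure G := ⟨by
    rw [hG, withDensity_apply _ .univ, Measure.restrict_univ, lintegral_gaussianShape hb]⟩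
  set L : E d → ℝ := fun x => -(2 * b * inner ℝ t x + b * ‖t‖ ^ 2) with hL
  have hLm : Measurable L := by fun_prop
  have hmin : ∀ x, min (ENNReal.ofReal (gaussianShape d b x))
      (ENNReal.ofReal (gaussianShape d b (x + t))) =
      p x * ENNReal.ofReal (min 1 (Real.exp (L x))) := fun x => by
    have h1 : gaussianShape d b (x + t) = gaussianShape d b x * Real.exp (L x) := by
      simp only [gaussianShape, hL]
      rw [mul_assoc, ← Real.exp_add, norm_add_sq_real, real_inner_comm]
      congr 2
      ring
    rw [← ENNReal.ofReal_min, h1, hp, ← ENNReal.ofReal_mul (gaussianShape_pos hb x).le,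
      mul_min_of_nonneg _ _ (gaussianShape_pos hb x).le, mul_one]
  set v : ℝ≥0 := NNReal.mk (2 * b * ‖t‖ ^ 2) (by positivity) with hv
  have hvc : (v : ℝ) = 2 * b * ‖t‖ ^ 2 := rfl
  have hlaw : G.map L = gaussianReal (-(v / 2)) v := by
    have : IsProbabilityMeasure (G.map L) := Measure.isProbabilityMeasure_map hLm.aemeasurable
    refine Measure.ext_of_charFun (funext fun s => ?_)
    rw [charFun_gaussianReal, charFun_apply_real, integral_map hLm.aemeasurable (by fun_prop), hG,
      integral_withDensity_eq_integral_toReal_smul hpm (.of_forall fun x => ENNReal.ofReal_lt_top)]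
    simp only [hp, ENNReal.toReal_ofReal (gaussianShape_pos hb _).le, Complex.real_smul]
    rw [integral_gaussianShape_mul_cexp hb, hvc]
    congr 1
    push_cast
    ring
  simp_rw [hmin]
  have hm : Measurable fun y : ℝ => ENNReal.ofReal (min 1 (Real.exp y)) := by fun_prop
  have h1 := lintegral_withDensity_eq_lintegral_mul volume hpm (hm.comp hLm)
  simp only [Pi.mul_apply, Function.comp_apply] at h1
  rw [← h1, ← lintegral_map hm hLm, ← hG, hlaw, lintegral_min_one_exp_gaussianReal, hvc]
  congr 2
  rw [show 2 * b * ‖t‖ ^ 2 / 8 = b * (‖t‖ / 2) ^ 2 by ring, Real.sqrt_mul hb.le,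
    Real.sqrt_sq (by positivity)]
  ring

theorem sqrt_four_and_hundred : √(4 : ℝ) = 2 ∧ √(100 : ℝ) = 10 :=
  ⟨by rw [show (4 : ℝ) = 2 ^ 2 by norm_num, Real.sqrt_sq zero_le_two],
    by rw [show (100 : ℝ) = 10 ^ 2 by norm_num, Real.sqrt_sq (by norm_num)]⟩

theorem erfc_mixture_mem_TM3r :
    (fun t : E d => 1 / 4 * erfc ‖t‖ + 3 / 4 * erfc (5 * ‖t‖)) ∈ TM3r d := by
  set Q : Measure Bool := ENNReal.ofReal (1 / 4) • Measure.dirac false +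
    ENNReal.ofReal (3 / 4) • Measure.dirac true with hQ
  have hsum : ENNReal.ofReal (1 / 4) + ENNReal.ofReal (3 / 4) = 1 := by
    rw [← ENNReal.ofReal_add (by norm_num) (by norm_num)]
    norm_num
  have : IsProbabilityMeasure Q := ⟨by
    rw [hQ, Measure.add_apply, Measure.smul_apply, Measure.smul_apply, measure_univ, measure_univ,
      smul_eq_mul, smul_eq_mul, mul_one, mul_one, hsum]⟩
  -- The exponents 4 and 100 make √b/2 equal to 1 and 5.
  obtain ⟨β, hβ0, hβf, hβt⟩ : ∃ β : Bool → ℝ, (∀ ξ, 0 < β ξ) ∧ β false = 4 ∧ β true = 100 :=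
    ⟨fun ξ => cond ξ 100 4, by simp, rfl, rfl⟩
  have hfm : Measurable fun p : Bool × E d => ENNReal.ofReal (gaussianShape d (β p.1) p.2) :=
    measurable_from_prod_countable_right fun ξ =>
      (continuous_gaussianShape (b := β ξ)).measurable.ennreal_ofReal
  have hn : ∫⁻ ξ, (∫⁻ x, ENNReal.ofReal (gaussianShape d (β ξ) x) ∂volume) ∂Q = 1 := by
    simp only [lintegral_gaussianShape (hβ0 _), lintegral_const, measure_univ, mul_one]
  have h := mem_TM3r_of (Q := Q) hfm hn
    fun ξ x y hxy => ENNReal.ofReal_le_ofReal (gaussianShape_le (hβ0 ξ) hxy)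
  suffices heq : ∀ t : E d, (∫⁻ ξ, (∫⁻ x, min (ENNReal.ofReal (gaussianShape d (β ξ) x))
      (ENNReal.ofReal (gaussianShape d (β ξ) (x + t))) ∂volume) ∂Q).toReal =
      1 / 4 * erfc ‖t‖ + 3 / 4 * erfc (5 * ‖t‖) by
    simpa only [heq] using h
  intro t
  have h1 := (erfc_pos ‖t‖).le
  have h5 := (erfc_pos (5 * ‖t‖)).le
  have e1 : √(4 : ℝ) * ‖t‖ / 2 = ‖t‖ := by rw [sqrt_four_and_hundred.1]; ring
  have e5 : √(100 : ℝ) * ‖t‖ / 2 = 5 * ‖t‖ := by rw [sqrt_four_and_hundred.2]; ring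
  simp only [lintegral_min_gaussianShape (hβ0 _)]
  rw [hQ, lintegral_add_measure, lintegral_smul_measure, lintegral_smul_measure, lintegral_dirac,
    lintegral_dirac, hβf, hβt, e1, e5, smul_eq_mul, smul_eq_mul, ← ENNReal.ofReal_mul (by norm_num),
    ← ENNReal.ofReal_mul (by norm_num), ← ENNReal.ofReal_add (by positivity) (by positivity),
    ENNReal.toReal_ofReal (by positivity)]

theorem erfc_mixture_mem_TM3rInfty :
    (fun r : ℝ≥0 => 1 / 4 * erfc r + 3 / 4 * erfc (5 * r)) ∈ TM3rInfty :=
  fun _ _ => erfc_mixture_mem_TM3r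

end GaussianShapes

/-! ### Convexity of the cells of a hyperplane mosaic -/

section ConvexCells

variable {d : ℕ}

/-- The component of x consists of the points on the same side as x of every hyperplane, an
intersection of open half-spaces. Leaving a side would force a zero by the intermediate value
theorem; conversely a convex set is preconnected. -/
theorem convex_connectedComponentIn_compl_hyperplanes (h : ℕ → Metric.sphere (0 : E d) 1 × ℝ)
    {x : E d} (hx : x ∈ (⋃ n, hyperplane (h n))ᶜ) :
    Convex ℝ (connectedComponentIn (⋃ n, hyperplane (h n))ᶜ x) := by
  set g : ℕ → E d → ℝ := fun n y => inner ℝ y ((h n).1 : E d) - (h n).2 with hg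
  have hU : ∀ y, y ∈ (⋃ n, hyperplane (h n))ᶜ ↔ ∀ n, g n y ≠ 0 := fun y => by
    simp [hyperplane, hg, sub_eq_zero]
  have hconv : Convex ℝ {y | ∀ n, 0 < g n x * g n y} := by
    intro y hy z hz a b ha hb hab n
    have e : g n x * g n (a • y + b • z) = a * (g n x * g n y) + b * (g n x * g n z) := by
      simp only [hg, inner_add_left, real_inner_smul_left]
      linear_combination ((inner ℝ x ((h n).1 : E d) - (h n).2) * (h n).2) * hab
    rw [e]
    rcases ha.eq_or_lt with rfl | ha
    · have : b = 1 := by linarith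
      simpa [this] using hz n
    · have := mul_pos ha (hy n)
      have := mul_nonneg hb (hz n).le
      linarith
  have hxD : x ∈ {y | ∀ n, 0 < g n x * g n y} := fun n => mul_self_pos.2 ((hU x).1 hx n)
  convert hconv using 1
  refine Subset.antisymm (fun y hy n => ?_) ?_
  · by_contra hneg
    have hcont : Continuous fun y => g n x * g n y := by fun_prop
    obtain ⟨z, hz, hz0⟩ := isPreconnected_connectedComponentIn.intermediate_value hy
      (mem_connectedComponentIn hx) hcont.continuousOn ⟨not_lt.1 hneg, (hxD n).le⟩
    rcases mul_eq_zero.1 hz0 with h0 | h0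
    · exact (hU x).1 hx n h0
    · exact (hU z).1 (connectedComponentIn_subset _ _ hz) n h0
  · exact hconv.isPreconnected.subset_connectedComponentIn hxD fun y hy =>
      (hU y).2 fun n => right_ne_zero_of_mul (hy n).ne'

theorem convex_of_mem_cells {h : ℕ → Metric.sphere (0 : E d) 1 × ℝ} {K : Set (E d)}
    (hK : K ∈ cells h) : Convex ℝ K := by
  obtain ⟨x, hx, rfl⟩ := hK
  exact (convex_connectedComponentIn_compl_hyperplanes h hx).closure

theorem convex_image_sub {K : Set (E d)} (hK : Convex ℝ K) (c : E d) :
    Convex ℝ ((fun x => x - c) '' K) := by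
  simpa only [sub_eq_neg_add] using hK.translate (-c)

/-- For a fixed triple the failure of convexity involves only three membership events, so it is
measurable. No cell realizes it, and the Palm law therefore gives it mass 0. -/
theorem IsTypicalCell.ae_mem_of_mem_segment {Ξ : Type} [MeasurableSpace Ξ] {Q : Measure Ξ}
    {C : Ξ → Set (E d)} (hC : IsTypicalCell Q C) {y z w : E d} (hw : w ∈ segment ℝ y z) :
    ∀ᵐ ξ ∂Q, y ∈ C ξ → z ∈ C ξ → w ∈ C ξ := by
  obtain ⟨Ω, _, P, _, h, -, hlaw⟩ := hC.law
  set 𝒜 : Set (Set (E d)) := {K | y ∈ K ∧ z ∈ K ∧ w ∉ K} with h𝒜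
  have hm : MeasurableSet 𝒜 :=
    (measurableSet_setOfPred.2 (measurable_set_mem y)).inter
      ((measurableSet_setOfPred.2 (measurable_set_mem z)).inter
        (measurableSet_setOfPred.2 (measurable_set_mem w)).compl)
  have h0 : cellIntensity P h 𝒜 = 0 := by
    have : ∀ ω, {K ∈ cells (fun n => h n ω) | centroid K ∈ unitCube d ∧
        (fun x => x - centroid K) '' K ∈ 𝒜} = ∅ := fun ω => by
      refine eq_empty_of_forall_notMem fun K hK => ?_
      have hconv := convex_image_sub (convex_of_mem_cells hK.1) (centroid K)
      exact hK.2.2.2.2 (hconv.segment_subset hK.2.2.1 hK.2.2.2.1 hw)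
    simp only [cellIntensity, this]
    simp
  have hQ := hlaw 𝒜 hm
  rw [h0, ENNReal.zero_div] at hQ
  rw [ae_iff, ← hQ]
  congr 1
  ext ξ
  simp [h𝒜]

end ConvexCells

/-! ### A midpoint inequality for mixed Poisson storm TCFs -/

section MixedPoissonStorms

variable {d : ℕ} {Ξ : Type} {Λ : Ξ → ℝ} {C : Ξ → Set (E d)}

/-- Take four equally spaced points with step t/2. If either pair at lag t lies in the cell, so does
the middle pair; if both pairs do, all four points lie in it, including the outer pair. -/
theorem ae_stormShape_four_point {ξ : Ξ} {t : E d} (h : ∀ᵐ x : E d,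
      Λ ξ • x ∈ C ξ → Λ ξ • (x + t) ∈ C ξ → Λ ξ • (x + (1 / 2 : ℝ) • t) ∈ C ξ) :
    ∀ᵐ x : E d,
      min (stormShape Λ C ξ x) (stormShape Λ C ξ (x + t)) +
        min (stormShape Λ C ξ (x + (1 / 2 : ℝ) • t)) (stormShape Λ C ξ (x + (3 / 2 : ℝ) • t)) ≤
      min (stormShape Λ C ξ (x + (1 / 2 : ℝ) • t)) (stormShape Λ C ξ (x + t)) +
        min (stormShape Λ C ξ x) (stormShape Λ C ξ (x + (3 / 2 : ℝ) • t)) := by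
  -- The shift by t/2 gives the second midpoint implication, from x + t/2 and x + 3t/2 to x + t.
  filter_upwards [h, (quasiMeasurePreserving_add_right volume ((1 / 2 : ℝ) • t)).ae h] with x h1 h2
  rw [show x + (1 / 2 : ℝ) • t + t = x + (3 / 2 : ℝ) • t by module,
    show x + (1 / 2 : ℝ) • t + (1 / 2 : ℝ) • t = x + t by module] at h2
  by_cases m1 : Λ ξ • x ∈ C ξ <;> by_cases m2 : Λ ξ • (x + (1 / 2 : ℝ) • t) ∈ C ξ <;>
    by_cases m3 : Λ ξ • (x + t) ∈ C ξ <;> by_cases m4 : Λ ξ • (x + (3 / 2 : ℝ) • t) ∈ C ξ <;>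
    simp only [stormShape, indicator, mem_ofPred_eq, m1, m2, m3, m4, if_true, if_false,
      min_self, zero_min, min_zero, le_refl, add_zero, zero_add, zero_le] <;> tauto

variable [MeasurableSpace Ξ] {Q : Measure Ξ}

theorem measurableSet_scaled_mem (hΛ : Measurable Λ) (hC : MeasurableSet {p : Ξ × E d | p.2 ∈ C p.1}) :
    MeasurableSet {p : Ξ × E d | Λ p.1 • p.2 ∈ C p.1} := by
  have : Measurable fun p : Ξ × E d => (p.1, Λ p.1 • p.2) := by fun_prop
  exact this hC

theorem measurable_stormShape (hΛ : Measurable Λ)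
    (hC : MeasurableSet {p : Ξ × E d | p.2 ∈ C p.1}) :
    Measurable fun p : Ξ × E d => stormShape Λ C p.1 p.2 := by
  have hc : Measurable fun p : Ξ × E d => ENNReal.ofReal (cellNorm d (Λ p.1)) := by
    unfold cellNorm
    fun_prop
  exact hc.indicator (measurableSet_scaled_mem hΛ hC)

/-- The four-point inequality is integrated in x. By translation invariance both left-hand terms
have lag t, and the right-hand ones have lags t/2 and 3t/2. -/
theorem two_mul_lintegral_min_stormShape_le (hΛ : Measurable Λ) (hC : IsTypicalCell Q C) {t : E d}
    (h : ∀ᵐ ξ ∂Q, ∀ᵐ x : E d,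
      Λ ξ • x ∈ C ξ → Λ ξ • (x + t) ∈ C ξ → Λ ξ • (x + (1 / 2 : ℝ) • t) ∈ C ξ) :
    2 * ∫⁻ ξ, (∫⁻ x, min (stormShape Λ C ξ x) (stormShape Λ C ξ (x + t)) ∂volume) ∂Q ≤
      ∫⁻ ξ, (∫⁻ x, min (stormShape Λ C ξ x)
        (stormShape Λ C ξ (x + (1 / 2 : ℝ) • t)) ∂volume) ∂Q +
      ∫⁻ ξ, (∫⁻ x, min (stormShape Λ C ξ x)
        (stormShape Λ C ξ (x + (3 / 2 : ℝ) • t)) ∂volume) ∂Q := by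
  have hm := measurable_stormShape hΛ hC.measurable
  have hm2 : ∀ a b : E d, Measurable fun p : Ξ × E d =>
      min (stormShape Λ C p.1 (p.2 + a)) (stormShape Λ C p.1 (p.2 + b)) := fun a b =>
    (hm.comp (measurable_fst.prodMk (measurable_snd.add_const a))).min
      (hm.comp (measurable_fst.prodMk (measurable_snd.add_const b)))
  have hm0 : ∀ b : E d, Measurable fun p : Ξ × E d =>
      min (stormShape Λ C p.1 p.2) (stormShape Λ C p.1 (p.2 + b)) := fun b => by
    simpa using hm2 0 b
  have hshift : ∀ (ξ : Ξ) (a b c : E d), c = b - a →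
      ∫⁻ x, min (stormShape Λ C ξ (x + a)) (stormShape Λ C ξ (x + b)) =
        ∫⁻ x, min (stormShape Λ C ξ x) (stormShape Λ C ξ (x + c)) := by
    rintro ξ a b c rfl
    rw [← lintegral_add_right_eq_self (fun x => min (stormShape Λ C ξ x) _) a]
    simp only [add_assoc, add_sub_cancel]
  rw [two_mul, ← lintegral_add_left (hm0 _).lintegral_prod_right',
    ← lintegral_add_left (hm0 _).lintegral_prod_right']
  refine lintegral_mono_ae ?_
  filter_upwards [h] with ξ hξ
  have hle := lintegral_mono_ae (ae_stormShape_four_point hξ)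
  have hs : ∀ a b : E d, Measurable fun x =>
      min (stormShape Λ C ξ (x + a)) (stormShape Λ C ξ (x + b)) := fun a b =>
    (hm2 a b).comp measurable_prodMk_left
  have hs0 : ∀ b : E d, Measurable fun x => min (stormShape Λ C ξ x) (stormShape Λ C ξ (x + b)) :=
    fun b => (hm0 b).comp measurable_prodMk_left
  rw [lintegral_add_left (hs0 _), lintegral_add_left (hs _ _),
    hshift ξ _ _ t (by module), hshift ξ _ _ ((1 / 2 : ℝ) • t) (by module)] at hle
  exact hle

variable [IsProbabilityMeasure Q]

/-- Convexity is available almost surely for each fixed triple only. Fubini converts this to almost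
every (t, x) for almost every ξ, which survives the random dilation; a second exchange puts t
outermost. -/
theorem ae_ae_ae_midpoint_mem (hΛ : Measurable Λ) (hpos : ∀ᵐ ξ ∂Q, 0 < Λ ξ)
    (hC : IsTypicalCell Q C) :
    ∀ᵐ t : E d, ∀ᵐ ξ ∂Q, ∀ᵐ x : E d,
      Λ ξ • x ∈ C ξ → Λ ξ • (x + t) ∈ C ξ → Λ ξ • (x + (1 / 2 : ℝ) • t) ∈ C ξ := by
  have hCm := hC.measurable
  have hPm : MeasurableSet {p : (E d × E d) × Ξ |
      p.1.2 ∈ C p.2 → p.1.2 + p.1.1 ∈ C p.2 → p.1.2 + (1 / 2 : ℝ) • p.1.1 ∈ C p.2} := by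
    have m1 : Measurable fun p : (E d × E d) × Ξ => (p.2, p.1.2) := by fun_prop
    have m2 : Measurable fun p : (E d × E d) × Ξ => (p.2, p.1.2 + p.1.1) := by fun_prop
    have m3 : Measurable fun p : (E d × E d) × Ξ => (p.2, p.1.2 + (1 / 2 : ℝ) • p.1.1) := by fun_prop
    exact (measurableSet_setOfPred.1 (m1 hCm)).imp
      ((measurableSet_setOfPred.1 (m2 hCm)).imp (measurableSet_setOfPred.1 (m3 hCm))) |> measurableSet_setOfPred.2
  have hPm' : MeasurableSet {p : (E d × E d) × Ξ |
      Λ p.2 • p.1.2 ∈ C p.2 → Λ p.2 • (p.1.2 + p.1.1) ∈ C p.2 →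
        Λ p.2 • (p.1.2 + (1 / 2 : ℝ) • p.1.1) ∈ C p.2} := by
    have hCm := measurableSet_scaled_mem hΛ hCm
    have m1 : Measurable fun p : (E d × E d) × Ξ => (p.2, p.1.2) := by fun_prop
    have m2 : Measurable fun p : (E d × E d) × Ξ => (p.2, p.1.2 + p.1.1) := by fun_prop
    have m3 : Measurable fun p : (E d × E d) × Ξ => (p.2, p.1.2 + (1 / 2 : ℝ) • p.1.1) := by fun_prop
    exact (measurableSet_setOfPred.1 (m1 hCm)).imp
      ((measurableSet_setOfPred.1 (m2 hCm)).imp (measurableSet_setOfPred.1 (m3 hCm))) |> measurableSet_setOfPred.2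
  have h1 : ∀ᵐ p : E d × E d, ∀ᵐ ξ ∂Q,
      p.2 ∈ C ξ → p.2 + p.1 ∈ C ξ → p.2 + (1 / 2 : ℝ) • p.1 ∈ C ξ := by
    refine .of_forall fun p => hC.ae_mem_of_mem_segment
      ⟨1 / 2, 1 / 2, by norm_num, by norm_num, by norm_num, ?_⟩
    module
  rw [Measure.ae_ae_comm (p := fun (p : E d × E d) (ξ : Ξ) =>
    p.2 ∈ C ξ → p.2 + p.1 ∈ C ξ → p.2 + (1 / 2 : ℝ) • p.1 ∈ C ξ) hPm] at h1
  have h2 : ∀ᵐ ξ ∂Q, ∀ᵐ p : E d × E d, Λ ξ • p.2 ∈ C ξ → Λ ξ • (p.2 + p.1) ∈ C ξ →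
      Λ ξ • (p.2 + (1 / 2 : ℝ) • p.1) ∈ C ξ := by
    filter_upwards [h1, hpos] with ξ hξ hΛξ
    have : (volume : Measure (E d × E d)).IsAddHaarMeasure :=
      inferInstanceAs ((volume : Measure (E d)).prod volume).IsAddHaarMeasure
    -- Dilation by Λ ξ acts on t and x together and preserves null sets.
    have := Measure.addHaar_preimage_smul (volume : Measure (E d × E d)) hΛξ.ne'
      {p | ¬ (p.2 ∈ C ξ → p.2 + p.1 ∈ C ξ → p.2 + (1 / 2 : ℝ) • p.1 ∈ C ξ)}
    rw [ae_iff.1 hξ, mul_zero] at this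
    rw [ae_iff, ← this]
    congr 1
    ext p
    simp only [mem_ofPred_eq, preimage_ofPred_eq, Prod.smul_fst, Prod.smul_snd, smul_add,
      smul_comm (Λ ξ) (1 / 2 : ℝ)]
  rw [← Measure.ae_ae_comm (p := fun (p : E d × E d) (ξ : Ξ) => Λ ξ • p.2 ∈ C ξ →
    Λ ξ • (p.2 + p.1) ∈ C ξ → Λ ξ • (p.2 + (1 / 2 : ℝ) • p.1) ∈ C ξ) hPm'] at h2
  filter_upwards [Measure.ae_ae_of_ae_prod h2] with t ht
  refine (Measure.ae_ae_comm (p := fun (x : E d) (ξ : Ξ) => Λ ξ • x ∈ C ξ →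
    Λ ξ • (x + t) ∈ C ξ → Λ ξ • (x + (1 / 2 : ℝ) • t) ∈ C ξ) ?_).1 ht
  have m : Measurable fun p : E d × Ξ => ((t, p.1), p.2) := by fun_prop
  exact m hPm'

theorem ae_two_mul_le_of_mem_TMPS {χ : E d → ℝ} (h : χ ∈ TMPS d) :
    ∀ᵐ t : E d, 2 * χ t ≤ χ ((1 / 2 : ℝ) • t) + χ ((3 / 2 : ℝ) • t) := by
  obtain ⟨Ξ, _, Q, _, Λ, C, hΛ, hpos, hC, -, hχ⟩ := h
  have hm := measurable_stormShape hΛ hC.measurable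
  set F : E d → ℝ≥0∞ := fun t =>
    ∫⁻ ξ, (∫⁻ x, min (stormShape Λ C ξ x) (stormShape Λ C ξ (x + t)) ∂volume) ∂Q with hF
  have hFeq : ∀ t, ∫⁻ p, min (movingSpectral (stormShape Λ C) 0 p)
      (movingSpectral (stormShape Λ C) t p) ∂((volume : Measure (E d)).prod Q) = F t := fun t => by
    simp only [lintegral_min_movingSpectral hm, add_zero, hF]
  have hFtop : ∀ t, F t ≠ ∞ := fun t => by
    rw [← hFeq]
    exact ne_top_of_le_ne_top ENNReal.one_ne_top
      ((lintegral_mono fun ξ => min_le_left _ _).trans_eq (hχ.lintegral 0))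
  have hχF : ∀ t, χ t = (F t).toReal := fun t => by rw [hχ.eq, hFeq]
  filter_upwards [ae_ae_ae_midpoint_mem hΛ hpos hC] with t ht
  have hle := ENNReal.toReal_mono (ENNReal.add_ne_top.2 ⟨hFtop _, hFtop _⟩)
    (two_mul_lintegral_min_stormShape_le hΛ hC ht)
  rw [ENNReal.toReal_mul, ENNReal.toReal_add (hFtop _) (hFtop _)] at hle
  rw [hχF, hχF, hχF]
  simpa using hle

end MixedPoissonStorms

/-! ### A radial Brown–Resnick TCF violating the midpoint inequality -/

section Witness

variable {d : ℕ}

theorem hasDerivAt_erfc_sqrt_one_add {a : ℝ} :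
    HasDerivAt (fun ε => erfc √(1 + a * ε)) (-(2 / √Real.pi * Real.exp (-1)) * (a / 2)) 0 := by
  have h1 : HasDerivAt (fun ε : ℝ => 1 + a * ε) a 0 := by
    simpa using ((hasDerivAt_id (0 : ℝ)).const_mul a).const_add 1
  have h2 : HasDerivAt (fun ε : ℝ => √(1 + a * ε)) (a / 2) 0 := by
    simpa using h1.sqrt (by simp)
  have h3 := hasDerivAt_erfc 1
  rw [one_pow] at h3
  exact HasDerivAt.comp (h₂ := erfc) (0 : ℝ) (by simpa using h3) h2

/-- With ε = r² the difference of the two sides vanishes at ε = 0 and has slope proportional to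
-(1/4 + 9/4 - 2) < 0. -/
theorem exists_erfc_sqrt_one_add_lt :
    ∃ r : ℝ, 0 < r ∧ erfc √(1 + (1 / 2 * r) ^ 2) + erfc √(1 + (3 / 2 * r) ^ 2) <
      2 * erfc √(1 + r ^ 2) := by
  set q : ℝ → ℝ := fun ε =>
    erfc √(1 + 1 / 4 * ε) + erfc √(1 + 9 / 4 * ε) - 2 * erfc √(1 + 1 * ε) with hq
  have hder := (((hasDerivAt_erfc_sqrt_one_add (a := 1 / 4)).add
    (hasDerivAt_erfc_sqrt_one_add (a := 9 / 4))).sub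
      ((hasDerivAt_erfc_sqrt_one_add (a := 1)).const_mul 2))
  have hc : 0 < 2 / √Real.pi * Real.exp (-1) := by positivity
  have hlim := (hasDerivAt_iff_tendsto_slope_zero.1 hder).mono_left
    (nhdsWithin_mono _ fun x (hx : x ∈ Ioi (0 : ℝ)) => (ne_of_gt hx : x ≠ 0))
  obtain ⟨ε, hε, hε0⟩ := ((hlim.eventually_lt_const (u := 0) (by linarith)).and
    self_mem_nhdsWithin).exists
  have hε0 : 0 < ε := hε0
  refine ⟨√ε, Real.sqrt_pos.2 hε0, ?_⟩
  rw [mul_pow, mul_pow, Real.sq_sqrt hε0.le]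
  simp only [smul_eq_mul, Pi.add_apply, Pi.sub_apply, zero_add, mul_zero, add_zero] at hε
  have := (pos_iff_neg_of_mul_neg hε).1 (inv_pos.2 hε0)
  norm_num at this ⊢
  linarith

/-- Since s^(2β) → 1 as β ↓ 0 for each s > 0, the strict inequality for erfc √(1 + s²) persists for
some small β > 0. A positive β keeps the resulting function continuous at the origin. -/
theorem exists_norm_profile_lt :
    ∃ β : ℝ, β ∈ Ioo (0 : ℝ) 1 ∧ ∃ r : ℝ, 0 < r ∧
      erfc √((1 / 2 * r) ^ (2 * β) + (1 / 2 * r) ^ 2) +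
        erfc √((3 / 2 * r) ^ (2 * β) + (3 / 2 * r) ^ 2) < 2 * erfc √(r ^ (2 * β) + r ^ 2) := by
  obtain ⟨r, hr, hlt⟩ := exists_erfc_sqrt_one_add_lt
  have hlim : ∀ s : ℝ, 0 < s → Tendsto (fun β : ℝ => erfc √(s ^ (2 * β) + s ^ 2)) (𝓝[>] 0)
      (𝓝 (erfc √(1 + s ^ 2))) := fun s hs => by
    have hcont : ContinuousAt (fun β : ℝ => erfc √(s ^ (2 * β) + s ^ 2)) 0 := by
      have h1 : ContinuousAt (fun β : ℝ => s ^ (2 * β)) 0 :=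
        ContinuousAt.rpow continuousAt_const (by fun_prop) (Or.inl hs.ne')
      exact continuous_erfc.continuousAt.comp
        (Real.continuous_sqrt.continuousAt.comp (h1.add continuousAt_const))
    have := hcont.tendsto.mono_left (nhdsWithin_le_nhds (s := Ioi 0))
    simpa using this
  have h1 := (hlim _ (show 0 < 1 / 2 * r by positivity)).add
    (hlim _ (show 0 < 3 / 2 * r by positivity))
  obtain ⟨β, hβ, hβ1⟩ := ((h1.eventually_lt ((hlim r hr).const_mul 2) hlt).and
    (Ioo_mem_nhdsGT one_pos)).exists
  exact ⟨β, hβ1, r, hr, hβ⟩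

theorem erfc_sqrt_norm_rpow_add_mem_TBRRadial (hd : 1 ≤ d) {β : ℝ} (hβ : β ∈ Ioo (0 : ℝ) 1) :
    (fun t : E d => erfc √(‖t‖ ^ (2 * β) + ‖t‖ ^ 2)) ∈ TBRRadial d := by
  refine mem_TBRRadial (((isHilbertVariogram_norm_rpow hd hβ.1 hβ.2).add
    isHilbertVariogram_norm_sq).const_mul (a := 8) (by norm_num))
    ⟨fun r => 8 * (r ^ (2 * β) + r ^ 2), ?_, ?_, fun t => rfl⟩ fun t => ?_
  · intro x hx y _ hxy
    have := hβ.1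
    have hx : 0 ≤ x := hx
    simp only
    gcongr
  · exact ((tendsto_rpow_atTop (by linarith [hβ.1])).atTop_add_atTop
      (tendsto_pow_atTop two_ne_zero)).const_mul_atTop (by norm_num)
  · rw [mul_div_cancel_left₀ _ (by norm_num)]

theorem TBRRadial_diff_TMPS_nonempty (hd : 1 ≤ d) : (TBRRadial d \ TMPS d).Nonempty := by
  obtain ⟨β, hβ, r, hr, hlt⟩ := exists_norm_profile_lt
  refine ⟨_, erfc_sqrt_norm_rpow_add_mem_TBRRadial hd hβ, fun h => ?_⟩
  set χ : E d → ℝ := fun t => erfc √(‖t‖ ^ (2 * β) + ‖t‖ ^ 2) with hχ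
  have hcont : Continuous χ := by
    have : Continuous fun t : E d => ‖t‖ ^ (2 * β) :=
      continuous_norm.rpow_const fun _ => Or.inr (by linarith [hβ.1])
    exact continuous_erfc.comp (Real.continuous_sqrt.comp (this.add (by fun_prop)))
  -- Continuity of χ upgrades the almost-everywhere inequality to all t: the set where it holds is
  -- closed and dense.
  have hclosed : IsClosed {t : E d | 2 * χ t ≤ χ ((1 / 2 : ℝ) • t) + χ ((3 / 2 : ℝ) • t)} :=
    isClosed_le (by fun_prop) (by fun_prop)
  have huniv := (Measure.dense_of_ae (ae_two_mul_le_of_mem_TMPS h)).closure_eq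
  rw [hclosed.closure_eq] at huniv
  obtain ⟨t, rfl⟩ := exists_norm_eq hd hr.le
  have ht : t ∈ {t : E d | 2 * χ t ≤ χ ((1 / 2 : ℝ) • t) + χ ((3 / 2 : ℝ) • t)} :=
    huniv ▸ mem_univ t
  simp only [mem_ofPred_eq, hχ, norm_smul, Real.norm_of_nonneg (by norm_num : (0 : ℝ) ≤ 1 / 2),
    Real.norm_of_nonneg (by norm_num : (0 : ℝ) ≤ 3 / 2)] at ht
  exact absurd ht (not_le.2 hlt)

end Witness

/-! ### A Cauchy–Schwarz inequality for radial variograms in high dimension -/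

section Orthant

variable {d : ℕ}

theorem inner_sum_self_of_exchangeable {H : Type*} [NormedAddCommGroup H] [InnerProductSpace ℝ H]
    {N : ℕ} {x : Fin N → H} {a b : ℝ} (ha : ∀ i, inner ℝ (x i) (x i) = a)
    (hb : ∀ i j, i ≠ j → inner ℝ (x i) (x j) = b) :
    inner ℝ (∑ i, x i) (∑ i, x i) = N * (a + (N - 1) * b) := by
  have h : ∀ i, ∑ j, inner ℝ (x i) (x j) = a + (N - 1) * b := fun i => by
    have e : ∀ j, inner ℝ (x i) (x j) = (if i = j then a - b else 0) + b := fun j => by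
      split_ifs with hij
      · rw [← hij, ha]; ring
      · rw [hb i j hij]; ring
    simp only [e, Finset.sum_add_distrib, Finset.sum_ite_eq, Finset.mem_univ, if_true,
      Finset.sum_const, Finset.card_univ, Fintype.card_fin, nsmul_eq_mul]
    ring
  rw [sum_inner]
  simp only [inner_sum, h, Finset.sum_const, Finset.card_univ, Fintype.card_fin, nsmul_eq_mul]

theorem norm_single_sub_single_sq {i j : Fin d} (hij : i ≠ j) (a b : ℝ) :
    ‖(EuclideanSpace.single i a - EuclideanSpace.single j b : E d)‖ ^ 2 = a ^ 2 + b ^ 2 := by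
  rw [norm_sub_sq_real, EuclideanSpace.inner_single_left]
  simp [hij]

/-- N points √T e_i and N points √h e_(N+i) have squared mutual distances 2T, 2h and T + h only.
Cauchy–Schwarz is applied to the sums of their images relative to the image of 0; averaging over N
points suppresses the diagonal terms up to 1/N. -/
theorem IsHilbertVariogram.sq_le_mul {γ : E d → ℝ} (hγ : IsHilbertVariogram γ) {g : ℝ → ℝ}
    (hg : ∀ t, γ t = g (‖t‖ ^ 2)) {N : ℕ} (hN : 1 ≤ N) (hd : 2 * N ≤ d) {T h : ℝ} (hT : 0 ≤ T)
    (hh : 0 ≤ h) :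
    (g T + g h - g (T + h)) ^ 2 ≤
      (2 * g T - (1 - (N : ℝ)⁻¹) * g (2 * T)) * (2 * g h - (1 - (N : ℝ)⁻¹) * g (2 * h)) := by
  obtain ⟨H, _, _, _, c, hc⟩ := hγ
  have hN0 : (N : ℝ) ≠ 0 := by positivity
  have hinner : ∀ s t : E d, inner ℝ (c s - c 0) (c t - c 0) =
      (g (‖s‖ ^ 2) + g (‖t‖ ^ 2) - g (‖s - t‖ ^ 2)) / 2 := fun s t => by
    rw [real_inner_eq_norm_mul_self_add_norm_mul_self_sub_norm_sub_mul_self_div_two,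
      sub_sub_sub_cancel_right, ← sq, ← sq, ← sq, hc, hc, hc, sub_zero, sub_zero, hg, hg, hg]
  have g0 : g 0 = 0 := by
    have := hc 0 0
    simpa [hg] using this.symm
  set p : Fin N → E d := fun i => EuclideanSpace.single ⟨i, by omega⟩ √T with hp
  set q : Fin N → E d := fun i => EuclideanSpace.single ⟨N + i, by omega⟩ √h with hq
  have np : ∀ i, ‖p i‖ ^ 2 = T := fun i => by simp [hp, Real.sq_sqrt hT]
  have nq : ∀ i, ‖q i‖ ^ 2 = h := fun i => by simp [hq, Real.sq_sqrt hh]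
  have npp : ∀ i j, i ≠ j → ‖p i - p j‖ ^ 2 = 2 * T := fun i j hij => by
    rw [hp, norm_single_sub_single_sq (by simpa [Fin.ext_iff] using hij), Real.sq_sqrt hT, two_mul]
  have nqq : ∀ i j, i ≠ j → ‖q i - q j‖ ^ 2 = 2 * h := fun i j hij => by
    rw [hq, norm_single_sub_single_sq (by simpa [Fin.ext_iff] using hij), Real.sq_sqrt hh, two_mul]
  have npq : ∀ i j, ‖p i - q j‖ ^ 2 = T + h := fun i j => by
    rw [hp, hq, norm_single_sub_single_sq (by simp [Fin.ext_iff]; omega), Real.sq_sqrt hT,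
      Real.sq_sqrt hh]
  have hX := inner_sum_self_of_exchangeable (x := fun i => c (p i) - c 0) (a := g T)
    (b := (2 * g T - g (2 * T)) / 2) (fun i => by rw [hinner, np, sub_self, norm_zero, zero_pow two_ne_zero, g0]; ring)
    (fun i j hij => by rw [hinner, np, np, npp i j hij, two_mul (g T)])
  have hY := inner_sum_self_of_exchangeable (x := fun i => c (q i) - c 0) (a := g h)
    (b := (2 * g h - g (2 * h)) / 2) (fun i => by rw [hinner, nq, sub_self, norm_zero, zero_pow two_ne_zero, g0]; ring)
    (fun i j hij => by rw [hinner, nq, nq, nqq i j hij, two_mul (g h)])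
  have hXY : inner ℝ (∑ i, (c (p i) - c 0)) (∑ i, (c (q i) - c 0)) =
      (N : ℝ) ^ 2 * ((g T + g h - g (T + h)) / 2) := by
    simp only [sum_inner, inner_sum, hinner, np, nq, npq, Finset.sum_const, Finset.card_univ,
      Fintype.card_fin, nsmul_eq_mul]
    ring
  have hcs := real_inner_mul_inner_self_le (∑ i, (c (p i) - c 0)) (∑ i, (c (q i) - c 0))
  rw [hX, hY, hXY] at hcs
  -- Each of the three inner products carries a factor N²/2.
  have h4 : (0 : ℝ) < (N : ℝ) ^ 4 / 4 := by positivity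
  refine le_of_mul_le_mul_left ?_ h4
  calc _ = _ := by ring
    _ ≤ _ := hcs
    _ = _ := by field_simp; ring

end Orthant

/-! ### Behaviour of the error function at infinity and at the origin -/

section Asymptotics

/-- Mills ratio, by l'Hôpital's rule against exp(-x²)/x. -/
theorem tendsto_erfc_mul_exp_sq :
    Tendsto (fun x => erfc x * (x * Real.exp (x ^ 2))) atTop (𝓝 (1 / √Real.pi)) := by
  have hg : ∀ x : ℝ, 0 < x → HasDerivAt (fun x => Real.exp (-x ^ 2) / x)
      (-(Real.exp (-x ^ 2) * (2 + (x⁻¹) ^ 2))) x := fun x hx => by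
    have h1 : HasDerivAt (fun x : ℝ => -x ^ 2) (-(2 * x)) x := by
      simpa using (hasDerivAt_pow 2 x).fun_neg
    refine (h1.exp.div (hasDerivAt_id' x) hx.ne').congr_deriv ?_
    field_simp
    ring
  have hlim0 : Tendsto (fun x : ℝ => Real.exp (-x ^ 2)) atTop (𝓝 0) :=
    Real.tendsto_exp_atBot.comp (tendsto_neg_atTop_atBot.comp (tendsto_pow_atTop two_ne_zero))
  have hlim : Tendsto (fun x : ℝ => Real.exp (-x ^ 2) / x) atTop (𝓝 0) :=
    hlim0.div_atTop tendsto_id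
  have hmain := HasDerivAt.lhopital_zero_atTop (l := 𝓝 (1 / √Real.pi))
    (f := erfc) (.of_forall hasDerivAt_erfc)
    ((eventually_gt_atTop 0).mono hg)
    (.of_forall fun x => neg_ne_zero.2 (by positivity)) tendsto_erfc_atTop hlim ?_
  · refine hmain.congr' ?_
    filter_upwards [eventually_gt_atTop 0] with x hx
    rw [Real.exp_neg]
    field_simp
  · have : Tendsto (fun x : ℝ => 2 / √Real.pi / (2 + (x⁻¹) ^ 2)) atTop
        (𝓝 (2 / √Real.pi / (2 + 0 ^ 2))) :=
      tendsto_const_nhds.div (tendsto_const_nhds.add (tendsto_inv_atTop_zero.pow 2)) (by norm_num)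
    convert this.congr fun x => ?_ using 2
    · ring
    · have := (Real.exp_pos (-x ^ 2)).ne'
      have : (2 + (x⁻¹) ^ 2) ≠ 0 := by positivity
      field_simp

/-- The function `∫_0^x exp (-y²) dy`. -/
def gaussPrimitive (x : ℝ) : ℝ := ∫ y in (0 : ℝ)..x, Real.exp (-y ^ 2)

theorem hasDerivAt_gaussPrimitive (x : ℝ) :
    HasDerivAt gaussPrimitive (Real.exp (-x ^ 2)) x :=
  intervalIntegral.integral_hasDerivAt_right (continuous_exp_neg_sq.intervalIntegrable _ _)
    continuous_exp_neg_sq.aestronglyMeasurable.stronglyMeasurableAtFilter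
    continuous_exp_neg_sq.continuousAt

/-- The cubic Taylor coefficient of the primitive, x - x³/3 + …, by l'Hôpital's rule. -/
theorem tendsto_gaussPrimitive_remainder :
    Tendsto (fun x => (x - gaussPrimitive x) / x ^ 3) (𝓝[>] 0) (𝓝 (1 / 3)) := by
  have hE0 : gaussPrimitive 0 = 0 := by simp [gaussPrimitive]
  refine HasDerivAt.lhopital_zero_nhdsGT (f' := fun x => 1 - Real.exp (-x ^ 2))
    (g' := fun x => 3 * x ^ 2) (.of_forall fun x => (hasDerivAt_id x).sub (hasDerivAt_gaussPrimitive x))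
    (.of_forall fun x => by simpa using hasDerivAt_pow 3 x) ?_ ?_ ?_ ?_
  · filter_upwards [self_mem_nhdsWithin] with x hx
    have : 0 < x := hx
    positivity
  · have : ContinuousAt (fun x => x - gaussPrimitive x) 0 :=
      continuousAt_id.sub (hasDerivAt_gaussPrimitive 0).continuousAt
    have := this.tendsto.mono_left (nhdsWithin_le_nhds (s := Ioi 0))
    simpa [hE0] using this
  · have : ContinuousAt (fun x : ℝ => x ^ 3) 0 := by fun_prop
    have := this.tendsto.mono_left (nhdsWithin_le_nhds (s := Ioi 0))
    simpa using this
  · have h1 : HasDerivAt (fun u : ℝ => 1 - Real.exp (-u)) 1 0 := by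
      simpa using ((hasDerivAt_id (0 : ℝ)).neg.exp).const_sub 1
    have h2 := (hasDerivAt_iff_tendsto_slope_zero.1 h1).mono_left
      (nhdsWithin_mono _ fun x (hx : x ∈ Ioi (0 : ℝ)) => (ne_of_gt hx : x ≠ 0))
    have h3 : Tendsto (fun x : ℝ => x ^ 2) (𝓝[>] 0) (𝓝[>] 0) := by
      refine tendsto_nhdsWithin_iff.2 ⟨?_, ?_⟩
      · have : ContinuousAt (fun x : ℝ => x ^ 2) 0 := by fun_prop
        simpa using this.tendsto.mono_left (nhdsWithin_le_nhds (s := Ioi 0))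
      · filter_upwards [self_mem_nhdsWithin] with x hx
        have hx : 0 < x := hx
        exact pow_pos hx 2
    have h4 := (h2.comp h3).mul_const (1 / 3)
    rw [one_mul] at h4
    refine h4.congr fun x => ?_
    simp only [Function.comp_apply, smul_eq_mul, zero_add, neg_zero, Real.exp_zero, sub_self, sub_zero]
    ring

end Asymptotics

/-! ### The squared inverse profile of the mixture and its violation of Cauchy–Schwarz -/

section MixtureProfile

theorem exists_erfc_eq_mixture {r : ℝ} (hr : 0 ≤ r) :
    ∃ x ∈ Icc r (5 * r), erfc x = 1 / 4 * erfc r + 3 / 4 * erfc (5 * r) := by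
  have hle : r ≤ 5 * r := by linarith
  have h := intermediate_value_Icc' hle continuous_erfc.continuousOn
  have hanti := strictAnti_erfc.antitone hle
  exact h ⟨by linarith, by linarith⟩

/-- The solution `x` of `erfc x = erfc r / 4 + 3 erfc (5 r) / 4`. -/
def mixtureRoot (r : ℝ) : ℝ :=
  if hr : 0 ≤ r then (exists_erfc_eq_mixture hr).choose else 0

theorem mixtureRoot_mem {r : ℝ} (hr : 0 ≤ r) : mixtureRoot r ∈ Icc r (5 * r) := by
  rw [mixtureRoot, dif_pos hr]
  exact (exists_erfc_eq_mixture hr).choose_spec.1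

theorem erfc_mixtureRoot {r : ℝ} (hr : 0 ≤ r) :
    erfc (mixtureRoot r) = 1 / 4 * erfc r + 3 / 4 * erfc (5 * r) := by
  rw [mixtureRoot, dif_pos hr]
  exact (exists_erfc_eq_mixture hr).choose_spec.2

theorem gaussPrimitive_mixtureRoot {r : ℝ} (hr : 0 ≤ r) :
    gaussPrimitive (mixtureRoot r) = 1 / 4 * gaussPrimitive r + 3 / 4 * gaussPrimitive (5 * r) := by
  have h := erfc_mixtureRoot hr
  simp only [erfc_eq] at h
  have hc : (0 : ℝ) < 2 / √Real.pi := by positivity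
  refine mul_left_cancel₀ hc.ne' ?_
  unfold gaussPrimitive
  linarith

theorem tendsto_mixtureRoot_zero : Tendsto mixtureRoot (𝓝[>] 0) (𝓝[>] 0) := by
  refine tendsto_nhdsWithin_iff.2 ⟨?_, ?_⟩
  · have h1 : Tendsto (fun r : ℝ => r) (𝓝[>] 0) (𝓝 0) := tendsto_id.mono_left nhdsWithin_le_nhds
    have h5 : Tendsto (fun r : ℝ => 5 * r) (𝓝[>] 0) (𝓝 0) := by simpa using h1.const_mul 5
    have hmem : ∀ᶠ r in 𝓝[>] 0, mixtureRoot r ∈ Icc r (5 * r) := by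
      filter_upwards [self_mem_nhdsWithin] with r hr using mixtureRoot_mem (le_of_lt hr)
    exact tendsto_of_tendsto_of_tendsto_of_le_of_le' h1 h5 (hmem.mono fun _ h => h.1)
      (hmem.mono fun _ h => h.2)
  · filter_upwards [self_mem_nhdsWithin] with r hr
    have hr : 0 < r := hr
    exact hr.trans_le (mixtureRoot_mem hr.le).1

/-- The remainder of the expansion of `gaussPrimitive` at the origin. -/
def gaussRemainder (x : ℝ) : ℝ := (x - gaussPrimitive x) / x ^ 3

/-- The linear terms give 1/4 + 15/4 = 4, and 375/4 is 3/4 · 5³. This isolates the cubic term of the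
root exactly. -/
theorem mixtureRoot_sub_eq {r : ℝ} (hr : 0 < r) :
    (mixtureRoot r - 4 * r) / r ^ 3 = gaussRemainder (mixtureRoot r) * (mixtureRoot r / r) ^ 3 -
      (1 / 4 * gaussRemainder r + 375 / 4 * gaussRemainder (5 * r)) := by
  have hψ : 0 < mixtureRoot r := hr.trans_le (mixtureRoot_mem hr.le).1
  have h := gaussPrimitive_mixtureRoot hr.le
  unfold gaussRemainder
  rw [h]
  field_simp
  ring

theorem tendsto_gaussRemainder_mixture :
    Tendsto (fun r => 1 / 4 * gaussRemainder r + 375 / 4 * gaussRemainder (5 * r)) (𝓝[>] 0)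
      (𝓝 (94 / 3)) := by
  have h5 : Tendsto (fun r : ℝ => 5 * r) (𝓝[>] 0) (𝓝[>] 0) := by
    refine tendsto_nhdsWithin_iff.2 ⟨?_, ?_⟩
    · have h1 : Tendsto (fun r : ℝ => r) (𝓝[>] 0) (𝓝 0) := tendsto_id.mono_left nhdsWithin_le_nhds
      simpa using h1.const_mul 5
    · filter_upwards [self_mem_nhdsWithin] with x hx
      have hx : 0 < x := hx
      exact mul_pos (by norm_num) hx
  have := (tendsto_gaussPrimitive_remainder.const_mul (1 / 4)).add
    ((tendsto_gaussPrimitive_remainder.comp h5).const_mul (375 / 4))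
  norm_num at this
  exact this

/-- The crude bound that the quotient lies in [1, 5] makes the cubic correction, multiplied by r²,
negligible. -/
theorem tendsto_mixtureRoot_div : Tendsto (fun r => mixtureRoot r / r) (𝓝[>] 0) (𝓝 4) := by
  have h1 : Tendsto (fun r : ℝ => r) (𝓝[>] 0) (𝓝 0) := tendsto_id.mono_left nhdsWithin_le_nhds
  have hR : Tendsto (fun r => gaussRemainder (mixtureRoot r)) (𝓝[>] 0) (𝓝 (1 / 3)) :=
    tendsto_gaussPrimitive_remainder.comp tendsto_mixtureRoot_zero
  have hb : Tendsto (fun r => (mixtureRoot r / r) ^ 3 * r ^ 2) (𝓝[>] 0) (𝓝 0) := by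
    have hu : Tendsto (fun r : ℝ => 5 ^ 3 * r ^ 2) (𝓝[>] 0) (𝓝 0) := by
      simpa using (h1.pow 2).const_mul (5 ^ 3)
    refine tendsto_of_tendsto_of_tendsto_of_le_of_le' tendsto_const_nhds hu ?_ ?_ <;>
    · filter_upwards [self_mem_nhdsWithin] with r hr
      have hr : 0 < r := hr
      have hm := mixtureRoot_mem hr.le
      have h0 : 0 ≤ mixtureRoot r / r := div_nonneg (hr.le.trans hm.1) hr.le
      have h5 : mixtureRoot r / r ≤ 5 := (div_le_iff₀ hr).2 hm.2
      first
      | positivity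
      | gcongr
  have h := ((hR.mul hb).sub ((tendsto_gaussRemainder_mixture).mul (h1.pow 2))).add_const 4
  norm_num at h
  refine h.congr' ?_
  filter_upwards [self_mem_nhdsWithin] with r hr
  have hr : 0 < r := hr
  have := mixtureRoot_sub_eq hr
  have e : mixtureRoot r / r = (mixtureRoot r - 4 * r) / r ^ 3 * r ^ 2 + 4 := by
    field_simp
    ring
  rw [this] at e
  rw [show ∀ a b c : ℝ, a * (b * r ^ 2) - c * r ^ 2 + 4 = (a * b - c) * r ^ 2 + 4 from
    fun a b c => by ring, ← e]

/-- The limit is 4³/3 - 94/3 = -10. -/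
theorem tendsto_mixtureRoot_sub :
    Tendsto (fun r => (mixtureRoot r - 4 * r) / r ^ 3) (𝓝[>] 0) (𝓝 (-10)) := by
  have hR : Tendsto (fun r => gaussRemainder (mixtureRoot r)) (𝓝[>] 0) (𝓝 (1 / 3)) :=
    tendsto_gaussPrimitive_remainder.comp tendsto_mixtureRoot_zero
  have h := (hR.mul (tendsto_mixtureRoot_div.pow 3)).sub tendsto_gaussRemainder_mixture
  norm_num at h
  refine h.congr' ?_
  filter_upwards [self_mem_nhdsWithin] with r hr
  rw [mixtureRoot_sub_eq hr]

/-- The squared root as a function of the squared radius. -/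
def mixtureProfile (u : ℝ) : ℝ := mixtureRoot √u ^ 2

/-- Writing ψ² - 16 r² = (ψ - 4r)(ψ + 4r) for the root ψ at r = √u, the limit is -10 · (4 + 4). -/
theorem tendsto_mixtureProfile_zero :
    Tendsto (fun u => (mixtureProfile u - 16 * u) / u ^ 2) (𝓝[>] 0) (𝓝 (-80)) := by
  have hs : Tendsto Real.sqrt (𝓝[>] 0) (𝓝[>] 0) := by
    refine tendsto_nhdsWithin_iff.2 ⟨?_, ?_⟩
    · simpa using Real.continuous_sqrt.continuousAt.tendsto.mono_left
        (nhdsWithin_le_nhds (a := (0 : ℝ)) (s := Ioi 0))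
    · filter_upwards [self_mem_nhdsWithin] with x hx
      exact Real.sqrt_pos.2 hx
  have h := (tendsto_mixtureRoot_sub.mul (tendsto_mixtureRoot_div.add_const 4)).comp hs
  norm_num at h
  refine h.congr' ?_
  filter_upwards [self_mem_nhdsWithin] with u hu
  have hu : 0 < u := hu
  have hsu : 0 < √u := Real.sqrt_pos.2 hu
  have e : u = √u ^ 2 := (Real.sq_sqrt hu.le).symm
  simp only [Function.comp_apply, mixtureProfile]
  generalize mixtureRoot √u = m
  generalize √u = s at *
  subst e
  field_simp
  ring

theorem tendsto_erfc_five_div : Tendsto (fun r => erfc (5 * r) / erfc r) atTop (𝓝 0) := by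
  have h5 : Tendsto (fun r : ℝ => 5 * r) atTop atTop := tendsto_id.const_mul_atTop (by norm_num)
  have hpi : 1 / √Real.pi ≠ 0 := by positivity
  have h := (tendsto_erfc_mul_exp_sq.comp h5).div tendsto_erfc_mul_exp_sq hpi
  rw [div_self hpi] at h
  have hexp : Tendsto (fun r : ℝ => Real.exp (-(24 * r ^ 2)) / 5) atTop (𝓝 0) := by
    have := (Real.tendsto_exp_atBot.comp (tendsto_neg_atTop_atBot.comp
      ((tendsto_pow_atTop (α := ℝ) two_ne_zero).const_mul_atTop (by norm_num : (0 : ℝ) < 24)))).div_const 5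
    simpa using this
  have h' := h.mul hexp
  rw [mul_zero] at h'
  refine h'.congr' ?_
  filter_upwards [eventually_gt_atTop 0] with r hr
  have := (erfc_pos r).ne'
  simp only [Function.comp_apply, Pi.div_apply]
  rw [show (5 * r) ^ 2 = r ^ 2 + 24 * r ^ 2 by ring, Real.exp_add, Real.exp_neg]
  field_simp

theorem tendsto_mixtureRoot_atTop : Tendsto mixtureRoot atTop atTop :=
  tendsto_atTop_mono' _ ((eventually_ge_atTop 0).mono fun _ hr => (mixtureRoot_mem hr).1) tendsto_id

/-- The defining equation is rearranged into a ratio of Mills-normalized quantities, which tends to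
1, and the factors 4, 1 + 3 erfc(5r)/erfc(r) and r/ψ, where ψ is the root. -/
theorem exp_mixtureRoot_sq_sub {r : ℝ} (hr : 0 < r) :
    Real.exp (mixtureRoot r ^ 2 - r ^ 2) =
      4 * (erfc (mixtureRoot r) * (mixtureRoot r * Real.exp (mixtureRoot r ^ 2)) /
        (erfc r * (r * Real.exp (r ^ 2)))) / (1 + 3 * (erfc (5 * r) / erfc r)) *
        (r / mixtureRoot r) := by
  have hψ : 0 < mixtureRoot r := hr.trans_le (mixtureRoot_mem hr.le).1
  have h1 := erfc_pos r
  have h5 := erfc_pos (5 * r)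
  rw [erfc_mixtureRoot hr.le, Real.exp_sub]
  have : erfc r + 3 * erfc (5 * r) ≠ 0 := by positivity
  have e : 1 + 3 * (erfc (5 * r) / erfc r) = (erfc r + 3 * erfc (5 * r)) / erfc r := by
    field_simp
  rw [e, show 1 / 4 * erfc r + 3 / 4 * erfc (5 * r) = 1 / 4 * (erfc r + 3 * erfc (5 * r)) by ring]
  generalize erfc r + 3 * erfc (5 * r) = w at *
  field_simp

/-- At infinity the component erfc(5r) is negligible, so erfc ψ ≈ erfc(r)/4 and e^(ψ² - r²) → 4. The
factor r/ψ needs a bootstrap: a bound on ψ² - r² first, then ψ/r → 1, then the limit. -/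
theorem tendsto_mixtureRoot_sq_sub :
    Tendsto (fun r => mixtureRoot r ^ 2 - r ^ 2) atTop (𝓝 (Real.log 4)) := by
  have hpi : 1 / √Real.pi ≠ 0 := by positivity
  set k : ℝ → ℝ := fun r =>
    4 * (erfc (mixtureRoot r) * (mixtureRoot r * Real.exp (mixtureRoot r ^ 2)) /
        (erfc r * (r * Real.exp (r ^ 2)))) / (1 + 3 * (erfc (5 * r) / erfc r)) with hk
  have hklim : Tendsto k atTop (𝓝 4) := by
    have h := (((tendsto_erfc_mul_exp_sq.comp tendsto_mixtureRoot_atTop).div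
      tendsto_erfc_mul_exp_sq hpi).const_mul 4).div
        ((tendsto_erfc_five_div.const_mul 3).const_add 1) (by norm_num)
    rw [div_self hpi] at h
    norm_num at h
    exact h
  -- The root is at least r, so r/ψ ≤ 1 and any bound above the limit 4 of k suffices; 5 is taken.
  have hbound : ∀ᶠ r in atTop, mixtureRoot r ^ 2 - r ^ 2 ≤ Real.log 5 := by
    filter_upwards [eventually_gt_atTop 0, hklim.eventually_lt_const (show (4 : ℝ) < 5 by norm_num)]
      with r hr hkr
    have hψ := (mixtureRoot_mem hr.le).1
    have hψ0 : 0 < mixtureRoot r := hr.trans_le hψ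
    rw [Real.le_log_iff_exp_le (by norm_num), exp_mixtureRoot_sq_sub hr]
    have h1 : r / mixtureRoot r ≤ 1 := (div_le_one hψ0).2 hψ
    have h0 : 0 ≤ r / mixtureRoot r := by positivity
    change k r * _ ≤ 5
    nlinarith
  have hsq : Tendsto (fun r => (mixtureRoot r / r) ^ 2) atTop (𝓝 1) := by
    have hu : Tendsto (fun r : ℝ => 1 + Real.log 5 / r ^ 2) atTop (𝓝 1) := by
      simpa using (tendsto_const_nhds (x := Real.log 5)).div_atTop
        (tendsto_pow_atTop (α := ℝ) two_ne_zero) |>.const_add 1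
    refine tendsto_of_tendsto_of_tendsto_of_le_of_le' tendsto_const_nhds hu ?_ ?_
    · filter_upwards [eventually_gt_atTop 0] with r hr
      exact one_le_pow₀ ((one_le_div hr).2 (mixtureRoot_mem hr.le).1)
    · filter_upwards [eventually_gt_atTop 0, hbound] with r hr hb
      rw [div_pow, div_le_iff₀ (by positivity)]
      field_simp
      linarith
  have hratio : Tendsto (fun r => r / mixtureRoot r) atTop (𝓝 1) := by
    have h := (Real.continuous_sqrt.continuousAt.tendsto.comp hsq).inv₀ (by simp)
    simp only [Real.sqrt_one, inv_one] at h
    refine h.congr' ?_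
    filter_upwards [eventually_gt_atTop 0] with r hr
    have hψ0 : 0 < mixtureRoot r := hr.trans_le (mixtureRoot_mem hr.le).1
    simp only [Function.comp_apply]
    rw [Real.sqrt_sq (by positivity), inv_div]
  have h := (Real.continuousAt_log (by norm_num : (4 * 1 : ℝ) ≠ 0)).tendsto.comp (hklim.mul hratio)
  rw [mul_one] at h
  refine h.congr' ?_
  filter_upwards [eventually_gt_atTop 0] with r hr
  simp only [Function.comp_apply]
  rw [hk, ← exp_mixtureRoot_sq_sub hr, Real.log_exp]

theorem tendsto_mixtureProfile_atTop :
    Tendsto (fun u => mixtureProfile u - u) atTop (𝓝 (Real.log 4)) := by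
  refine (tendsto_mixtureRoot_sq_sub.comp Real.tendsto_sqrt_atTop).congr' ?_
  filter_upwards [eventually_ge_atTop 0] with u hu
  simp only [Function.comp_apply, mixtureProfile, Real.sq_sqrt hu]

/-- After division by h² the sides tend to log 4 · (-160 + 320) = 160 log 4 and (16 - 1)² = 225. -/
theorem exists_small_radius :
    ∃ h : ℝ, 0 < h ∧ Real.log 4 * (2 * mixtureProfile h - mixtureProfile (2 * h)) <
      (mixtureProfile h - h) ^ 2 := by
  set a : ℝ → ℝ := fun u => (mixtureProfile u - 16 * u) / u ^ 2 with ha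
  have h1 : Tendsto (fun r : ℝ => r) (𝓝[>] 0) (𝓝 0) := tendsto_id.mono_left nhdsWithin_le_nhds
  have h2 : Tendsto (fun r : ℝ => 2 * r) (𝓝[>] 0) (𝓝[>] 0) := by
    refine tendsto_nhdsWithin_iff.2 ⟨by simpa using h1.const_mul 2, ?_⟩
    filter_upwards [self_mem_nhdsWithin] with x hx
    have hx : 0 < x := hx
    exact mul_pos (by norm_num) hx
  have hlhs := ((tendsto_mixtureProfile_zero.const_mul 2).sub
    ((tendsto_mixtureProfile_zero.comp h2).const_mul 4)).const_mul (Real.log 4)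
  have hrhs := (((tendsto_mixtureProfile_zero.mul h1).const_add 15).pow 2)
  -- The inequality 160 log 4 < 225 requires log 4 < 1.40625, a narrow margin since log 4 ≈ 1.386.
  have hlog : Real.log 4 < 1.4 := by
    rw [show (4 : ℝ) = 2 ^ 2 by norm_num, Real.log_pow]
    have := Real.log_two_lt_d9
    push_cast
    linarith
  obtain ⟨h, hlt, hh⟩ := ((hlhs.eventually_lt hrhs (by norm_num; linarith)).and
    self_mem_nhdsWithin).exists
  have hh : 0 < h := hh
  refine ⟨h, hh, ?_⟩
  have := mul_lt_mul_of_pos_right hlt (pow_pos hh 2)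
  simp only [Function.comp_apply] at this
  refine lt_of_eq_of_lt ?_ (this.trans_eq ?_)
  · field_simp
    ring
  · field_simp
    ring

theorem exists_violating_parameters :
    ∃ N : ℕ, 1 ≤ N ∧ ∃ T h : ℝ, 0 ≤ T ∧ 0 ≤ h ∧
      (2 * mixtureProfile T - (1 - (N : ℝ)⁻¹) * mixtureProfile (2 * T)) *
        (2 * mixtureProfile h - (1 - (N : ℝ)⁻¹) * mixtureProfile (2 * h)) <
      (mixtureProfile T + mixtureProfile h - mixtureProfile (T + h)) ^ 2 := by
  obtain ⟨h, hh, hlt⟩ := exists_small_radius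
  have h2 : Tendsto (fun T : ℝ => 2 * T) atTop atTop := tendsto_id.const_mul_atTop (by norm_num)
  have hsh : Tendsto (fun T : ℝ => T + h) atTop atTop := tendsto_atTop_add_const_right _ _ tendsto_id
  have hA : Tendsto (fun T => 2 * mixtureProfile T - mixtureProfile (2 * T)) atTop
      (𝓝 (Real.log 4)) := by
    have := (tendsto_mixtureProfile_atTop.const_mul 2).sub (tendsto_mixtureProfile_atTop.comp h2)
    rw [show 2 * Real.log 4 - Real.log 4 = Real.log 4 by ring] at this
    refine this.congr fun T => ?_
    simp only [Function.comp_apply]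
    ring
  have hB : Tendsto (fun T => mixtureProfile T + mixtureProfile h - mixtureProfile (T + h)) atTop
      (𝓝 (mixtureProfile h - h)) := by
    have := (tendsto_mixtureProfile_atTop.sub (tendsto_mixtureProfile_atTop.comp hsh)).add_const
      (mixtureProfile h - h)
    rw [sub_self, zero_add] at this
    refine this.congr fun T => ?_
    simp only [Function.comp_apply]
    ring
  -- T is fixed first, for the limiting inequality without the 1/N terms; strictness then leaves
  -- room for a finite N.
  obtain ⟨T, hT, hT0⟩ := (((hA.mul_const _).eventually_lt (hB.pow 2) hlt).and
    (eventually_ge_atTop 0)).exists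
  have hinv : Tendsto (fun N : ℕ => 1 - (N : ℝ)⁻¹) atTop (𝓝 (1 - 0)) :=
    tendsto_const_nhds.sub tendsto_inv_atTop_nhds_zero_nat
  have hN := (((hinv.mul_const (mixtureProfile (2 * T))).const_sub (2 * mixtureProfile T)).mul
    ((hinv.mul_const (mixtureProfile (2 * h))).const_sub (2 * mixtureProfile h)))
  rw [sub_zero, one_mul, one_mul] at hN
  obtain ⟨N, hN, hN1⟩ := ((hN.eventually_lt_const hT).and (eventually_ge_atTop 1)).exists
  exact ⟨N, hN1, T, h, hT0, hh.le, hN⟩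

theorem exists_dimension_erfc_mixture_notMem_TBR :
    ∃ d₀ : ℕ, 1 ≤ d₀ ∧ ∀ d : ℕ, d₀ ≤ d →
      (fun t : E d => 1 / 4 * erfc ‖t‖ + 3 / 4 * erfc (5 * ‖t‖)) ∉ TBR d := by
  obtain ⟨N, hN, T, h, hT, hh, hlt⟩ := exists_violating_parameters
  -- The 2N orthogonal axes of the configuration set the dimension bound.
  refine ⟨2 * N, by omega, fun d hd hmem => ?_⟩
  obtain ⟨γ, hγ, hχ⟩ := mem_TBR_iff.1 hmem
  have hg : ∀ t, 8⁻¹ * γ t = mixtureProfile (‖t‖ ^ 2) := fun t => by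
    -- Injectivity of erfc forces the profile: a variogram producing the mixture must be 8 times the
    -- squared root.
    have h1 : mixtureRoot ‖t‖ = √(γ t / 8) :=
      strictAnti_erfc.injective ((erfc_mixtureRoot (norm_nonneg t)).trans (hχ t))
    rw [mixtureProfile, Real.sqrt_sq (norm_nonneg t), h1,
      Real.sq_sqrt (div_nonneg (hγ.nonneg t) (by norm_num)), div_eq_inv_mul]
  exact (((hγ.const_mul (a := 8⁻¹) (by norm_num)).sq_le_mul hg hN hd hT hh).trans_lt hlt).false

end MixtureProfile

end

end TailCorr

theorem proposition4p1 :
    (∀ d : ℕ, 1 ≤ d →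
      -- (a)
      ((∀ α : ℝ,
          ((fun t : TailCorr.E d => TailCorr.erfc (‖t‖ ^ α)) ∈ TailCorr.TBR d ↔
            α ∈ Set.Ioc (0 : ℝ) 1) ∧
          ((fun t : TailCorr.E d => TailCorr.erfc (‖t‖ ^ α)) ∈ TailCorr.TBRRadial d ↔
            α ∈ Set.Ioc (0 : ℝ) 1)) ∧
        (TailCorr.TBRRadial d \ TailCorr.TMPS d).Nonempty) ∧
      -- (b)
      ((∀ χ ∈ TailCorr.TVBR d, ¬ HasCompactSupport χ) ∧
        (TailCorr.TM3r d \ TailCorr.TVBR d).Nonempty)) ∧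
    -- (c)
    (∃ d₀ : ℕ, 1 ≤ d₀ ∧ ∀ d : ℕ, d₀ ≤ d →
      (fun r : NNReal => 1 / 4 * TailCorr.erfc r + 3 / 4 * TailCorr.erfc (5 * r)) ∈
          TailCorr.TM3rInfty ∧
        (fun t : TailCorr.E d => 1 / 4 * TailCorr.erfc ‖t‖ + 3 / 4 * TailCorr.erfc (5 * ‖t‖)) ∉
          TailCorr.TBR d) := by
  obtain ⟨d₀, hd₀, h⟩ := TailCorr.exists_dimension_erfc_mixture_notMem_TBR
  refine ⟨fun d hd => ⟨⟨fun α => ⟨⟨TailCorr.exponent_mem_of_mem_TBR hd, fun hα =>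
    TailCorr.TBRRadial_subset d (TailCorr.erfc_norm_rpow_mem_TBRRadial hd hα)⟩,
    fun hα => TailCorr.exponent_mem_of_mem_TBR hd (TailCorr.TBRRadial_subset d hα),
    TailCorr.erfc_norm_rpow_mem_TBRRadial hd⟩, TailCorr.TBRRadial_diff_TMPS_nonempty hd⟩,
    fun _ hχ => TailCorr.not_hasCompactSupport_of_mem_TVBR hd hχ,
    TailCorr.TM3r_diff_TVBR_nonempty hd⟩, d₀, hd₀, fun d hd =>
    ⟨TailCorr.erfc_mixture_mem_TM3rInfty, h d hd⟩⟩
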